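/- Let $(\mathcal V,\otimes,\mathbf 1,[-,-])$ be a complete and cocomplete closed symmetric monoidal category, let $X$ be a set, and let $S(X)$ be the free symmetric monoidal category on $X$; it is a groupoid, and is identified with its opposite. A (colored) operad $P$ in $\mathcal V$ with set of colors $X$ consists of functors $P(-;y):S(X)\to\mathcal V$ ($y\in X$), identities $\mathbf 1\to P(y;y)$ and compositions $P(w;y)\otimes P(x;w)\to P(x;y)$ (for $x,w\in S(X)$), natural in $x$, dinatural in $w$, associative and unital, where for $w=w_1\otimes\dots\otimes w_n$ one puts $P(-;w)=P(-;w_1)\otimes\dots\otimes P(-;w_n)$ (Day convolution). For $N:S(X)\to\mathcal V$ put $(\mathbb P^\wedge N)(w)=\int_{x\in S(X)}[P(x;w),N(x)]$. For $C\in\mathcal V^X$ let $\epsilon C:S(X)\to\mathcal V$ be the symmetric monoidal functor $x_1\otimes\dots\otimes x_n\mapsto C(x_1)\otimes\dots\otimes C(x_n)$, and let $\pi:\mathcal V^{S(X)}\to\mathcal V^X$ be the restriction to the words with one letter. Put $P^\wedge_n=\pi(\mathbb P^\wedge)^n\epsilon$, so that $P^\wedge_1(C)(y)=\int_{x}[P(x;y),(\epsilon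 C)(x)]$. The operad structure gives $\mathbb P^\wedge$ a comultiplication and a counit, hence degeneracies $P^\wedge_n\to P^\wedge_{n+1}$ and faces $P^\wedge_{n+1}\to P^\wedge_n$; the lax symmetric monoidal structures of the functors $(\mathbb P^\wedge)^n\epsilon C$ give maps $\alpha_{m,n}$ from the composite of $P^\wedge_m$ and $P^\wedge_n$ to $P^\wedge_{m+n}$, and $\mathrm{Id}=P^\wedge_0$. A *lax comonad* on a category $\mathcal C$ is a lax monoidal functor from $(\Delta_+^{op},+)$ to the endofunctors of $\mathcal C$ with composition, where $\Delta_+$ is the category of finite ordinals; morphisms of lax comonads are monoidal natural transformations; a comonad $R$ is regarded as the lax comonad $n\mapsto R^n$. Define a tower $\cdots\to Q_2\xrightarrow{\chi_2}Q_1\xrightarrow{\chi_1}Q_0=P^\wedge_1$ of endofunctors of $\mathcal V^X$, with maps $\delta_k:Q_k\to Q_{k-1}Q_{k-1}$: $Q_1$ is the pullback of $P^\wedge_1\to P^\wedge_2\xleftarrow{\alpha_{1,1}}P^\wedge_1P^\wedge_1$, with projections $\chi_1,\delta_1$, and $Q_{k+1}$, with projections $\chi_{k+1}$ and $\delta_{k+1}$,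 is the limit of the diagram formed by $Q_k\xrightarrow{\delta_k}(Q_{k-1})^2\xleftarrow{(\chi_k)^2}(Q_k)^2$ and by the two maps $\delta_k\chi_k,\ \chi_k\delta_k:(Q_k)^2\rightrightarrows(Q_{k-1})^3$. Let $Q_\infty=\lim_kQ_k$, with projections $p_k:Q_\infty\to Q_k$. **Theorem.** Assume that 1. for all families $(A_i,A'_i)_{i\in I}$, $(B_j,B'_j)_{j\in J}$ of pairs of objects of $\mathcal V$ indexed by sets, such that there are a morphism $\mathbf 1\to A_i$ for some $i$ and a morphism $\mathbf 1\to B_j$ for some $j$, the canonical map $\prod_i[A_i,A'_i]\otimes\prod_j[B_j,B'_j]\to\prod_{i,j}[A_i\otimes B_j,A'_i\otimes B'_j]$ is a monomorphism; 2. for each object $A$, the functor $A\otimes-$ preserves monomorphisms and preserves the limits of the towers $\cdots\to A_2\to A_1\to A_0$ of monomorphisms. (Both conditions hold in sets, in every complete and cocomplete cartesian closed category, and in vector spaces and chain complexes over a field.) Then $P^\wedge$ is a lax comonad, and $Q_\infty$ has a structure of comonad with counit $Q_\infty\xrightarrow{p_0}P^\wedge_1\to\mathrm{Id}$ and with comultiplication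 $\delta$ satisfying $(p_kp_k)\circ\delta=\delta_{k+1}\circ p_{k+1}:Q_\infty\to Q_kQ_k$ for all $k\ge0$. Moreover $p_0:Q_\infty\to P^\wedge_1$ is the component at $1$ of a morphism of lax comonads $\Phi:Q_\infty\to P^\wedge$, and $\Phi$ is the coreflection of $P^\wedge$ into comonads: for every comonad $R$ on $\mathcal V^X$ and every morphism of lax comonads $\Psi:R\to P^\wedge$ there is a unique morphism of comonads $f:R\to Q_\infty$ with $\Phi\circ f=\Psi$. -/

import Mathlib

set_option linter.unusedSectionVars false
set_option linter.style.haveILetI false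

universe v u v' u'

open CategoryTheory MonoidalCategory Limits

namespace ColoredOperad

/-! ### The free symmetric monoidal category on a set of colors -/

/-- Objects of the free symmetric monoidal category `S(X)` on a set `X`: words in the elements
of `X`, with their bracketing. -/
inductive Word (X : Type u) : Type u
  | of : X → Word X
  | unit : Word X
  | tensor : Word X → Word X → Word X

namespace Word

variable {X : Type u}

/-- Formal composites of identities, associators, unitors and symmetries. -/
inductive FHom : Word X → Word X → Type u
  | id (a) : FHom a a
  | comp {a b c} (f : FHom a b) (g : FHom b c) : FHom a c
  | whiskerLeft (a : Word X) {b c} (f : FHom b c) : FHom (a.tensor b) (a.tensor c)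
  | whiskerRight {a b} (f : FHom a b) (c : Word X) : FHom (a.tensor c) (b.tensor c)
  | tensor {a b c d} (f : FHom a c) (g : FHom b d) : FHom (a.tensor b) (c.tensor d)
  | assocHom (a b c : Word X) : FHom ((a.tensor b).tensor c) (a.tensor (b.tensor c))
  | assocInv (a b c : Word X) : FHom (a.tensor (b.tensor c)) ((a.tensor b).tensor c)
  | leftHom (a) : FHom (unit.tensor a) a
  | leftInv (a) : FHom a (unit.tensor a)
  | rightHom (a : Word X) : FHom (a.tensor unit) a
  | rightInv (a : Word X) : FHom a (a.tensor unit)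
  | swap (a b : Word X) : FHom (a.tensor b) (b.tensor a)

/-- The congruence generated by the axioms of symmetric monoidal categories. -/
inductive Rel : ∀ {a b : Word X}, FHom a b → FHom a b → Prop
  | refl {a b} (f : FHom a b) : Rel f f
  | symm {a b} (f g : FHom a b) : Rel f g → Rel g f
  | trans {a b} {f g h : FHom a b} : Rel f g → Rel g h → Rel f h
  | comp {a b c} {f f' : FHom a b} {g g' : FHom b c} :
      Rel f f' → Rel g g' → Rel (f.comp g) (f'.comp g')
  | whiskerLeft (a) {b c} (f f' : FHom b c) :
      Rel f f' → Rel (f.whiskerLeft a) (f'.whiskerLeft a)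
  | whiskerRight {b c} (f f' : FHom b c) (a) :
      Rel f f' → Rel (f.whiskerRight a) (f'.whiskerRight a)
  | tensor {a b c d} {f f' : FHom a b} {g g' : FHom c d} :
      Rel f f' → Rel g g' → Rel (f.tensor g) (f'.tensor g')
  | comp_id {a b} (f : FHom a b) : Rel (f.comp (FHom.id _)) f
  | id_comp {a b} (f : FHom a b) : Rel ((FHom.id _).comp f) f
  | assoc {a b c d} (f : FHom a b) (g : FHom b c) (h : FHom c d) :
      Rel ((f.comp g).comp h) (f.comp (g.comp h))
  | tensorHom_def {a b c d} (f : FHom a b) (g : FHom c d) :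
      Rel (f.tensor g) ((f.whiskerRight c).comp (g.whiskerLeft b))
  | id_tensorHom_id {a b} : Rel ((FHom.id a).tensor (FHom.id b)) (FHom.id _)
  | tensorHom_comp_tensorHom {a₁ b₁ c₁ a₂ b₂ c₂ : Word X} (f₁ : FHom a₁ b₁) (f₂ : FHom a₂ b₂)
      (g₁ : FHom b₁ c₁) (g₂ : FHom b₂ c₂) :
      Rel ((f₁.tensor f₂).comp (g₁.tensor g₂)) ((f₁.comp g₁).tensor (f₂.comp g₂))
  | whiskerLeft_id (a b) : Rel ((FHom.id b).whiskerLeft a) (FHom.id (a.tensor b))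
  | id_whiskerRight (a b) : Rel ((FHom.id a).whiskerRight b) (FHom.id (a.tensor b))
  | assoc_hom_inv {a b c} : Rel ((FHom.assocHom a b c).comp (FHom.assocInv a b c)) (FHom.id _)
  | assoc_inv_hom {a b c} : Rel ((FHom.assocInv a b c).comp (FHom.assocHom a b c)) (FHom.id _)
  | assoc_naturality {a₁ a₂ a₃ b₁ b₂ b₃}
      (f₁ : FHom a₁ b₁) (f₂ : FHom a₂ b₂) (f₃ : FHom a₃ b₃) :
      Rel (((f₁.tensor f₂).tensor f₃).comp (FHom.assocHom b₁ b₂ b₃))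
        ((FHom.assocHom a₁ a₂ a₃).comp (f₁.tensor (f₂.tensor f₃)))
  | right_hom_inv {a} : Rel ((FHom.rightHom a).comp (FHom.rightInv a)) (FHom.id _)
  | right_inv_hom {a} : Rel ((FHom.rightInv a).comp (FHom.rightHom a)) (FHom.id _)
  | right_naturality {a b} (f : FHom a b) :
      Rel ((f.whiskerRight unit).comp (FHom.rightHom b)) ((FHom.rightHom a).comp f)
  | left_hom_inv {a} : Rel ((FHom.leftHom a).comp (FHom.leftInv a)) (FHom.id _)
  | left_inv_hom {a} : Rel ((FHom.leftInv a).comp (FHom.leftHom a)) (FHom.id _)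
  | left_naturality {a b} (f : FHom a b) :
      Rel ((f.whiskerLeft unit).comp (FHom.leftHom b)) ((FHom.leftHom a).comp f)
  | pentagon {a b c d} :
      Rel (((FHom.assocHom a b c).whiskerRight d).comp
          ((FHom.assocHom a (b.tensor c) d).comp ((FHom.assocHom b c d).whiskerLeft a)))
        ((FHom.assocHom (a.tensor b) c d).comp (FHom.assocHom a b (c.tensor d)))
  | triangle {a b} :
      Rel ((FHom.assocHom a unit b).comp ((FHom.leftHom b).whiskerLeft a))
        ((FHom.rightHom a).whiskerRight b)
  | swap_swap {a b} : Rel ((FHom.swap a b).comp (FHom.swap b a)) (FHom.id _)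
  | swap_naturality_right (a) {b c} (f : FHom b c) :
      Rel ((f.whiskerLeft a).comp (FHom.swap a c)) ((FHom.swap a b).comp (f.whiskerRight a))
  | swap_naturality_left {a b} (f : FHom a b) (c) :
      Rel ((f.whiskerRight c).comp (FHom.swap b c)) ((FHom.swap a c).comp (f.whiskerLeft c))
  | hexagon_forward {a b c} :
      Rel ((FHom.assocHom a b c).comp ((FHom.swap a (b.tensor c)).comp (FHom.assocHom b c a)))
        (((FHom.swap a b).whiskerRight c).comp
          ((FHom.assocHom b a c).comp ((FHom.swap a c).whiskerLeft b)))
  | hexagon_reverse {a b c} :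
      Rel ((FHom.assocInv a b c).comp ((FHom.swap (a.tensor b) c).comp (FHom.assocInv c a b)))
        (((FHom.swap b c).whiskerLeft a).comp
          ((FHom.assocInv a c b).comp ((FHom.swap a c).whiskerRight b)))

instance setoidFHom (a b : Word X) : Setoid (FHom a b) :=
  ⟨Rel, ⟨Rel.refl, Rel.symm _ _, Rel.trans⟩⟩

/-- The category `S(X)`: its morphisms are the formal composites, modulo the axioms of symmetric
monoidal categories. -/
instance category : Category.{u} (Word X) where
  Hom a b := Quotient (setoidFHom a b)
  id a := ⟦FHom.id a⟧
  comp := Quotient.map₂ FHom.comp (fun _ _ hf _ _ hg ↦ Rel.comp hf hg)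
  id_comp := by rintro _ _ ⟨f⟩; exact Quotient.sound (Rel.id_comp f)
  comp_id := by rintro _ _ ⟨f⟩; exact Quotient.sound (Rel.comp_id f)
  assoc := by rintro _ _ _ _ ⟨f⟩ ⟨g⟩ ⟨h⟩; exact Quotient.sound (Rel.assoc f g h)

instance monoidalCategory : MonoidalCategory (Word X) where
  tensorObj a b := Word.tensor a b
  tensorUnit := Word.unit
  tensorHom := Quotient.map₂ FHom.tensor (fun _ _ hf _ _ hg ↦ Rel.tensor hf hg)
  whiskerLeft a _ _ f := Quot.map (fun f ↦ FHom.whiskerLeft a f) (fun f f' ↦ .whiskerLeft a f f') f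
  whiskerRight f b :=
    Quot.map (fun f ↦ FHom.whiskerRight f b) (fun f f' ↦ .whiskerRight f f' b) f
  associator a b c := ⟨⟦FHom.assocHom a b c⟧, ⟦FHom.assocInv a b c⟧,
    Quotient.sound Rel.assoc_hom_inv, Quotient.sound Rel.assoc_inv_hom⟩
  leftUnitor a := ⟨⟦FHom.leftHom a⟧, ⟦FHom.leftInv a⟧,
    Quotient.sound Rel.left_hom_inv, Quotient.sound Rel.left_inv_hom⟩
  rightUnitor a := ⟨⟦FHom.rightHom a⟧, ⟦FHom.rightInv a⟧,
    Quotient.sound Rel.right_hom_inv, Quotient.sound Rel.right_inv_hom⟩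
  tensorHom_def := by rintro _ _ _ _ ⟨f⟩ ⟨g⟩; exact Quotient.sound (Rel.tensorHom_def _ _)
  id_tensorHom_id _ _ := Quot.sound Rel.id_tensorHom_id
  tensorHom_comp_tensorHom := by
    rintro _ _ _ _ _ _ ⟨f₁⟩ ⟨f₂⟩ ⟨g₁⟩ ⟨g₂⟩
    exact Quotient.sound (Rel.tensorHom_comp_tensorHom _ _ _ _)
  whiskerLeft_id a b := Quot.sound (Rel.whiskerLeft_id a b)
  id_whiskerRight a b := Quot.sound (Rel.id_whiskerRight a b)
  associator_naturality := by
    rintro _ _ _ _ _ _ ⟨f₁⟩ ⟨f₂⟩ ⟨f₃⟩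
    exact Quotient.sound (Rel.assoc_naturality _ _ _)
  leftUnitor_naturality := by rintro _ _ ⟨f⟩; exact Quotient.sound (Rel.left_naturality _)
  rightUnitor_naturality := by rintro _ _ ⟨f⟩; exact Quotient.sound (Rel.right_naturality _)
  pentagon _ _ _ _ := Quotient.sound Rel.pentagon
  triangle _ _ := Quotient.sound Rel.triangle

instance symmetricCategory : SymmetricCategory (Word X) where
  braiding a b := ⟨⟦FHom.swap a b⟧, ⟦FHom.swap b a⟧,
    Quotient.sound Rel.swap_swap, Quotient.sound Rel.swap_swap⟩
  braiding_naturality_right := by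
    rintro _ _ _ ⟨f⟩; exact Quotient.sound (Rel.swap_naturality_right _ f)
  braiding_naturality_left := by
    rintro _ _ ⟨f⟩ _; exact Quotient.sound (Rel.swap_naturality_left f _)
  hexagon_forward _ _ _ := Quotient.sound Rel.hexagon_forward
  hexagon_reverse _ _ _ := Quotient.sound Rel.hexagon_reverse
  symmetry _ _ := Quotient.sound Rel.swap_swap

theorem hom_induction {motive : ∀ {a b : Word X}, (a ⟶ b) → Prop}
    (id : ∀ a : Word X, motive (𝟙 a))
    (comp : ∀ {a b c : Word X} (f : a ⟶ b) (g : b ⟶ c), motive f → motive g → motive (f ≫ g))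
    (whiskerLeft : ∀ (a : Word X) {b c : Word X} (f : b ⟶ c), motive f → motive (a ◁ f))
    (whiskerRight : ∀ {a b : Word X} (f : a ⟶ b) (c : Word X), motive f → motive (f ▷ c))
    (assocHom : ∀ a b c : Word X, motive (α_ a b c).hom)
    (assocInv : ∀ a b c : Word X, motive (α_ a b c).inv)
    (leftHom : ∀ a : Word X, motive (λ_ a).hom) (leftInv : ∀ a : Word X, motive (λ_ a).inv)
    (rightHom : ∀ a : Word X, motive (ρ_ a).hom) (rightInv : ∀ a : Word X, motive (ρ_ a).inv)
    (swap : ∀ a b : Word X, motive (β_ a b).hom) {a b : Word X} (f : a ⟶ b) : motive f := by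
  induction f using Quotient.inductionOn with | _ f
  induction f with
  | id a => exact id a
  | comp f g hf hg => exact comp _ _ hf hg
  | whiskerLeft a f hf => exact whiskerLeft a _ hf
  | whiskerRight f a hf => exact whiskerRight _ a hf
  | @tensor a b c d f g hf hg =>
      have h : (Quotient.mk _ (f.tensor g) : (a ⊗ b : Word X) ⟶ (c ⊗ d : Word X)) =
          MonoidalCategoryStruct.whiskerRight (C := Word X) (Quotient.mk _ f) b ≫
            MonoidalCategoryStruct.whiskerLeft (C := Word X) c (Quotient.mk _ g) :=
        Quotient.sound (Rel.tensorHom_def f g)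
      exact h ▸ comp _ _ (whiskerRight _ _ hf) (whiskerLeft _ _ hg)
  | assocHom a b c => exact assocHom a b c
  | assocInv a b c => exact assocInv a b c
  | leftHom a => exact leftHom a
  | leftInv a => exact leftInv a
  | rightHom a => exact rightHom a
  | rightInv a => exact rightInv a
  | swap a b => exact swap a b

/-- `S(X)` is a groupoid. -/
instance isIso_hom {a b : Word X} (f : a ⟶ b) : IsIso f := by
  induction f using hom_induction with
  | id a => infer_instance
  | comp f g hf hg => infer_instance
  | whiskerLeft a f hf => infer_instance
  | whiskerRight f a hf => infer_instance
  | assocHom a b c => infer_instance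
  | assocInv a b c => infer_instance
  | leftHom a => infer_instance
  | leftInv a => infer_instance
  | rightHom a => infer_instance
  | rightInv a => infer_instance
  | swap a b => infer_instance

section Lift

variable {M : Type u'} [Category.{v'} M] [MonoidalCategory M] [SymmetricCategory M] (φ : X → M)

/-- The tensor product in `M` of the objects `φ x` for the letters `x` of a word. -/
def liftObj : Word X → M
  | of x => φ x
  | unit => 𝟙_ M
  | tensor a b => liftObj a ⊗ liftObj b

/-- Interpretation of formal composites. -/
def liftFHom : ∀ {a b : Word X}, FHom a b → (liftObj φ a ⟶ liftObj φ b)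
  | _, _, .id _ => 𝟙 _
  | _, _, .comp f g => liftFHom f ≫ liftFHom g
  | _, _, .whiskerLeft a f => liftObj φ a ◁ liftFHom f
  | _, _, .whiskerRight f a => liftFHom f ▷ liftObj φ a
  | _, _, .tensor f g => liftFHom f ⊗ₘ liftFHom g
  | _, _, .assocHom _ _ _ => (α_ _ _ _).hom
  | _, _, .assocInv _ _ _ => (α_ _ _ _).inv
  | _, _, .leftHom _ => (λ_ _).hom
  | _, _, .leftInv _ => (λ_ _).inv
  | _, _, .rightHom _ => (ρ_ _).hom
  | _, _, .rightInv _ => (ρ_ _).inv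
  | _, _, .swap _ _ => (β_ _ _).hom

theorem liftFHom_rel {a b : Word X} {f g : FHom a b} (h : Rel f g) :
    liftFHom φ f = liftFHom φ g := by
  induction h with
  | refl => rfl
  | symm _ _ _ h => exact h.symm
  | trans _ _ h h' => exact h.trans h'
  | comp _ _ h h' => exact congrArg₂ (· ≫ ·) h h'
  | whiskerLeft _ _ _ _ h => exact congrArg (_ ◁ ·) h
  | whiskerRight _ _ _ _ h => exact congrArg (· ▷ _) h
  | tensor _ _ h h' => exact congrArg₂ (· ⊗ₘ ·) h h'
  | comp_id => exact Category.comp_id _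
  | id_comp => exact Category.id_comp _
  | assoc => exact Category.assoc _ _ _
  | tensorHom_def => exact MonoidalCategory.tensorHom_def _ _
  | id_tensorHom_id => exact MonoidalCategory.id_tensorHom_id _ _
  | tensorHom_comp_tensorHom => exact MonoidalCategory.tensorHom_comp_tensorHom _ _ _ _
  | whiskerLeft_id => exact MonoidalCategory.whiskerLeft_id _ _
  | id_whiskerRight => exact MonoidalCategory.id_whiskerRight _ _
  | assoc_hom_inv => exact Iso.hom_inv_id _
  | assoc_inv_hom => exact Iso.inv_hom_id _
  | assoc_naturality => exact MonoidalCategory.associator_naturality _ _ _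
  | right_hom_inv => exact Iso.hom_inv_id _
  | right_inv_hom => exact Iso.inv_hom_id _
  | right_naturality => exact MonoidalCategory.rightUnitor_naturality _
  | left_hom_inv => exact Iso.hom_inv_id _
  | left_inv_hom => exact Iso.inv_hom_id _
  | left_naturality => exact MonoidalCategory.leftUnitor_naturality _
  | pentagon => exact MonoidalCategory.pentagon _ _ _ _
  | triangle => exact MonoidalCategory.triangle _ _
  | swap_swap => exact SymmetricCategory.symmetry _ _
  | swap_naturality_right => exact BraidedCategory.braiding_naturality_right _ _
  | swap_naturality_left => exact BraidedCategory.braiding_naturality_left _ _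
  | hexagon_forward => exact BraidedCategory.hexagon_forward _ _ _
  | hexagon_reverse => exact BraidedCategory.hexagon_reverse _ _ _

/-- The functor `S(X) ⥤ M` induced by a family of objects of a symmetric monoidal category. -/
def lift : Word X ⥤ M where
  obj := liftObj φ
  map {_ _} := Quotient.lift (liftFHom φ) (fun _ _ h ↦ liftFHom_rel φ h)
  map_comp := by rintro _ _ _ ⟨_⟩ ⟨_⟩; rfl

/-- The functor `lift φ` is strictly compatible with tensor products and units. -/
instance liftMonoidal : (lift φ).Monoidal :=
  Functor.CoreMonoidal.toMonoidal
    { εIso := Iso.refl _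
      μIso := fun _ _ ↦ Iso.refl _
      μIso_hom_natural_left := by
        rintro _ _ ⟨f⟩ _
        exact (Category.comp_id _).trans (Category.id_comp _).symm
      μIso_hom_natural_right := by
        rintro _ _ _ ⟨f⟩
        exact (Category.comp_id _).trans (Category.id_comp _).symm
      associativity := fun a b c ↦ by
        change (𝟙 (liftObj φ a ⊗ liftObj φ b) ▷ liftObj φ c) ≫ 𝟙 _ ≫ (α_ _ _ _).hom =
          (α_ _ _ _).hom ≫ (liftObj φ a ◁ 𝟙 (liftObj φ b ⊗ liftObj φ c)) ≫ 𝟙 _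
        simp
      left_unitality := fun a ↦ by
        change (λ_ (liftObj φ a)).hom = (𝟙 (𝟙_ M) ▷ liftObj φ a) ≫ 𝟙 _ ≫ (λ_ (liftObj φ a)).hom
        simp
      right_unitality := fun a ↦ by
        change (ρ_ (liftObj φ a)).hom = (liftObj φ a ◁ 𝟙 (𝟙_ M)) ≫ 𝟙 _ ≫ (ρ_ (liftObj φ a)).hom
        simp }

instance liftBraided : (lift φ).Braided where
  braided a b := by
    change 𝟙 (liftObj φ a ⊗ liftObj φ b) ≫ (β_ (liftObj φ a) (liftObj φ b)).hom =
      (β_ (liftObj φ a) (liftObj φ b)).hom ≫ 𝟙 _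
    simp

section Desc

open Functor.LaxMonoidal

variable {φ} (Ψ : Word X ⥤ M) [Ψ.LaxBraided] (f : ∀ x, φ x ⟶ Ψ.obj (of x))

/-- The components of `liftDesc`. -/
def liftDescApp : ∀ a : Word X, liftObj φ a ⟶ Ψ.obj a
  | of x => f x
  | unit => ε Ψ
  | tensor a b => (liftDescApp a ⊗ₘ liftDescApp b) ≫ μ Ψ a b

theorem liftDescApp_naturality {a b : Word X} (g : FHom a b) :
    liftFHom φ g ≫ liftDescApp Ψ f b = liftDescApp Ψ f a ≫ Ψ.map (Quotient.mk _ g : a ⟶ b) := by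
  induction g with
  | id a => exact (Category.id_comp _).trans ((congrArg _ (Ψ.map_id a)).trans
      (Category.comp_id _)).symm
  | @comp a b c g h hg hh =>
    change (liftFHom φ g ≫ liftFHom φ h) ≫ _ =
      _ ≫ Ψ.map ((Quotient.mk _ g : a ⟶ b) ≫ (Quotient.mk _ h : b ⟶ c))
    rw [Category.assoc, hh, reassoc_of% hg, Ψ.map_comp]
  | @whiskerLeft a b c g hg =>
    change (liftObj φ a ◁ liftFHom φ g) ≫ (liftDescApp Ψ f a ⊗ₘ liftDescApp Ψ f c) ≫ μ Ψ a c =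
      ((liftDescApp Ψ f a ⊗ₘ liftDescApp Ψ f b) ≫ μ Ψ a b) ≫
        Ψ.map (a ◁ (Quotient.mk _ g : b ⟶ c))
    rw [Category.assoc, ← μ_natural_right, ← Category.assoc, ← Category.assoc,
      whiskerLeft_comp_tensorHom, tensorHom_comp_whiskerLeft, hg]
  | @whiskerRight b c g a hg =>
    change (liftFHom φ g ▷ liftObj φ a) ≫ (liftDescApp Ψ f c ⊗ₘ liftDescApp Ψ f a) ≫ μ Ψ c a =
      ((liftDescApp Ψ f b ⊗ₘ liftDescApp Ψ f a) ≫ μ Ψ b a) ≫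
        Ψ.map ((Quotient.mk _ g : b ⟶ c) ▷ a)
    rw [Category.assoc, ← μ_natural_left, ← Category.assoc, ← Category.assoc,
      whiskerRight_comp_tensorHom, tensorHom_comp_whiskerRight, hg]
  | @tensor a b c d g h hg hh =>
    change (liftFHom φ g ⊗ₘ liftFHom φ h) ≫ (liftDescApp Ψ f c ⊗ₘ liftDescApp Ψ f d) ≫ μ Ψ c d =
      ((liftDescApp Ψ f a ⊗ₘ liftDescApp Ψ f b) ≫ μ Ψ a b) ≫
        Ψ.map ((Quotient.mk _ g : a ⟶ c) ⊗ₘ (Quotient.mk _ h : b ⟶ d))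
    rw [Category.assoc, ← μ_natural, ← Category.assoc, ← Category.assoc,
      tensorHom_comp_tensorHom, tensorHom_comp_tensorHom, hg, hh]
  | assocHom a b c =>
    change (α_ (liftObj φ a) (liftObj φ b) (liftObj φ c)).hom ≫
        (liftDescApp Ψ f a ⊗ₘ ((liftDescApp Ψ f b ⊗ₘ liftDescApp Ψ f c) ≫ μ Ψ b c)) ≫
          μ Ψ a (b ⊗ c) =
      ((((liftDescApp Ψ f a ⊗ₘ liftDescApp Ψ f b) ≫ μ Ψ a b) ⊗ₘ liftDescApp Ψ f c) ≫
        μ Ψ (a ⊗ b) c) ≫ Ψ.map (α_ a b c).hom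
    rw [← tensorHom_comp_whiskerRight, ← tensorHom_comp_whiskerLeft]
    simp
  | assocInv a b c =>
    change (α_ (liftObj φ a) (liftObj φ b) (liftObj φ c)).inv ≫
        (((liftDescApp Ψ f a ⊗ₘ liftDescApp Ψ f b) ≫ μ Ψ a b) ⊗ₘ liftDescApp Ψ f c) ≫
          μ Ψ (a ⊗ b) c =
      ((liftDescApp Ψ f a ⊗ₘ ((liftDescApp Ψ f b ⊗ₘ liftDescApp Ψ f c) ≫ μ Ψ b c)) ≫
          μ Ψ a (b ⊗ c)) ≫ Ψ.map (α_ a b c).inv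
    rw [← tensorHom_comp_whiskerRight, ← tensorHom_comp_whiskerLeft]
    simp
  | leftHom a =>
    change (λ_ (liftObj φ a)).hom ≫ liftDescApp Ψ f a =
      ((ε Ψ ⊗ₘ liftDescApp Ψ f a) ≫ μ Ψ (𝟙_ _) a) ≫ Ψ.map (λ_ a).hom
    rw [Category.assoc, tensorHom_def', Category.assoc, ← left_unitality, leftUnitor_naturality]
  | leftInv a =>
    change (λ_ (liftObj φ a)).inv ≫ (ε Ψ ⊗ₘ liftDescApp Ψ f a) ≫ μ Ψ (𝟙_ _) a =
      liftDescApp Ψ f a ≫ Ψ.map (λ_ a).inv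
    rw [Iso.inv_comp_eq, ← cancel_mono (Ψ.map (λ_ a).hom)]
    simp only [Category.assoc, ← Ψ.map_comp, Iso.inv_hom_id, Ψ.map_id, Category.comp_id]
    rw [tensorHom_def', Category.assoc, ← left_unitality, leftUnitor_naturality]
  | rightHom a =>
    change (ρ_ (liftObj φ a)).hom ≫ liftDescApp Ψ f a =
      ((liftDescApp Ψ f a ⊗ₘ ε Ψ) ≫ μ Ψ a (𝟙_ _)) ≫ Ψ.map (ρ_ a).hom
    rw [Category.assoc, MonoidalCategory.tensorHom_def, Category.assoc, ← right_unitality, rightUnitor_naturality]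
  | rightInv a =>
    change (ρ_ (liftObj φ a)).inv ≫ (liftDescApp Ψ f a ⊗ₘ ε Ψ) ≫ μ Ψ a (𝟙_ _) =
      liftDescApp Ψ f a ≫ Ψ.map (ρ_ a).inv
    rw [Iso.inv_comp_eq, ← cancel_mono (Ψ.map (ρ_ a).hom)]
    simp only [Category.assoc, ← Ψ.map_comp, Iso.inv_hom_id, Ψ.map_id, Category.comp_id]
    rw [MonoidalCategory.tensorHom_def, Category.assoc, ← right_unitality, rightUnitor_naturality]
  | swap a b =>
    change (β_ (liftObj φ a) (liftObj φ b)).hom ≫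
        (liftDescApp Ψ f b ⊗ₘ liftDescApp Ψ f a) ≫ μ Ψ b a =
      ((liftDescApp Ψ f a ⊗ₘ liftDescApp Ψ f b) ≫ μ Ψ a b) ≫ Ψ.map (β_ a b).hom
    rw [Category.assoc, Functor.LaxBraided.braided, ← Category.assoc, ← Category.assoc,
      BraidedCategory.braiding_naturality]

/-- A lax symmetric monoidal functor `Ψ` on `S(X)` receives a natural transformation from
`lift φ` for each family of morphisms `φ x ⟶ Ψ x`. -/
def liftDesc : lift φ ⟶ Ψ where
  app := liftDescApp Ψ f
  naturality := by
    rintro a b ⟨g⟩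
    exact liftDescApp_naturality Ψ f g

end Desc

end Lift
end Word

noncomputable section

open scoped MonoidalCategory.ExternalProduct
open MonoidalCategory.DayFunctor Opposite

section Day
variable (V : Type u) [Category.{v} V] [MonoidalCategory V] [SymmetricCategory V]
  [MonoidalClosed V] [HasLimits V] [HasColimits V] (X : Type v)

instance preservesColimits_tensorRight (v : V) : PreservesColimitsOfSize.{v, v} (tensorRight v) :=
  preservesColimits_of_natIso (BraidedCategory.tensorLeftIsoTensorRight v)

/-- The functors `S(X) ⥤ V`, with the Day convolution tensor product. -/
abbrev SMod := DayFunctor (Word X) V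

instance hasDayUnit : (Functor.fromPUnit.{0} <| 𝟙_ (Word X)).HasPointwiseLeftKanExtension
        (Functor.fromPUnit.{0} <| 𝟙_ V) := fun d ↦ by
  have : HasColimitsOfShape (CostructuredArrow (Functor.fromPUnit.{0} <| 𝟙_ (Word X)) d) V :=
    hasColimitsOfShape_of_essentiallySmall.{v} _ _
  dsimp only [Functor.HasPointwiseLeftKanExtensionAt]
  infer_instance

variable {V X}

instance hasDayProduct (F G : Word X ⥤ V) :
    (tensor (Word X)).HasPointwiseLeftKanExtension (F ⊠ G) := inferInstance

instance preservesTensorLeft (v : V) (d : Word X) :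
    PreservesColimitsOfShape (CostructuredArrow (tensor (Word X)) d) (tensorLeft v) :=
  inferInstance

instance preservesTensorRight (v : V) (d : Word X) :
    PreservesColimitsOfShape (CostructuredArrow (tensor (Word X)) d) (tensorRight v) :=
  inferInstance

instance preservesUnitLeft (v : V) (d : Word X) : PreservesColimitsOfShape
    (CostructuredArrow (Functor.fromPUnit.{0} <| 𝟙_ (Word X)) d) (tensorLeft v) :=
  inferInstance

instance preservesUnitRight (v : V) (d : Word X) : PreservesColimitsOfShape
    (CostructuredArrow (Functor.fromPUnit.{0} <| 𝟙_ (Word X)) d) (tensorRight v) :=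
  inferInstance

instance preservesProdUnit (v : V) (d : Word X × Word X) : PreservesColimitsOfShape
    (CostructuredArrow ((𝟭 (Word X)).prod <| Functor.fromPUnit.{0} <| 𝟙_ (Word X)) d)
    (tensorRight v) :=
  inferInstance

instance preservesProdTensor (v : V) (d : Word X × Word X) : PreservesColimitsOfShape
    (CostructuredArrow ((tensor (Word X)).prod (𝟭 (Word X))) d) (tensorRight v) :=
  inferInstance

instance dayMonoidalCategory : MonoidalCategory (SMod V X) := inferInstance

end Day

section Convolution

variable {V : Type u} [Category.{v} V] [MonoidalCategory V] [SymmetricCategory V]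
  [MonoidalClosed V] [HasLimits V] [HasColimits V] {X : Type v}

open LawfulDayConvolutionMonoidalCategoryStruct

/-- The universal pairing `F x ⊗ G y ⟶ (F ⊗ G) (x ⊗ y)`. -/
def dayι (F G : SMod V X) (x y : Word X) :
    F.functor.obj x ⊗ G.functor.obj y ⟶ (F ⊗ G).functor.obj (x ⊗ y) :=
  (η F G).app (x, y)

theorem dayι_natural (F G : SMod V X) {x x' y y' : Word X} (f : x ⟶ x') (g : y ⟶ y') :
    (F.functor.map f ⊗ₘ G.functor.map g) ≫ dayι F G x' y' =
      dayι F G x y ≫ (F ⊗ G).functor.map (f ⊗ₘ g) := by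
  have h := (η F G).naturality (X := (x, y)) (Y := (x', y')) (f, g)
  rw [MonoidalCategory.tensorHom_def]
  exact h

theorem dayι_map {F F' G G' : SMod V X} (f : F ⟶ F') (g : G ⟶ G') (x y : Word X) :
    dayι F G x y ≫ (f ⊗ₘ g).natTrans.app (x ⊗ y) =
      (f.natTrans.app x ⊗ₘ g.natTrans.app y) ≫ dayι F' G' x y :=
  convolutionExtensionUnit_comp_ι_map_tensorHom_app (Word X) V f g x y

theorem dayι_assoc (F G H : SMod V X) (x y z : Word X) :
    (dayι F G x y ▷ H.functor.obj z) ≫ dayι (F ⊗ G) H (x ⊗ y) z ≫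
        (α_ F G H).hom.natTrans.app ((x ⊗ y) ⊗ z) =
      (α_ _ _ _).hom ≫ (F.functor.obj x ◁ dayι G H y z) ≫ dayι F (G ⊗ H) x (y ⊗ z) ≫
        (F ⊗ G ⊗ H).functor.map (α_ x y z).inv :=
  associator_hom_unit_unit V F G H x y z

theorem dayι_leftUnit (F : SMod V X) (y : Word X) :
    (ν (Word X) V ▷ F.functor.obj y) ≫ dayι (𝟙_ _) F (𝟙_ _) y ≫
      (λ_ F).hom.natTrans.app (𝟙_ _ ⊗ y) = (λ_ _).hom ≫ F.functor.map (λ_ y).inv :=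
  leftUnitor_hom_unit_app V F y

theorem dayι_rightUnit (F : SMod V X) (y : Word X) :
    (F.functor.obj y ◁ ν (Word X) V) ≫ dayι F (𝟙_ _) y (𝟙_ _) ≫
      (ρ_ F).hom.natTrans.app (y ⊗ 𝟙_ _) = (ρ_ _).hom ≫ F.functor.map (ρ_ y).inv :=
  rightUnitor_hom_unit_app V F y

theorem natTrans_comp {F G H : SMod V X} (f : F ⟶ G) (g : G ⟶ H) (x : Word X) :
    (f ≫ g).natTrans.app x = f.natTrans.app x ≫ g.natTrans.app x := rfl

theorem natTrans_id (F : SMod V X) (x : Word X) :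
    (𝟙 F : F ⟶ F).natTrans.app x = 𝟙 _ := rfl

/-- Extensionality for morphisms out of a Day tensor product, with a parameter. -/
theorem day_hom_ext {F G : SMod V X} {Z K : V} {w : Word X}
    {f g : Z ⊗ (F ⊗ G).functor.obj w ⟶ K}
    (h : ∀ (x y : Word X) (u : x ⊗ y ⟶ w),
      (Z ◁ (dayι F G x y ≫ (F ⊗ G).functor.map u)) ≫ f =
        (Z ◁ (dayι F G x y ≫ (F ⊗ G).functor.map u)) ≫ g) : f = g := by
  apply (MonoidalClosed.curry_injective)
  let inst : DayConvolution F.functor G.functor := convolution (Word X) V (SMod V X) F G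
  refine DayConvolution.convolution_hom_ext_at F.functor G.functor w (fun {x y} u ↦ ?_)
  have := congrArg MonoidalClosed.curry (h x y u)
  rw [MonoidalClosed.curry_natural_left, MonoidalClosed.curry_natural_left] at this
  rw [Category.assoc, Category.assoc] at this
  exact this

theorem day_hom_ext_nat {F G : SMod V X} {Z : V} {K : Word X ⥤ V}
    {f g : (F ⊗ G).functor ⋙ tensorLeft Z ⟶ K}
    (h : ∀ (x y : Word X), (Z ◁ dayι F G x y) ≫ f.app (x ⊗ y) =
      (Z ◁ dayι F G x y) ≫ g.app (x ⊗ y)) : f = g := by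
  ext w
  refine day_hom_ext (fun x y u ↦ ?_)
  have hf := f.naturality u
  have hg := g.naturality u
  dsimp at hf hg
  rw [MonoidalCategory.whiskerLeft_comp, Category.assoc, Category.assoc, hf, hg,
    reassoc_of% h]

theorem unit_hom_ext' {Z : V} {K : Word X ⥤ V}
    {f g : (𝟙_ (SMod V X)).functor ⋙ tensorLeft Z ⟶ K}
    (h : (Z ◁ ν (Word X) V) ≫ f.app (𝟙_ _) = (Z ◁ ν (Word X) V) ≫ g.app (𝟙_ _)) : f = g := by
  ext w
  apply (MonoidalClosed.curry_injective)
  let inst : DayConvolutionUnit (𝟙_ (SMod V X)).functor := convolutionUnit (Word X) V (SMod V X)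
  refine DayConvolutionUnit.hom_ext (U := (𝟙_ (SMod V X)).functor) (fun u ↦ ?_)
  have hf := f.naturality u
  have hg := g.naturality u
  have := congrArg MonoidalClosed.curry (h =≫ K.map u)
  simp only [Category.assoc, ← hf, ← hg] at this
  dsimp at this
  simp only [MonoidalClosed.curry_natural_left] at this
  exact this

theorem dayι_whiskerRight {F F' G : SMod V X} (f : F ⟶ F') (x y : Word X) :
    dayι F G x y ≫ (f ▷ G).natTrans.app (x ⊗ y) =
      (f.natTrans.app x ▷ _) ≫ dayι F' G x y :=
  convolutionExtensionUnit_comp_ι_map_whiskerRight_app (Word X) V f G x y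

theorem dayι_whiskerLeft {F G G' : SMod V X} (g : G ⟶ G') (x y : Word X) :
    dayι F G x y ≫ (F ◁ g).natTrans.app (x ⊗ y) =
      (_ ◁ g.natTrans.app y) ≫ dayι F G' x y :=
  convolutionExtensionUnit_comp_ι_map_whiskerLeft_app V F g x y

theorem day_hom_ext₃ {F G H K : SMod V X} {f g : (F ⊗ G) ⊗ H ⟶ K}
    (h : ∀ (x y z : Word X),
      (dayι F G x y ▷ H.functor.obj z) ≫ dayι (F ⊗ G) H (x ⊗ y) z ≫ f.natTrans.app _ =
      (dayι F G x y ▷ H.functor.obj z) ≫ dayι (F ⊗ G) H (x ⊗ y) z ≫ g.natTrans.app _) :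
    f = g := by
  refine tensor_hom_ext (fun w z ↦ ?_)
  change dayι (F ⊗ G) H w z ≫ _ = dayι (F ⊗ G) H w z ≫ _
  rw [← cancel_epi (β_ _ _).hom]
  refine day_hom_ext (fun x y u ↦ ?_)
  have key : ∀ q : (F ⊗ G) ⊗ H ⟶ K,
      (H.functor.obj z ◁ (dayι F G x y ≫ (F ⊗ G).functor.map u)) ≫
        (β_ _ _).hom ≫ dayι (F ⊗ G) H w z ≫ q.natTrans.app (w ⊗ z) =
      (β_ _ _).hom ≫ ((dayι F G x y ▷ H.functor.obj z) ≫ dayι (F ⊗ G) H (x ⊗ y) z ≫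
        q.natTrans.app _) ≫ K.functor.map (u ▷ z) := by
    intro q
    have e := dayι_natural (F ⊗ G) H u (𝟙 z)
    simp only [H.functor.map_id, tensorHom_id] at e
    rw [BraidedCategory.braiding_naturality_right_assoc, comp_whiskerRight_assoc]
    simp only [Category.assoc, ← q.natTrans.naturality, reassoc_of% e]
  rw [key, key, h]

/-- The symmetry of the Day tensor product. -/
def dayBraidHom (F G : SMod V X) : F ⊗ G ⟶ G ⊗ F :=
  tensorDesc
    { app := fun p ↦ (β_ _ _).hom ≫ dayι G F p.2 p.1 ≫ (G ⊗ F).functor.map (β_ p.2 p.1).hom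
      naturality := by
        rintro ⟨x, y⟩ ⟨x', y'⟩ ⟨f, g⟩
        have h := dayι_natural G F g f
        have e := BraidedCategory.braiding_naturality (F.functor.map f) (G.functor.map g)
        change (F.functor.map f ▷ _ ≫ _ ◁ G.functor.map g) ≫ _ = _ ≫ (G ⊗ F).functor.map (f ⊗ₘ g)
        dsimp only
        rw [← MonoidalCategory.tensorHom_def, reassoc_of% e, reassoc_of% h, Category.assoc,
          Category.assoc, ← Functor.map_comp, ← Functor.map_comp,
          BraidedCategory.braiding_naturality] }

theorem dayι_braidHom (F G : SMod V X) (x y : Word X) :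
    dayι F G x y ≫ (dayBraidHom F G).natTrans.app (x ⊗ y) =
      (β_ _ _).hom ≫ dayι G F y x ≫ (G ⊗ F).functor.map (β_ y x).hom :=
  η_comp_tensorDesc_app _ _ _

theorem dayι_natural_left (F G : SMod V X) {x x' : Word X} (f : x ⟶ x') (y : Word X) :
    (F.functor.map f ▷ G.functor.obj y) ≫ dayι F G x' y =
      dayι F G x y ≫ (F ⊗ G).functor.map (f ▷ y) := by
  have := dayι_natural F G f (𝟙 y)
  rwa [G.functor.map_id, tensorHom_id, tensorHom_id] at this

theorem dayι_natural_right (F G : SMod V X) (x : Word X) {y y' : Word X} (g : y ⟶ y') :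
    (F.functor.obj x ◁ G.functor.map g) ≫ dayι F G x y' =
      dayι F G x y ≫ (F ⊗ G).functor.map (x ◁ g) := by
  have := dayι_natural F G (𝟙 x) g
  rwa [F.functor.map_id, id_tensorHom, id_tensorHom] at this

theorem dayHexagon (F G H : SMod V X) :
    (α_ F G H).hom ≫ dayBraidHom F (G ⊗ H) ≫ (α_ G H F).hom =
      (dayBraidHom F G ▷ H) ≫ (α_ G F H).hom ≫ (G ◁ dayBraidHom F H) := by
  refine day_hom_ext₃ (fun x y z ↦ ?_)
  simp only [natTrans_comp]
  have e1 : (dayι F G x y ▷ H.functor.obj z) ≫ dayι (F ⊗ G) H (x ⊗ y) z ≫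
      (α_ F G H).hom.natTrans.app ((x ⊗ y) ⊗ z) ≫ (dayBraidHom F (G ⊗ H)).natTrans.app _ ≫
        (α_ G H F).hom.natTrans.app _ =
      (α_ _ _ _).hom ≫ (β_ _ _).hom ≫ (α_ _ _ _).hom ≫ (_ ◁ dayι H F z x) ≫
        dayι G (H ⊗ F) y (z ⊗ x) ≫ (G ⊗ H ⊗ F).functor.map
          ((α_ y z x).inv ≫ (β_ (y ⊗ z) x).hom ≫ (α_ x y z).inv) := by
    rw [reassoc_of% dayι_assoc F G H x y z, NatTrans.naturality_assoc,
      reassoc_of% dayι_braidHom F (G ⊗ H) x (y ⊗ z),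
      BraidedCategory.braiding_naturality_right_assoc, ← Functor.map_comp_assoc,
      NatTrans.naturality, reassoc_of% dayι_assoc G H F y z x]
    simp only [Functor.map_comp]
  have e2 : (dayι F G x y ▷ H.functor.obj z) ≫ dayι (F ⊗ G) H (x ⊗ y) z ≫
      (dayBraidHom F G ▷ H).natTrans.app ((x ⊗ y) ⊗ z) ≫ (α_ G F H).hom.natTrans.app _ ≫
        (G ◁ dayBraidHom F H).natTrans.app _ =
      ((β_ _ _).hom ▷ _) ≫ (α_ _ _ _).hom ≫ (_ ◁ ((β_ _ _).hom ≫ dayι H F z x)) ≫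
        dayι G (H ⊗ F) y (z ⊗ x) ≫ (G ⊗ H ⊗ F).functor.map
          ((y ◁ (β_ z x).hom) ≫ (α_ y x z).inv ≫ ((β_ y x).hom ▷ z)) := by
    rw [reassoc_of% dayι_whiskerRight (dayBraidHom F G) (x ⊗ y) z,
      ← comp_whiskerRight_assoc, dayι_braidHom, comp_whiskerRight_assoc,
      comp_whiskerRight_assoc, reassoc_of% dayι_natural_left,
      NatTrans.naturality_assoc, reassoc_of% dayι_assoc G F H y x z,
      NatTrans.naturality, NatTrans.naturality_assoc,
      reassoc_of% dayι_whiskerLeft (dayBraidHom F H) y (x ⊗ z),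
      ← whiskerLeft_comp_assoc, dayι_braidHom, whiskerLeft_comp_assoc,
      whiskerLeft_comp_assoc, reassoc_of% dayι_natural_right]
    simp only [Functor.map_comp, MonoidalCategory.whiskerLeft_comp, Category.assoc]
  rw [e1, e2]
  have h1 := BraidedCategory.hexagon_forward (F.functor.obj x) (G.functor.obj y) (H.functor.obj z)
  have h2 := BraidedCategory.hexagon_reverse y z x
  rw [reassoc_of% h1, h2]
  simp only [MonoidalCategory.whiskerLeft_comp, Category.assoc]

theorem dayBraidHom_symm (F G : SMod V X) : dayBraidHom F G ≫ dayBraidHom G F = 𝟙 _ := by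
  refine tensor_hom_ext (fun x y ↦ ?_)
  change dayι F G x y ≫ _ = dayι F G x y ≫ 𝟙 _
  rw [natTrans_comp, reassoc_of% dayι_braidHom F G x y, NatTrans.naturality,
    reassoc_of% dayι_braidHom G F y x, ← Functor.map_comp, SymmetricCategory.symmetry_assoc]
  simp

instance dayBraided : BraidedCategory (SMod V X) where
  braiding F G := ⟨dayBraidHom F G, dayBraidHom G F, dayBraidHom_symm F G, dayBraidHom_symm G F⟩
  braiding_naturality_right F {G G'} f := by
    refine tensor_hom_ext (fun x y ↦ ?_)
    change dayι F G x y ≫ _ = dayι F G x y ≫ _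
    dsimp only
    rw [natTrans_comp, natTrans_comp, reassoc_of% dayι_whiskerLeft f x y, dayι_braidHom,
      reassoc_of% dayι_braidHom F G x y, NatTrans.naturality,
      reassoc_of% dayι_whiskerRight f y x, BraidedCategory.braiding_naturality_right_assoc]
  braiding_naturality_left {F F'} f G := by
    refine tensor_hom_ext (fun x y ↦ ?_)
    change dayι F G x y ≫ _ = dayι F G x y ≫ _
    dsimp only
    rw [natTrans_comp, natTrans_comp, reassoc_of% dayι_whiskerRight f x y, dayι_braidHom,
      reassoc_of% dayι_braidHom F G x y, NatTrans.naturality,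
      reassoc_of% dayι_whiskerLeft f y x, BraidedCategory.braiding_naturality_left_assoc]
  hexagon_forward F G H := dayHexagon F G H
  hexagon_reverse F G H := by
    have h := dayHexagon H F G
    change (α_ F G H).inv ≫ dayBraidHom (F ⊗ G) H ≫ (α_ H F G).inv =
      (F ◁ dayBraidHom G H) ≫ (α_ F H G).inv ≫ (dayBraidHom F H ▷ G)
    have h3 : ((α_ H F G).hom ≫ dayBraidHom H (F ⊗ G) ≫ (α_ F G H).hom) ≫
        ((F ◁ dayBraidHom G H) ≫ (α_ F H G).inv ≫ (dayBraidHom F H ▷ G)) = 𝟙 _ := by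
      rw [h]
      simp only [Category.assoc]
      rw [← MonoidalCategory.whiskerLeft_comp_assoc, dayBraidHom_symm]
      simp [← comp_whiskerRight, dayBraidHom_symm]
    have h4 : ((α_ F G H).inv ≫ dayBraidHom (F ⊗ G) H ≫ (α_ H F G).inv) ≫
        ((α_ H F G).hom ≫ dayBraidHom H (F ⊗ G) ≫ (α_ F G H).hom) = 𝟙 _ := by
      simp only [Category.assoc, Iso.inv_hom_id_assoc]
      rw [← Category.assoc (dayBraidHom (F ⊗ G) H), dayBraidHom_symm, Category.id_comp,
        Iso.inv_hom_id]
    rw [← Category.comp_id ((α_ F G H).inv ≫ _), ← h3, ← Category.assoc, h4, Category.id_comp]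

instance daySymmetric : SymmetricCategory (SMod V X) where
  symmetry F G := dayBraidHom_symm F G

theorem dayι_braid (F G : SMod V X) (x y : Word X) :
    dayι F G x y ≫ (β_ F G).hom.natTrans.app (x ⊗ y) =
      (β_ _ _).hom ≫ dayι G F y x ≫ (G ⊗ F).functor.map (β_ y x).hom :=
  dayι_braidHom F G x y

end Convolution

variable {V : Type u} [Category.{v} V] [MonoidalCategory V] [SymmetricCategory V]
  [MonoidalClosed V] [HasLimits V] [HasColimits V] {X : Type v}

/-- Transposition of natural transformations. -/
def transposeNat {A K : Word X ⥤ V} {Z : V} (t : A ⟶ K ⋙ ihom Z) : A ⋙ tensorLeft Z ⟶ K where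
  app w := MonoidalClosed.uncurry (t.app w)
  naturality x y f := by
    change (Z ◁ A.map f) ≫ MonoidalClosed.uncurry (t.app y) =
      MonoidalClosed.uncurry (t.app x) ≫ K.map f
    rw [← MonoidalClosed.uncurry_natural_left, ← MonoidalClosed.uncurry_natural_right,
      t.naturality]
    rfl

/-- The universal property of the Day tensor product, with a parameter. -/
def dayLift {F G : SMod V X} {Z : V} {K : Word X ⥤ V}
    (α : ∀ x y, Z ⊗ (F.functor.obj x ⊗ G.functor.obj y) ⟶ K.obj (x ⊗ y))
    (h : ∀ {x x' y y' : Word X} (f : x ⟶ x') (g : y ⟶ y'),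
      (Z ◁ (F.functor.map f ⊗ₘ G.functor.map g)) ≫ α x' y' = α x y ≫ K.map (f ⊗ₘ g)) :
    (F ⊗ G).functor ⋙ tensorLeft Z ⟶ K :=
  transposeNat (tensorDesc (H := ⟨K ⋙ ihom Z⟩)
    { app := fun p ↦ MonoidalClosed.curry (α p.1 p.2)
      naturality := by
        rintro ⟨x, y⟩ ⟨x', y'⟩ ⟨f, g⟩
        change (F.functor.map f ▷ _ ≫ _ ◁ G.functor.map g) ≫ _ =
          _ ≫ (ihom Z).map (K.map (f ⊗ₘ g))
        dsimp only
        rw [← MonoidalCategory.tensorHom_def, ← MonoidalClosed.curry_natural_left, h,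
          MonoidalClosed.curry_natural_right] }).natTrans

theorem dayι_dayLift {F G : SMod V X} {Z : V} {K : Word X ⥤ V}
    (α : ∀ x y, Z ⊗ (F.functor.obj x ⊗ G.functor.obj y) ⟶ K.obj (x ⊗ y))
    (h : ∀ {x x' y y' : Word X} (f : x ⟶ x') (g : y ⟶ y'),
      (Z ◁ (F.functor.map f ⊗ₘ G.functor.map g)) ≫ α x' y' = α x y ≫ K.map (f ⊗ₘ g))
    (x y : Word X) : (Z ◁ dayι F G x y) ≫ (dayLift α h).app (x ⊗ y) = α x y := by
  have e := η_comp_tensorDesc_app (F := F) (G := G) (H := ⟨K ⋙ ihom Z⟩)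
    { app := fun p ↦ MonoidalClosed.curry (α p.1 p.2)
      naturality := by
        rintro ⟨x, y⟩ ⟨x', y'⟩ ⟨f, g⟩
        change (F.functor.map f ▷ _ ≫ _ ◁ G.functor.map g) ≫ _ =
          _ ≫ (ihom Z).map (K.map (f ⊗ₘ g))
        dsimp only
        rw [← MonoidalCategory.tensorHom_def, ← MonoidalClosed.curry_natural_left, h,
          MonoidalClosed.curry_natural_right] } x y
  have e' := congrArg MonoidalClosed.uncurry e
  dsimp only at e'
  rw [MonoidalClosed.uncurry_curry] at e'
  refine Eq.trans ?_ e'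
  exact (MonoidalClosed.uncurry_natural_left _ _).symm

/-- The universal property of the unit of the Day tensor product, with a parameter. -/
def dayUnitLift {Z : V} {K : Word X ⥤ V} (k : Z ⊗ 𝟙_ V ⟶ K.obj (𝟙_ _)) :
    (𝟙_ (SMod V X)).functor ⋙ tensorLeft Z ⟶ K :=
  transposeNat (unitDesc (F := ⟨K ⋙ ihom Z⟩) (MonoidalClosed.curry k)).natTrans

theorem ν_dayUnitLift {Z : V} {K : Word X ⥤ V} (k : Z ⊗ 𝟙_ V ⟶ K.obj (𝟙_ _)) :
    (Z ◁ ν (Word X) V) ≫ (dayUnitLift k).app (𝟙_ _) = k := by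
  have e' := congrArg MonoidalClosed.uncurry
    (ν_comp_unitDesc (C := Word X) (F := ⟨K ⋙ ihom Z⟩) (MonoidalClosed.curry k))
  rw [MonoidalClosed.uncurry_curry] at e'
  refine Eq.trans ?_ e'
  exact (MonoidalClosed.uncurry_natural_left _ _).symm

/-! ### The object of natural transformations -/

/-- The object of natural transformations: the end `∫_x [A x, K x]`. -/
def vhom (A K : Word X ⥤ V) : V :=
  end_ (A.op ⋙ MonoidalClosed.internalHom ⋙ (Functor.whiskeringLeft _ _ _).obj K)

/-- The projections of the end `vhom A K`. -/
def vproj (A K : Word X ⥤ V) (x : Word X) : vhom A K ⟶ (ihom (A.obj x)).obj (K.obj x) :=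
  end_.π (A.op ⋙ MonoidalClosed.internalHom ⋙ (Functor.whiskeringLeft _ _ _).obj K) x

theorem vproj_condition (A K : Word X ⥤ V) {x y : Word X} (f : x ⟶ y) :
    vproj A K x ≫ (ihom (A.obj x)).map (K.map f) =
      vproj A K y ≫ (MonoidalClosed.pre (A.map f)).app (K.obj y) :=
  end_.condition (A.op ⋙ MonoidalClosed.internalHom ⋙ (Functor.whiskeringLeft _ _ _).obj K) f

/-- Evaluation `(∫_x [A x, K x]) ⊗ A w ⟶ K w`. -/
def vev (A K : Word X ⥤ V) : A ⋙ tensorLeft (vhom A K) ⟶ K where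
  app w := (β_ _ _).hom ≫ MonoidalClosed.uncurry (vproj A K w)
  naturality x y f := by
    have h' := congrArg MonoidalClosed.uncurry (vproj_condition A K f)
    rw [MonoidalClosed.uncurry_natural_right] at h'
    change (vhom A K ◁ A.map f) ≫ _ = _
    rw [BraidedCategory.braiding_naturality_right_assoc, Category.assoc, h',
      MonoidalClosed.uncurry_eq, MonoidalClosed.uncurry_eq,
      MonoidalCategory.whiskerLeft_comp, Category.assoc, MonoidalClosed.id_tensor_pre_app_comp_ev,
      whisker_exchange_assoc]

/-- The universal property of `vhom`. -/
def vlift {A K : Word X ⥤ V} {Z : V} (t : A ⋙ tensorLeft Z ⟶ K) : Z ⟶ vhom A K :=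
  end_.lift (fun x ↦ (MonoidalClosed.curry ((β_ (A.obj x) Z).hom ≫ t.app x) :
      Z ⟶ (ihom (A.obj x)).obj (K.obj x))) (by
    intro x y f
    change MonoidalClosed.curry _ ≫ (ihom (A.obj x)).map (K.map f) =
      MonoidalClosed.curry _ ≫ (MonoidalClosed.pre (A.map f)).app (K.obj y)
    rw [← MonoidalClosed.curry_natural_right, MonoidalClosed.curry_pre_app]
    have := t.naturality f
    dsimp at this
    refine congrArg MonoidalClosed.curry ?_
    rw [BraidedCategory.braiding_naturality_left_assoc, Category.assoc, this])

theorem vlift_vproj {A K : Word X ⥤ V} {Z : V} (t : A ⋙ tensorLeft Z ⟶ K) (x : Word X) :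
    vlift t ≫ vproj A K x = MonoidalClosed.curry ((β_ (A.obj x) Z).hom ≫ t.app x) :=
  end_.lift_π _ _ _

theorem vlift_vev {A K : Word X ⥤ V} {Z : V} (t : A ⋙ tensorLeft Z ⟶ K) (x : Word X) :
    (vlift t ▷ A.obj x) ≫ (vev A K).app x = t.app x := by
  change (vlift t ▷ A.obj x) ≫ (β_ _ _).hom ≫ MonoidalClosed.uncurry (vproj A K x) = _
  rw [BraidedCategory.braiding_naturality_left_assoc, ← MonoidalClosed.uncurry_natural_left,
    vlift_vproj, MonoidalClosed.uncurry_curry, SymmetricCategory.symmetry_assoc]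

theorem vhom_ext {A K : Word X ⥤ V} {Z : V} {f g : Z ⟶ vhom A K}
    (h : ∀ x, (f ▷ A.obj x) ≫ (vev A K).app x = (g ▷ A.obj x) ≫ (vev A K).app x) : f = g := by
  refine end_.hom_ext (fun x ↦ ?_)
  have h' := h x
  change (f ▷ A.obj x) ≫ (β_ _ _).hom ≫ MonoidalClosed.uncurry (vproj A K x) =
    (g ▷ A.obj x) ≫ (β_ _ _).hom ≫ MonoidalClosed.uncurry (vproj A K x) at h'
  rw [BraidedCategory.braiding_naturality_left_assoc,
    BraidedCategory.braiding_naturality_left_assoc, cancel_epi,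
    ← MonoidalClosed.uncurry_natural_left, ← MonoidalClosed.uncurry_natural_left] at h'
  exact MonoidalClosed.uncurry_injective h'

/-- Functoriality of `vhom`. -/
def vmap {A A' K K' : Word X ⥤ V} (a : A' ⟶ A) (k : K ⟶ K') : vhom A K ⟶ vhom A' K' :=
  vlift (Functor.whiskerRight a (tensorLeft (vhom A K)) ≫ vev A K ≫ k)

theorem vmap_vev {A A' K K' : Word X ⥤ V} (a : A' ⟶ A) (k : K ⟶ K') (x : Word X) :
    (vmap a k ▷ A'.obj x) ≫ (vev A' K').app x =
      (vhom A K ◁ a.app x) ≫ (vev A K).app x ≫ k.app x :=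
  vlift_vev _ _

theorem vmap_comp {A A' A'' K K' K'' : Word X ⥤ V} (a : A' ⟶ A) (a' : A'' ⟶ A') (k : K ⟶ K')
    (k' : K' ⟶ K'') : vmap a k ≫ vmap a' k' = vmap (a' ≫ a) (k ≫ k') := by
  refine vhom_ext (fun x ↦ ?_)
  rw [comp_whiskerRight_assoc, vmap_vev, vmap_vev, ← whisker_exchange_assoc,
    reassoc_of% vmap_vev a k x]
  simp

theorem vmap_id (A K : Word X ⥤ V) : vmap (𝟙 A) (𝟙 K) = 𝟙 _ := by
  refine vhom_ext (fun x ↦ ?_)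
  rw [vmap_vev]
  simp

/-- A natural family of morphisms `M x ⊗ N y ⟶ K (x ⊗ y)`. -/
structure Pairing (M N K : Word X ⥤ V) where
  /-- the morphisms -/
  app (x y : Word X) : M.obj x ⊗ N.obj y ⟶ K.obj (x ⊗ y)
  natural {x x' y y' : Word X} (f : x ⟶ x') (g : y ⟶ y') :
    (M.map f ⊗ₘ N.map g) ≫ app x' y' = app x y ≫ K.map (f ⊗ₘ g)

theorem vpair_aux {F G M N K : Word X ⥤ V} (j : Pairing M N K) {x x' y y' : Word X}
    (f : x ⟶ x') (g : y ⟶ y') :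
    ((vhom F M ⊗ vhom G N) ◁ (F.map f ⊗ₘ G.map g)) ≫ tensorμ _ _ _ _ ≫
        ((vev F M).app x' ⊗ₘ (vev G N).app y') ≫ j.app x' y' =
      (tensorμ _ _ _ _ ≫ ((vev F M).app x ⊗ₘ (vev G N).app y) ≫ j.app x y) ≫
        K.map (f ⊗ₘ g) := by
  have h1 := (vev F M).naturality f
  have h2 := (vev G N).naturality g
  dsimp at h1 h2
  have h3 := tensorμ_natural_right (vhom F M) (vhom G N) (F.map f) (G.map g)
  rw [reassoc_of% h3, tensorHom_comp_tensorHom_assoc, h1, h2,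
    ← tensorHom_comp_tensorHom_assoc, j.natural]
  simp only [Category.assoc]

/-- The morphism `∫_x [F x, M x] ⊗ ∫_y [G y, N y] ⟶ ∫_w [(F ⊗ G) w, K w]` induced by a
pairing. -/
def vpair {F G : SMod V X} {M N K : Word X ⥤ V} (j : Pairing M N K) :
    vhom F.functor M ⊗ vhom G.functor N ⟶ vhom (F ⊗ G).functor K :=
  vlift (dayLift (fun x y ↦ tensorμ _ _ _ _ ≫
    ((vev F.functor M).app x ⊗ₘ (vev G.functor N).app y) ≫ j.app x y)
      (fun f g ↦ vpair_aux j f g))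

theorem vpair_vev {F G : SMod V X} {M N K : Word X ⥤ V} (j : Pairing M N K) (x y : Word X) :
    ((vhom F.functor M ⊗ vhom G.functor N) ◁ dayι F G x y) ≫
      (vpair (F := F) (G := G) j ▷ _) ≫ (vev (F ⊗ G).functor K).app (x ⊗ y) =
    tensorμ _ _ _ _ ≫ ((vev F.functor M).app x ⊗ₘ (vev G.functor N).app y) ≫ j.app x y := by
  rw [vpair, vlift_vev]
  exact dayι_dayLift _ (fun f g ↦ vpair_aux j f g) x y

/-- The morphism `𝟙_ V ⟶ ∫_w [𝟙_ w, K w]` induced by an element of `K (𝟙_)`. -/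
def vunit {K : Word X ⥤ V} (k : 𝟙_ V ⟶ K.obj (𝟙_ _)) :
    𝟙_ V ⟶ vhom (𝟙_ (SMod V X)).functor K :=
  vlift (dayUnitLift ((λ_ _).hom ≫ k))

theorem vunit_vev {K : Word X ⥤ V} (k : 𝟙_ V ⟶ K.obj (𝟙_ _)) :
    (𝟙_ V ◁ ν (Word X) V) ≫ (vunit k ▷ _) ≫ (vev (𝟙_ (SMod V X)).functor K).app (𝟙_ _) =
      (λ_ _).hom ≫ k := by
  rw [vunit, vlift_vev, ν_dayUnitLift]

theorem vhom_day_ext {F G : SMod V X} {K : Word X ⥤ V} {Z : V}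
    {f g : Z ⟶ vhom (F ⊗ G).functor K}
    (h : ∀ x y, (Z ◁ dayι F G x y) ≫ (f ▷ _) ≫ (vev (F ⊗ G).functor K).app (x ⊗ y) =
      (Z ◁ dayι F G x y) ≫ (g ▷ _) ≫ (vev (F ⊗ G).functor K).app (x ⊗ y)) : f = g := by
  let t (f : Z ⟶ vhom (F ⊗ G).functor K) : (F ⊗ G).functor ⋙ tensorLeft Z ⟶ K :=
    Functor.whiskerLeft _ ((tensoringLeft V).map f) ≫ vev _ _
  have := day_hom_ext_nat (f := t f) (g := t g) h
  exact vhom_ext (fun x ↦ NatTrans.congr_app this x)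

theorem vhom_unit_ext {K : Word X ⥤ V} {Z : V}
    {f g : Z ⟶ vhom (𝟙_ (SMod V X)).functor K}
    (h : (Z ◁ ν (Word X) V) ≫ (f ▷ _) ≫ (vev (𝟙_ (SMod V X)).functor K).app (𝟙_ _) =
      (Z ◁ ν (Word X) V) ≫ (g ▷ _) ≫ (vev (𝟙_ (SMod V X)).functor K).app (𝟙_ _)) : f = g := by
  let t (f : Z ⟶ vhom (𝟙_ (SMod V X)).functor K) : (𝟙_ (SMod V X)).functor ⋙ tensorLeft Z ⟶ K :=
    Functor.whiskerLeft _ ((tensoringLeft V).map f) ≫ vev _ _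
  have := unit_hom_ext' (f := t f) (g := t g) h
  exact vhom_ext (fun x ↦ NatTrans.congr_app this x)

/-- The action of an element `f` of `∫_x [A x, K x]` on an element `a` of `A x`. -/
def act {A K : Word X ⥤ V} {Z D : V} {x : Word X} (f : Z ⟶ vhom A K) (a : D ⟶ A.obj x) :
    Z ⊗ D ⟶ K.obj x :=
  (f ⊗ₘ a) ≫ (vev A K).app x

theorem act_comp {A K : Word X ⥤ V} {Z Z' D D' : V} {x : Word X} (h : Z' ⟶ Z)
    (f : Z ⟶ vhom A K) (d : D' ⟶ D) (a : D ⟶ A.obj x) :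
    act (h ≫ f) (d ≫ a) = (h ⊗ₘ d) ≫ act f a := by
  simp [act, tensorHom_comp_tensorHom_assoc]

theorem act_comp_left {A K : Word X ⥤ V} {Z Z' D : V} {x : Word X} (h : Z' ⟶ Z)
    (f : Z ⟶ vhom A K) (a : D ⟶ A.obj x) : act (h ≫ f) a = (h ▷ D) ≫ act f a := by
  have := act_comp h f (𝟙 D) a
  rwa [Category.id_comp, tensorHom_id] at this

theorem act_comp_right {A K : Word X ⥤ V} {Z D D' : V} {x : Word X}
    (f : Z ⟶ vhom A K) (d : D' ⟶ D) (a : D ⟶ A.obj x) :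
    act f (d ≫ a) = (Z ◁ d) ≫ act f a := by
  have := act_comp (𝟙 Z) f d a
  rwa [Category.id_comp, id_tensorHom] at this

theorem act_map {A K : Word X ⥤ V} {Z D : V} {x y : Word X} (f : Z ⟶ vhom A K)
    (a : D ⟶ A.obj x) (u : x ⟶ y) : act f (a ≫ A.map u) = act f a ≫ K.map u := by
  have h := (vev A K).naturality u
  dsimp at h
  simp only [act, Category.assoc, ← h]
  rw [← tensorHom_comp_whiskerLeft_assoc]

theorem act_vmap {A A' K K' : Word X ⥤ V} {Z D : V} {x : Word X} (f : Z ⟶ vhom A K)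
    (s : A' ⟶ A) (k : K ⟶ K') (a : D ⟶ A'.obj x) :
    act (f ≫ vmap s k) a = act f (a ≫ s.app x) ≫ k.app x := by
  rw [act, ← whiskerRight_comp_tensorHom, MonoidalCategory.tensorHom_def', act]
  simp only [Category.assoc, vmap_vev]
  rw [← whisker_exchange_assoc, ← whisker_exchange_assoc]
  simp [MonoidalCategory.tensorHom_def', whisker_exchange_assoc]

theorem act_vpair {F G : SMod V X} {M N K : Word X ⥤ V} (j : Pairing M N K) {Z Z' D D' : V}
    {x y : Word X} (f : Z ⟶ vhom F.functor M) (g : Z' ⟶ vhom G.functor N)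
    (a : D ⟶ F.functor.obj x) (b : D' ⟶ G.functor.obj y) :
    act ((f ⊗ₘ g) ≫ vpair j) ((a ⊗ₘ b) ≫ dayι F G x y) =
      tensorμ _ _ _ _ ≫ (act f a ⊗ₘ act g b) ≫ j.app x y := by
  have h := vpair_vev (F := F) (G := G) j x y
  rw [act_comp]
  have e : act (vpair (F := F) (G := G) j) (dayι F G x y) = tensorμ _ _ _ _ ≫
      ((vev F.functor M).app x ⊗ₘ (vev G.functor N).app y) ≫ j.app x y := by
    rw [← h, act, MonoidalCategory.tensorHom_def', Category.assoc]
  have e' := tensorμ_natural f g a b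
  rw [e, reassoc_of% e', tensorHom_comp_tensorHom_assoc]
  rfl

theorem act_vunit {K : Word X ⥤ V} (k : 𝟙_ V ⟶ K.obj (𝟙_ _)) :
    act (vunit k) (ν (Word X) V) = (λ_ _).hom ≫ k := by
  rw [← vunit_vev, act, MonoidalCategory.tensorHom_def', Category.assoc]

theorem act_ext {A K : Word X ⥤ V} {Z : V} {f g : Z ⟶ vhom A K}
    (h : ∀ x, act f (𝟙 (A.obj x)) = act g (𝟙 (A.obj x))) : f = g := by
  refine vhom_ext (fun x ↦ ?_)
  have := h x
  simpa only [act, tensorHom_id] using this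

theorem act_day_ext {F G : SMod V X} {K : Word X ⥤ V} {Z : V}
    {f g : Z ⟶ vhom (F ⊗ G).functor K}
    (h : ∀ x y, act f (dayι F G x y) = act g (dayι F G x y)) : f = g := by
  refine vhom_day_ext (fun x y ↦ ?_)
  have := h x y
  simpa only [act, MonoidalCategory.tensorHom_def', Category.assoc] using this

theorem act_day_ext₃ {F G H : SMod V X} {K : Word X ⥤ V} {Z : V}
    {f g : Z ⟶ vhom ((F ⊗ G) ⊗ H).functor K}
    (h : ∀ x y z, act f ((dayι F G x y ▷ _) ≫ dayι (F ⊗ G) H (x ⊗ y) z) =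
      act g ((dayι F G x y ▷ _) ≫ dayι (F ⊗ G) H (x ⊗ y) z)) : f = g := by
  refine act_day_ext (fun w z ↦ ?_)
  rw [← cancel_epi (Z ◁ (β_ (H.functor.obj z) _).hom), ← cancel_epi (α_ _ _ _).hom]
  refine day_hom_ext (fun x y u ↦ ?_)
  have key : ∀ q : Z ⟶ vhom ((F ⊗ G) ⊗ H).functor K,
      ((Z ⊗ H.functor.obj z) ◁ (dayι F G x y ≫ (F ⊗ G).functor.map u)) ≫
        (α_ _ _ _).hom ≫ (Z ◁ (β_ (H.functor.obj z) _).hom) ≫ act q (dayι (F ⊗ G) H w z) =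
      (α_ _ _ _).hom ≫ (Z ◁ (β_ (H.functor.obj z) _).hom) ≫
        act q ((dayι F G x y ▷ _) ≫ dayι (F ⊗ G) H (x ⊗ y) z) ≫ K.map (u ▷ z) := by
    intro q
    rw [← act_map, Category.assoc, ← dayι_natural_left, ← comp_whiskerRight_assoc,
      act_comp_right, associator_naturality_right_assoc,
      ← MonoidalCategory.whiskerLeft_comp_assoc, ← MonoidalCategory.whiskerLeft_comp_assoc,
      BraidedCategory.braiding_naturality_right]
  rw [key, key, h]

/-! ### Coherence of the morphisms `vpair` -/

theorem vpair_natural {F F' G G' : SMod V X} {M M' N N' K K' : Word X ⥤ V} (j : Pairing M N K)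
    (j' : Pairing M' N' K') (a : F' ⟶ F) (b : G' ⟶ G) (m : M ⟶ M') (n : N ⟶ N') (k : K ⟶ K')
    (h : ∀ x y, j.app x y ≫ k.app (x ⊗ y) = (m.app x ⊗ₘ n.app y) ≫ j'.app x y) :
    (vmap a.natTrans m ⊗ₘ vmap b.natTrans n) ≫ vpair j' =
      vpair j ≫ vmap (a ⊗ₘ b).natTrans k := by
  refine act_day_ext (fun x y ↦ ?_)
  have e1 := act_vpair j' (vmap a.natTrans m) (vmap b.natTrans n) (𝟙 (F'.functor.obj x))
    (𝟙 (G'.functor.obj y))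
  have e2 := act_vpair (F := F) (G := G) j (𝟙 _) (𝟙 _) (a.natTrans.app x) (b.natTrans.app y)
  have e3 := act_vmap (𝟙 (vhom F.functor M)) a.natTrans m (𝟙 (F'.functor.obj x))
  have e4 := act_vmap (𝟙 (vhom G.functor N)) b.natTrans n (𝟙 (G'.functor.obj y))
  rw [Category.id_comp] at e3 e4
  rw [id_tensorHom_id, Category.id_comp] at e1 e2
  rw [e1, act_vmap, dayι_map, e2, e3, e4]
  simp only [Category.assoc, Category.id_comp, h, tensorHom_comp_tensorHom_assoc]

section Coherence

variable {Z₁ Z₂ Z₃ A₁ A₂ A₃ M₁ M₂ M₃ M₁₂ M₂₃ K K' K'' : V}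

theorem vpair_assoc_aux (p : Z₁ ⊗ A₁ ⟶ M₁) (q : Z₂ ⊗ A₂ ⟶ M₂) (r : Z₃ ⊗ A₃ ⟶ M₃)
    (j₁₂ : M₁ ⊗ M₂ ⟶ M₁₂) (j₂₃ : M₂ ⊗ M₃ ⟶ M₂₃) (j : M₁₂ ⊗ M₃ ⟶ K) {k : K ⟶ K''}
    (j' : M₁ ⊗ M₂₃ ⟶ K') (k' : K' ⟶ K'')
    (h : (j₁₂ ▷ M₃) ≫ j ≫ k = (α_ _ _ _).hom ≫ (_ ◁ j₂₃) ≫ j' ≫ k') :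
    (tensorμ (Z₁ ⊗ Z₂) Z₃ (A₁ ⊗ A₂) A₃ ≫ ((tensorμ Z₁ Z₂ A₁ A₂ ≫ (p ⊗ₘ q) ≫ j₁₂) ⊗ₘ r) ≫ j) ≫ k =
      ((α_ _ _ _).hom ⊗ₘ (α_ _ _ _).hom) ≫
        (tensorμ Z₁ (Z₂ ⊗ Z₃) A₁ (A₂ ⊗ A₃) ≫ (p ⊗ₘ (tensorμ Z₂ Z₃ A₂ A₃ ≫ (q ⊗ₘ r) ≫ j₂₃)) ≫ j') ≫
          k' := by
  have h1 : (((tensorμ Z₁ Z₂ A₁ A₂ ≫ (p ⊗ₘ q) ≫ j₁₂) ⊗ₘ r) : _ ⟶ M₁₂ ⊗ M₃) =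
      (tensorμ Z₁ Z₂ A₁ A₂ ▷ _) ≫ ((p ⊗ₘ q) ⊗ₘ r) ≫ (j₁₂ ▷ _) := by
    rw [tensorHom_comp_whiskerRight, whiskerRight_comp_tensorHom]
  have h2 : ((p ⊗ₘ (tensorμ Z₂ Z₃ A₂ A₃ ≫ (q ⊗ₘ r) ≫ j₂₃)) : _ ⟶ M₁ ⊗ M₂₃) =
      (_ ◁ tensorμ Z₂ Z₃ A₂ A₃) ≫ (p ⊗ₘ (q ⊗ₘ r)) ≫ (_ ◁ j₂₃) := by
    rw [tensorHom_comp_whiskerLeft, whiskerLeft_comp_tensorHom]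
  have h3 := associator_monoidal Z₁ Z₂ Z₃ A₁ A₂ A₃
  rw [h1, h2]
  simp only [Category.assoc, h]
  rw [← reassoc_of% h3, associator_naturality_assoc]

theorem vpair_leftUnit_aux {D Z N : V} (k₀ : 𝟙_ V ⟶ M₁) (p : Z ⊗ D ⟶ N) (j : M₁ ⊗ N ⟶ K)
    {k : K ⟶ N} (h : (k₀ ▷ N) ≫ j ≫ k = (λ_ _).hom) :
    (_ ◁ (λ_ D).inv) ≫ tensorμ (𝟙_ V) Z (𝟙_ V) D ≫ (((λ_ _).hom ≫ k₀) ⊗ₘ p) ≫ j ≫ k =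
      ((λ_ Z).hom ▷ D) ≫ p := by
  have h1 : ((((λ_ _).hom ≫ k₀) ⊗ₘ p) : _ ⟶ M₁ ⊗ N) =
      ((λ_ (𝟙_ V)).hom ▷ _) ≫ (_ ◁ p) ≫ (k₀ ▷ _) := by
    rw [whisker_exchange, ← comp_whiskerRight_assoc, ← MonoidalCategory.tensorHom_def]
  have h2 := leftUnitor_monoidal Z D
  rw [h1]
  simp only [Category.assoc, h, leftUnitor_naturality]
  rw [← reassoc_of% h2, whiskerLeft_comp_tensorHom_assoc]
  simp

theorem vpair_rightUnit_aux {D Z N : V} (k₀ : 𝟙_ V ⟶ M₁) (p : Z ⊗ D ⟶ N) (j : N ⊗ M₁ ⟶ K)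
    {k : K ⟶ N} (h : (N ◁ k₀) ≫ j ≫ k = (ρ_ _).hom) :
    (_ ◁ (ρ_ D).inv) ≫ tensorμ Z (𝟙_ V) D (𝟙_ V) ≫ (p ⊗ₘ ((λ_ _).hom ≫ k₀)) ≫ j ≫ k =
      ((ρ_ Z).hom ▷ D) ≫ p := by
  have h1 : ((p ⊗ₘ ((λ_ _).hom ≫ k₀)) : _ ⟶ N ⊗ M₁) =
      (_ ◁ (λ_ (𝟙_ V)).hom) ≫ (p ▷ _) ≫ (_ ◁ k₀) := by
    rw [← whisker_exchange, ← MonoidalCategory.whiskerLeft_comp_assoc,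
      ← MonoidalCategory.tensorHom_def']
  have h2 := rightUnitor_monoidal Z D
  rw [h1]
  simp only [Category.assoc, h, rightUnitor_naturality]
  rw [← reassoc_of% h2, whiskerLeft_comp_tensorHom_assoc]
  simp

theorem vpair_braid_aux (p : Z₁ ⊗ A₁ ⟶ M₁) (q : Z₂ ⊗ A₂ ⟶ M₂) (j : M₂ ⊗ M₁ ⟶ K) :
    (_ ◁ (β_ A₂ A₁).hom) ≫ tensorμ Z₁ Z₂ A₁ A₂ ≫ (p ⊗ₘ q) ≫ (β_ _ _).hom ≫ j =
      ((β_ Z₁ Z₂).hom ▷ _) ≫ tensorμ Z₂ Z₁ A₂ A₁ ≫ (q ⊗ₘ p) ≫ j := by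
  have h : tensorμ Z₁ Z₂ A₁ A₂ ≫ (β_ (Z₁ ⊗ A₁) (Z₂ ⊗ A₂)).hom =
      ((β_ Z₁ Z₂).hom ⊗ₘ (β_ A₁ A₂).hom) ≫ tensorμ Z₂ Z₁ A₂ A₁ := by
    simp [tensorμ, SymmetricCategory.braiding_swap_eq_inv_braiding A₁ Z₂,
      MonoidalCategory.tensorHom_def]
  rw [BraidedCategory.braiding_naturality_assoc, reassoc_of% h,
    whiskerLeft_comp_tensorHom_assoc, SymmetricCategory.symmetry, tensorHom_id]

end Coherence

theorem vpair_assoc {F G H : SMod V X} {M₁ M₂ M₃ M₁₂ M₂₃ K K' : Word X ⥤ V}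
    (j₁₂ : Pairing M₁ M₂ M₁₂) (j : Pairing M₁₂ M₃ K) (j₂₃ : Pairing M₂ M₃ M₂₃)
    (j' : Pairing M₁ M₂₃ K') (k : K ⟶ K')
    (h : ∀ x y z, (j₁₂.app x y ▷ _) ≫ j.app (x ⊗ y) z ≫ k.app _ =
      (α_ _ _ _).hom ≫ (_ ◁ j₂₃.app y z) ≫ j'.app x (y ⊗ z) ≫ K'.map (α_ x y z).inv) :
    (vpair (F := F) (G := G) j₁₂ ▷ vhom H.functor M₃) ≫ vpair j ≫
        vmap (α_ F G H).inv.natTrans k =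
      (α_ _ _ _).hom ≫ (_ ◁ vpair j₂₃) ≫ vpair j' := by
  have hh : (vpair (F := F) (G := G) j₁₂ ▷ vhom H.functor M₃) ≫ vpair j ≫ vmap (𝟙 _) k =
      ((α_ _ _ _).hom ≫ (_ ◁ vpair j₂₃) ≫ vpair j') ≫ vmap (α_ F G H).hom.natTrans (𝟙 _) := by
    refine act_day_ext₃ (fun x y z ↦ ?_)
    have e1 := act_vpair (F := F) (G := G) j₁₂ (𝟙 _) (𝟙 _) (𝟙 _) (𝟙 _) (x := x) (y := y)
    rw [id_tensorHom_id, id_tensorHom_id, Category.id_comp, Category.id_comp] at e1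
    have e2 := act_vpair (G := H) j (vpair (F := F) (G := G) j₁₂) (𝟙 _) (dayι F G x y) (𝟙 _) (y := z)
    rw [tensorHom_id, tensorHom_id] at e2
    have e3 := act_vpair (F := G) (G := H) j₂₃ (𝟙 _) (𝟙 _) (𝟙 _) (𝟙 _) (x := y) (y := z)
    rw [id_tensorHom_id, id_tensorHom_id, Category.id_comp, Category.id_comp] at e3
    have e4 := act_vpair (F := F) j' (𝟙 _) (vpair (F := G) (G := H) j₂₃) (𝟙 _) (dayι G H y z) (x := x)
    rw [id_tensorHom, id_tensorHom] at e4
    have e5 : (dayι F G x y ▷ H.functor.obj z) ≫ dayι (F ⊗ G) H (x ⊗ y) z ≫ (α_ F G H).hom.natTrans.app ((x ⊗ y) ⊗ z) = (α_ _ _ _).hom ≫ ((F.functor.obj x ◁ dayι G H y z) ≫ dayι F (G ⊗ H) x (y ⊗ z)) ≫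
        (F ⊗ G ⊗ H).functor.map (α_ x y z).inv := by
      rw [dayι_assoc]; simp only [Category.assoc]
    rw [← Category.assoc (vpair j₁₂ ▷ _), act_vmap, act_vmap, NatTrans.id_app, NatTrans.id_app,
      Category.comp_id, Category.comp_id, e2, e1, Category.assoc (_ ▷ _), e5, act_comp, act_map,
      e4, e3]
    exact vpair_assoc_aux _ _ _ _ _ _ _ _ (h x y z)
  have h1 : (α_ F G H).inv.natTrans ≫ (α_ F G H).hom.natTrans = 𝟙 _ :=
    congrArg Hom.natTrans (α_ F G H).inv_hom_id
  have h2 := congrArg (· ≫ vmap (α_ F G H).inv.natTrans (𝟙 _)) hh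
  simp only [Category.assoc, vmap_comp, h1] at h2
  have h3 := vmap_id (F ⊗ G ⊗ H).functor K'
  simp only [Category.comp_id] at h2
  rw [h2, h3, Category.comp_id]

theorem day_leftUnitor_inv (G : SMod V X) (y : Word X) :
    (λ_ G).inv.natTrans.app y = ((λ_ _).inv ≫ (ν (Word X) V ▷ _) ≫
      dayι (𝟙_ _) G (𝟙_ _) y) ≫ (𝟙_ _ ⊗ G).functor.map (λ_ y).hom := by
  have e1 := dayι_leftUnit G y
  have e2 := (λ_ G).inv.natTrans.naturality (λ_ y).inv
  have e3 : (λ_ G).hom.natTrans.app (𝟙_ _ ⊗ y) ≫ (λ_ G).inv.natTrans.app _ = 𝟙 _ := by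
      rw [← natTrans_comp, Iso.hom_inv_id, natTrans_id]
  rw [Category.assoc, eq_comm, Iso.inv_comp_eq, Category.assoc]
  have e4 := congrArg (· ≫ (λ_ G).inv.natTrans.app _ ≫ (𝟙_ _ ⊗ G).functor.map (λ_ y).hom) e1
  simp only [Category.assoc] at e4
  rw [reassoc_of% e3, reassoc_of% e2, ← Functor.map_comp, Iso.inv_hom_id, CategoryTheory.Functor.map_id,
      Category.comp_id] at e4
  exact e4

theorem day_rightUnitor_inv (F : SMod V X) (y : Word X) :
    (ρ_ F).inv.natTrans.app y = ((ρ_ _).inv ≫ (_ ◁ ν (Word X) V) ≫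
      dayι F (𝟙_ _) y (𝟙_ _)) ≫ (F ⊗ 𝟙_ _).functor.map (ρ_ y).hom := by
  have e1 := dayι_rightUnit F y
  have e2 := (ρ_ F).inv.natTrans.naturality (ρ_ y).inv
  have e3 : (ρ_ F).hom.natTrans.app (y ⊗ 𝟙_ _) ≫ (ρ_ F).inv.natTrans.app _ = 𝟙 _ := by
      rw [← natTrans_comp, Iso.hom_inv_id, natTrans_id]
  rw [Category.assoc, eq_comm, Iso.inv_comp_eq, Category.assoc]
  have e4 := congrArg (· ≫ (ρ_ F).inv.natTrans.app _ ≫ (F ⊗ 𝟙_ _).functor.map (ρ_ y).hom) e1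
  simp only [Category.assoc] at e4
  rw [reassoc_of% e3, reassoc_of% e2, ← Functor.map_comp, Iso.inv_hom_id, CategoryTheory.Functor.map_id,
      Category.comp_id] at e4
  exact e4

theorem vpair_leftUnit {G : SMod V X} {M N K : Word X ⥤ V} (j : Pairing M N K)
    (k₀ : 𝟙_ V ⟶ M.obj (𝟙_ _)) (k : K ⟶ N)
    (h : ∀ y, (k₀ ▷ _) ≫ j.app (𝟙_ _) y ≫ k.app _ = (λ_ _).hom ≫ N.map (λ_ y).inv) :
    (vunit k₀ ▷ vhom G.functor N) ≫ vpair j ≫ vmap (λ_ G).inv.natTrans k = (λ_ _).hom := by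
  refine act_ext (fun y ↦ ?_)
  have e := day_leftUnitor_inv G y
  have e1 := act_vpair (F := 𝟙_ _) (G := G) j (vunit k₀) (𝟙 _) (ν (Word X) V) (𝟙 _) (y := y)
  rw [tensorHom_id, tensorHom_id, act_vunit] at e1
  rw [← Category.assoc, act_vmap, Category.id_comp, e, act_map, act_comp_right, e1]
  have e2 := k.naturality (λ_ y).hom
  have e3 := congrArg (· ≫ N.map (λ_ y).hom) (h y)
  simp only [Category.assoc, ← Functor.map_comp, Iso.inv_hom_id, CategoryTheory.Functor.map_id,
    Category.comp_id] at e3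
  have e4 : act (λ_ (vhom G.functor N)).hom (𝟙 (G.functor.obj y)) =
      ((λ_ (vhom G.functor N)).hom ▷ _) ≫ act (𝟙 _) (𝟙 _) := by
    rw [← act_comp_left, Category.comp_id]
  rw [e4]
  simp only [Category.assoc, e2]
  exact vpair_leftUnit_aux _ _ _ e3

theorem vpair_rightUnit {F : SMod V X} {M N K : Word X ⥤ V} (j : Pairing M N K)
    (k₀ : 𝟙_ V ⟶ N.obj (𝟙_ _)) (k : K ⟶ M)
    (h : ∀ y, (_ ◁ k₀) ≫ j.app y (𝟙_ _) ≫ k.app _ = (ρ_ _).hom ≫ M.map (ρ_ y).inv) :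
    (vhom F.functor M ◁ vunit k₀) ≫ vpair j ≫ vmap (ρ_ F).inv.natTrans k = (ρ_ _).hom := by
  refine act_ext (fun y ↦ ?_)
  have e := day_rightUnitor_inv F y
  have e1 := act_vpair (F := F) (G := 𝟙_ _) j (𝟙 _) (vunit k₀) (𝟙 _) (ν (Word X) V) (x := y)
  rw [id_tensorHom, id_tensorHom, act_vunit] at e1
  rw [← Category.assoc, act_vmap, Category.id_comp, e, act_map, act_comp_right, e1]
  have e2 := k.naturality (ρ_ y).hom
  have e3 := congrArg (· ≫ M.map (ρ_ y).hom) (h y)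
  simp only [Category.assoc, ← Functor.map_comp, Iso.inv_hom_id, CategoryTheory.Functor.map_id,
    Category.comp_id] at e3
  have e4 : act (ρ_ (vhom F.functor M)).hom (𝟙 (F.functor.obj y)) =
      ((ρ_ (vhom F.functor M)).hom ▷ _) ≫ act (𝟙 _) (𝟙 _) := by
    rw [← act_comp_left, Category.comp_id]
  rw [e4]
  simp only [Category.assoc, e2]
  exact vpair_rightUnit_aux _ _ _ e3

theorem vpair_braid {F G : SMod V X} {M N K K' : Word X ⥤ V} (j : Pairing M N K)
    (j' : Pairing N M K') (k : K ⟶ K')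
    (h : ∀ x y, j.app x y ≫ k.app _ = (β_ _ _).hom ≫ j'.app y x ≫ K'.map (β_ y x).hom) :
    vpair (F := F) (G := G) j ≫ vmap (β_ F G).inv.natTrans k = (β_ _ _).hom ≫ vpair j' := by
  have hb : (β_ F G).inv = (β_ G F).hom := rfl
  rw [hb]
  refine act_day_ext (fun y x ↦ ?_)
  have e1 := act_vpair (F := F) (G := G) j (𝟙 _) (𝟙 _) (𝟙 _) (𝟙 _) (x := x) (y := y)
  rw [id_tensorHom_id, id_tensorHom_id, Category.id_comp, Category.id_comp] at e1
  have e2 := act_vpair (F := G) (G := F) j' (𝟙 _) (𝟙 _) (𝟙 _) (𝟙 _) (x := y) (y := x)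
  rw [id_tensorHom_id, id_tensorHom_id, Category.id_comp, Category.id_comp] at e2
  have e3 := k.naturality (β_ x y).hom
  rw [act_vmap, dayι_braid, ← Category.assoc, act_map, act_comp_right, e1, act_comp_left, e2]
  simp only [Category.assoc, e3, reassoc_of% h x y, ← Functor.map_comp,
    SymmetricCategory.symmetry, CategoryTheory.Functor.map_id, Category.comp_id]
  exact vpair_braid_aux _ _ _

/-! ### The functor `P^∧` -/

section Wedge

variable (P : X → SMod V X)

/-- The Day tensor products `P(-; w) = P(-; w₁) ⊗ ⋯ ⊗ P(-; wₙ)`, for `w` in `S(X)`. -/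
abbrev bigP : Word X ⥤ SMod V X := Word.lift P

/-- The functor `w ↦ ∫_x [P(x; w), N x]`. -/
def wedgeObj (N : Word X ⥤ V) : Word X ⥤ V where
  obj w := vhom ((bigP P).obj w).functor N
  map f := vmap ((bigP P).map (inv f)).natTrans (𝟙 N)
  map_id w := by
    rw [IsIso.inv_id, CategoryTheory.Functor.map_id]
    exact vmap_id _ _
  map_comp f g := by
    rw [IsIso.inv_comp, CategoryTheory.Functor.map_comp, vmap_comp, Category.comp_id]
    rfl

/-- The endofunctor `N ↦ ∫_x [P(x; -), N x]`. -/
def wedge : (Word X ⥤ V) ⥤ (Word X ⥤ V) where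
  obj N := wedgeObj P N
  map k :=
    { app := fun _ ↦ vmap (𝟙 _) k
      naturality := fun _ _ f ↦ by
        simp only [wedgeObj, vmap_comp, Category.comp_id, Category.id_comp] }
  map_id N := by
    ext w
    exact vmap_id _ _
  map_comp k l := by
    ext w
    exact (by rw [vmap_comp, Category.comp_id] :
      vmap (𝟙 ((bigP P).obj w).functor) (k ≫ l) = vmap (𝟙 _) k ≫ vmap (𝟙 _) l)

theorem wedgeObj_map_iso (N : Word X ⥤ V) {a b : Word X} (e : a ≅ b) :
    (wedgeObj P N).map e.hom = vmap ((bigP P).map e.inv).natTrans (𝟙 N) := by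
  change vmap ((bigP P).map (inv e.hom)).natTrans (𝟙 N) = _
  rw [IsIso.Iso.inv_hom]

open Functor.LaxMonoidal

/-- The pairing given by a lax monoidal structure. -/
def laxPairing (N : Word X ⥤ V) [N.LaxMonoidal] : Pairing N N N where
  app x y := μ N x y
  natural f g := μ_natural N f g

theorem bigP_inv_whiskerRight {a a' : Word X} (f : a ⟶ a') (b : Word X) :
    (bigP P).map (inv (f ▷ b)) = (bigP P).map (inv f) ▷ (bigP P).obj b := by
  have h : ∀ g : a' ⟶ a, (bigP P).map (g ▷ b) = (bigP P).map g ▷ (bigP P).obj b := by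
    rintro ⟨g⟩
    rfl
  exact (congrArg (bigP P).map (inv_whiskerRight f b)).trans (h (inv f))

theorem bigP_inv_whiskerLeft {a a' : Word X} (b : Word X) (f : a ⟶ a') :
    (bigP P).map (inv (b ◁ f)) = (bigP P).obj b ◁ (bigP P).map (inv f) := by
  have h : ∀ g : a' ⟶ a, (bigP P).map (b ◁ g) = (bigP P).obj b ◁ (bigP P).map g := by
    rintro ⟨g⟩
    rfl
  exact (congrArg (bigP P).map (inv_whiskerLeft b f)).trans (h (inv f))

theorem wedgeObj_map_whiskerRight (N : Word X ⥤ V) {a a' : Word X} (f : a ⟶ a') (b : Word X) :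
    (wedgeObj P N).map (f ▷ b) =
      vmap ((bigP P).map (inv f) ▷ (bigP P).obj b).natTrans (𝟙 N) :=
  congrArg (fun g ↦ vmap (Hom.natTrans g) (𝟙 N)) (bigP_inv_whiskerRight P f b)

theorem wedgeObj_map_whiskerLeft (N : Word X ⥤ V) {a a' : Word X} (b : Word X) (f : a ⟶ a') :
    (wedgeObj P N).map (b ◁ f) =
      vmap ((bigP P).obj b ◁ (bigP P).map (inv f)).natTrans (𝟙 N) :=
  congrArg (fun g ↦ vmap (Hom.natTrans g) (𝟙 N)) (bigP_inv_whiskerLeft P b f)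

theorem wedgeObj_map_assoc (N : Word X ⥤ V) (a b c : Word X) :
    (wedgeObj P N).map (α_ a b c).hom =
      vmap (α_ ((bigP P).obj a) ((bigP P).obj b) ((bigP P).obj c)).inv.natTrans (𝟙 N) :=
  wedgeObj_map_iso P N (α_ a b c)

theorem wedgeObj_map_left (N : Word X ⥤ V) (a : Word X) :
    (wedgeObj P N).map (λ_ a).hom = vmap (λ_ ((bigP P).obj a)).inv.natTrans (𝟙 N) :=
  wedgeObj_map_iso P N (λ_ a)

theorem wedgeObj_map_right (N : Word X ⥤ V) (a : Word X) :
    (wedgeObj P N).map (ρ_ a).hom = vmap (ρ_ ((bigP P).obj a)).inv.natTrans (𝟙 N) :=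
  wedgeObj_map_iso P N (ρ_ a)

theorem wedgeObj_map_braid (N : Word X ⥤ V) (a b : Word X) :
    (wedgeObj P N).map (β_ a b).hom =
      vmap (β_ ((bigP P).obj a) ((bigP P).obj b)).inv.natTrans (𝟙 N) :=
  wedgeObj_map_iso P N (β_ a b)

theorem vunit_natural {K K' : Word X ⥤ V} (k₀ : 𝟙_ V ⟶ K.obj (𝟙_ _)) (k : K ⟶ K')
    {k₀' : 𝟙_ V ⟶ K'.obj (𝟙_ _)} (h : k₀ ≫ k.app _ = k₀') :
    vunit k₀ ≫ vmap (𝟙 _) k = vunit k₀' := by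
  refine vhom_unit_ext ?_
  have h1 := vunit_vev k₀
  rw [vunit_vev, comp_whiskerRight_assoc, vmap_vev, NatTrans.id_app,
    MonoidalCategory.whiskerLeft_id, Category.id_comp, reassoc_of% h1, h]

theorem vmap_id_day (F : SMod V X) (N : Word X ⥤ V) :
    vmap (Hom.natTrans (𝟙 F)) (𝟙 N) = 𝟙 _ := vmap_id F.functor N

/-- The components of the tensorator of `wedge N`. -/
def wedgeμ (N : Word X ⥤ V) [N.LaxMonoidal] (a b : Word X) :
    (wedgeObj P N).obj a ⊗ (wedgeObj P N).obj b ⟶ (wedgeObj P N).obj (a ⊗ b) :=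
  vpair (F := (bigP P).obj a) (G := (bigP P).obj b) (laxPairing N)

theorem wedgeμ_natural_left (N : Word X ⥤ V) [N.LaxMonoidal] {a a' : Word X} (f : a ⟶ a')
    (b : Word X) : ((wedgeObj P N).map f ▷ _) ≫ wedgeμ P N a' b =
      wedgeμ P N a b ≫ (wedgeObj P N).map (f ▷ b) := by
  have h := vpair_natural (laxPairing N) (laxPairing N) ((bigP P).map (inv f))
    (𝟙 ((bigP P).obj b)) (𝟙 N) (𝟙 N) (𝟙 N) (fun x y ↦ by simp)
  rw [vmap_id_day, tensorHom_id, tensorHom_id] at h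
  rw [wedgeObj_map_whiskerRight]
  exact h

theorem wedgeμ_natural_right (N : Word X ⥤ V) [N.LaxMonoidal] (a : Word X) {b b' : Word X}
    (f : b ⟶ b') : (_ ◁ (wedgeObj P N).map f) ≫ wedgeμ P N a b' =
      wedgeμ P N a b ≫ (wedgeObj P N).map (a ◁ f) := by
  have h := vpair_natural (laxPairing N) (laxPairing N) (𝟙 ((bigP P).obj a))
    ((bigP P).map (inv f)) (𝟙 N) (𝟙 N) (𝟙 N) (fun x y ↦ by simp)
  rw [vmap_id_day, id_tensorHom, id_tensorHom] at h
  rw [wedgeObj_map_whiskerLeft]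
  exact h

theorem wedgeμ_assoc (N : Word X ⥤ V) [N.LaxMonoidal] (a b c : Word X) :
    (wedgeμ P N a b ▷ _) ≫ wedgeμ P N (a ⊗ b) c ≫ (wedgeObj P N).map (α_ a b c).hom =
      (α_ _ _ _).hom ≫ (_ ◁ wedgeμ P N b c) ≫ wedgeμ P N a (b ⊗ c) := by
  rw [wedgeObj_map_assoc]
  exact vpair_assoc (laxPairing N) (laxPairing N) (laxPairing N) (laxPairing N) (𝟙 N)
    (fun x y z ↦ by
      simp [laxPairing])

theorem wedgeμ_left (N : Word X ⥤ V) [N.LaxMonoidal] (a : Word X) :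
    (λ_ _).hom = (vunit (ε N) ▷ _) ≫ wedgeμ P N (𝟙_ _) a ≫ (wedgeObj P N).map (λ_ a).hom := by
  rw [wedgeObj_map_left]
  exact (vpair_leftUnit (laxPairing N) (ε N) (𝟙 N) (fun y ↦ by simp [laxPairing])).symm

theorem wedgeμ_right (N : Word X ⥤ V) [N.LaxMonoidal] (a : Word X) :
    (ρ_ _).hom = (_ ◁ vunit (ε N)) ≫ wedgeμ P N a (𝟙_ _) ≫ (wedgeObj P N).map (ρ_ a).hom := by
  rw [wedgeObj_map_right]
  exact (vpair_rightUnit (laxPairing N) (ε N) (𝟙 N) (fun y ↦ by simp [laxPairing])).symm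

theorem wedgeμ_braid (N : Word X ⥤ V) [N.LaxBraided] (a b : Word X) :
    wedgeμ P N a b ≫ (wedgeObj P N).map (β_ a b).hom = (β_ _ _).hom ≫ wedgeμ P N b a := by
  rw [wedgeObj_map_braid]
  exact vpair_braid (laxPairing N) (laxPairing N) (𝟙 N) (fun x y ↦ by
    have h := Functor.LaxBraided.braided (F := N) y x
    simp [laxPairing, h])

instance wedgeLaxMonoidal (N : Word X ⥤ V) [N.LaxMonoidal] :
    ((wedge P).obj N).LaxMonoidal where
  ε := vunit (ε N)
  μ := wedgeμ P N
  μ_natural_left f b := wedgeμ_natural_left P N f b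
  μ_natural_right a f := wedgeμ_natural_right P N a f
  associativity a b c := wedgeμ_assoc P N a b c
  left_unitality a := wedgeμ_left P N a
  right_unitality a := wedgeμ_right P N a

instance wedgeLaxBraided (N : Word X ⥤ V) [N.LaxBraided] :
    ((wedge P).obj N).LaxBraided where
  braided a b := wedgeμ_braid P N a b

instance wedge_map_isMonoidal {N N' : Word X ⥤ V} [N.LaxMonoidal] [N'.LaxMonoidal] (k : N ⟶ N')
    [NatTrans.IsMonoidal k] : NatTrans.IsMonoidal ((wedge P).map k) where
  unit := by
    change vunit (ε N) ≫ vmap (𝟙 _) k = vunit (ε N')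
    exact vunit_natural _ k (NatTrans.IsMonoidal.unit (τ := k))
  tensor a b := by
    change wedgeμ P N a b ≫ vmap (𝟙 _) k = (vmap (𝟙 _) k ⊗ₘ vmap (𝟙 _) k) ≫ wedgeμ P N' a b
    have h := vpair_natural (laxPairing N) (laxPairing N') (𝟙 ((bigP P).obj a))
      (𝟙 ((bigP P).obj b)) k k k (fun x y ↦ NatTrans.IsMonoidal.tensor x y)
    rw [id_tensorHom_id] at h
    exact h.symm

end Wedge

section WedgeDay

variable (P : X → SMod V X)

/-- The functor `wedge P`, on objects of the Day convolution category. -/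
def wedgeDay : SMod V X ⥤ SMod V X where
  obj N := ⟨wedgeObj P N.functor⟩
  map k := ⟨(wedge P).map k.natTrans⟩
  map_id N := congrArg Hom.mk ((wedge P).map_id N.functor)
  map_comp k l := congrArg Hom.mk ((wedge P).map_comp k.natTrans l.natTrans)

/-- The universal pairing of the Day tensor product. -/
def dayPairing (F G : SMod V X) : Pairing F.functor G.functor (F ⊗ G).functor where
  app := dayι F G
  natural f g := dayι_natural F G f g

/-- The tensorator of `wedgeDay P`. -/
def wedgeDayμ (F G : SMod V X) :
    (wedgeDay P).obj F ⊗ (wedgeDay P).obj G ⟶ (wedgeDay P).obj (F ⊗ G) :=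
  tensorDesc
    { app := fun p ↦ vpair (F := (bigP P).obj p.1) (G := (bigP P).obj p.2) (dayPairing F G)
      naturality := by
        rintro ⟨a, b⟩ ⟨a', b'⟩ ⟨f, g⟩
        change ((wedgeObj P F.functor).map f ▷ _ ≫ _ ◁ (wedgeObj P G.functor).map g) ≫ _ =
          _ ≫ (wedgeObj P (F ⊗ G).functor).map (f ⊗ₘ g)
        have h := vpair_natural (dayPairing F G) (dayPairing F G) ((bigP P).map (inv f))
          ((bigP P).map (inv g)) (𝟙 _) (𝟙 _) (𝟙 _) (fun x y ↦ by simp)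
        rw [← MonoidalCategory.tensorHom_def]
        have h2 : (wedgeObj P (F ⊗ G).functor).map (f ⊗ₘ g) =
            vmap ((bigP P).map (inv f) ⊗ₘ (bigP P).map (inv g)).natTrans (𝟙 _) := by
          rw [MonoidalCategory.tensorHom_def' ((bigP P).map (inv f)),
            MonoidalCategory.tensorHom_def f, CategoryTheory.Functor.map_comp,
            wedgeObj_map_whiskerRight, wedgeObj_map_whiskerLeft]
          exact (vmap_comp _ _ _ _).trans (congrArg _ (Category.comp_id _))
        rw [h2]
        exact h }

theorem dayι_wedgeDayμ (F G : SMod V X) (a b : Word X) :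
    dayι ((wedgeDay P).obj F) ((wedgeDay P).obj G) a b ≫ (wedgeDayμ P F G).natTrans.app (a ⊗ b) =
      vpair (F := (bigP P).obj a) (G := (bigP P).obj b) (dayPairing F G) :=
  η_comp_tensorDesc_app _ _ _

/-- The unit of `wedgeDay P`. -/
def wedgeDayε : 𝟙_ (SMod V X) ⟶ (wedgeDay P).obj (𝟙_ _) :=
  unitDesc (vunit (ν (Word X) V))

theorem ν_wedgeDayε :
    ν (Word X) V ≫ (wedgeDayε P).natTrans.app (𝟙_ _) = vunit (ν (Word X) V) :=
  ν_comp_unitDesc _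

theorem wedgeDayμ_natural {F F' G G' : SMod V X} (k : F ⟶ F') (l : G ⟶ G') :
    ((wedgeDay P).map k ⊗ₘ (wedgeDay P).map l) ≫ wedgeDayμ P F' G' =
      wedgeDayμ P F G ≫ (wedgeDay P).map (k ⊗ₘ l) := by
  refine tensor_hom_ext (fun a b ↦ ?_)
  change dayι _ _ a b ≫ _ = dayι _ _ a b ≫ _
  have h := vpair_natural (dayPairing F G) (dayPairing F' G') (𝟙 ((bigP P).obj a))
    (𝟙 ((bigP P).obj b)) k.natTrans l.natTrans (k ⊗ₘ l).natTrans (fun x y ↦ dayι_map k l x y)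
  rw [id_tensorHom_id] at h
  rw [natTrans_comp, natTrans_comp, reassoc_of% dayι_map, dayι_wedgeDayμ,
    reassoc_of% dayι_wedgeDayμ]
  exact h

theorem wedgeDayμ_assoc (F G H : SMod V X) :
    (wedgeDayμ P F G ▷ _) ≫ wedgeDayμ P (F ⊗ G) H ≫ (wedgeDay P).map (α_ F G H).hom =
      (α_ _ _ _).hom ≫ (_ ◁ wedgeDayμ P G H) ≫ wedgeDayμ P F (G ⊗ H) := by
  refine day_hom_ext₃ (fun a b c ↦ ?_)
  simp only [natTrans_comp]
  rw [reassoc_of% dayι_whiskerRight, ← comp_whiskerRight_assoc, dayι_wedgeDayμ,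
    reassoc_of% dayι_wedgeDayμ, reassoc_of% dayι_assoc, NatTrans.naturality_assoc,
    NatTrans.naturality, reassoc_of% dayι_whiskerLeft, ← MonoidalCategory.whiskerLeft_comp_assoc,
    dayι_wedgeDayμ, reassoc_of% dayι_wedgeDayμ]
  have h := vpair_assoc (F := (bigP P).obj a) (G := (bigP P).obj b) (H := (bigP P).obj c)
    (dayPairing F G) (dayPairing (F ⊗ G) H) (dayPairing G H) (dayPairing F (G ⊗ H))
    (α_ F G H).hom.natTrans (fun x y z ↦ dayι_assoc F G H x y z)
  have h1 : ((wedgeDay P).obj (F ⊗ G ⊗ H)).functor.map (α_ a b c).inv =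
      vmap (α_ ((bigP P).obj a) ((bigP P).obj b) ((bigP P).obj c)).hom.natTrans (𝟙 _) :=
    wedgeObj_map_iso P (F ⊗ G ⊗ H).functor (α_ a b c).symm
  have h2 : vmap (α_ ((bigP P).obj a) ((bigP P).obj b) ((bigP P).obj c)).inv.natTrans
      (α_ F G H).hom.natTrans ≫
      vmap (α_ ((bigP P).obj a) ((bigP P).obj b) ((bigP P).obj c)).hom.natTrans (𝟙 _) =
        ((wedgeDay P).map (α_ F G H).hom).natTrans.app ((a ⊗ b) ⊗ c) := by
    rw [vmap_comp, Category.comp_id]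
    exact congrArg (fun t ↦ vmap (Hom.natTrans t) (α_ F G H).hom.natTrans)
      (α_ ((bigP P).obj a) ((bigP P).obj b) ((bigP P).obj c)).hom_inv_id
  have h3 := congrArg (· ≫ vmap (α_ ((bigP P).obj a) ((bigP P).obj b)
    ((bigP P).obj c)).hom.natTrans (𝟙 _)) h
  simp only [Category.assoc] at h3
  rw [h1, ← h2]
  exact h3

instance wedgeDayLaxMonoidal : (wedgeDay P).LaxMonoidal where
  ε := wedgeDayε P
  μ := wedgeDayμ P
  μ_natural_left k G := by
    have h := wedgeDayμ_natural P k (𝟙 G)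
    rwa [CategoryTheory.Functor.map_id, tensorHom_id, tensorHom_id] at h
  μ_natural_right F l := by
    have h := wedgeDayμ_natural P (𝟙 F) l
    rwa [CategoryTheory.Functor.map_id, id_tensorHom, id_tensorHom] at h
  associativity := wedgeDayμ_assoc P
  left_unitality F := by
    rw [← cancel_epi (λ_ _).inv, Iso.inv_hom_id]
    refine hom_ext (NatTrans.ext (funext fun a ↦ ?_))
    have h := vpair_leftUnit (G := (bigP P).obj a) (dayPairing (𝟙_ _) F) (ν (Word X) V)
      (λ_ F).hom.natTrans (fun y ↦ dayι_leftUnit F y)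
    have h1 : ((wedgeDay P).obj (𝟙_ _ ⊗ F)).functor.map (λ_ a).hom =
        vmap (λ_ ((bigP P).obj a)).inv.natTrans (𝟙 _) := wedgeObj_map_left P _ a
    have h2 : vmap (λ_ ((bigP P).obj a)).inv.natTrans (𝟙 _) ≫
        ((wedgeDay P).map (λ_ F).hom).natTrans.app a =
          vmap (λ_ ((bigP P).obj a)).inv.natTrans (λ_ F).hom.natTrans := by
      refine (vmap_comp _ _ _ _).trans ?_
      rw [Category.id_comp, Category.id_comp]
    simp only [natTrans_comp, natTrans_id]
    rw [day_leftUnitor_inv]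
    simp only [Category.assoc]
    rw [NatTrans.naturality_assoc, NatTrans.naturality_assoc, reassoc_of% dayι_whiskerRight,
      reassoc_of% dayι_wedgeDayμ, ← comp_whiskerRight_assoc, ν_wedgeDayε, h1, eq_comm,
      Iso.inv_comp_eq, Category.comp_id]
    rw [← h2] at h
    exact h
  right_unitality F := by
    rw [← cancel_epi (ρ_ _).inv, Iso.inv_hom_id]
    refine hom_ext (NatTrans.ext (funext fun a ↦ ?_))
    have h := vpair_rightUnit (F := (bigP P).obj a) (dayPairing F (𝟙_ _)) (ν (Word X) V)
      (ρ_ F).hom.natTrans (fun y ↦ dayι_rightUnit F y)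
    have h1 : ((wedgeDay P).obj (F ⊗ 𝟙_ _)).functor.map (ρ_ a).hom =
        vmap (ρ_ ((bigP P).obj a)).inv.natTrans (𝟙 _) := wedgeObj_map_right P _ a
    have h2 : vmap (ρ_ ((bigP P).obj a)).inv.natTrans (𝟙 _) ≫
        ((wedgeDay P).map (ρ_ F).hom).natTrans.app a =
          vmap (ρ_ ((bigP P).obj a)).inv.natTrans (ρ_ F).hom.natTrans := by
      refine (vmap_comp _ _ _ _).trans ?_
      rw [Category.id_comp, Category.id_comp]
    simp only [natTrans_comp, natTrans_id]
    rw [day_rightUnitor_inv]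
    simp only [Category.assoc]
    rw [NatTrans.naturality_assoc, NatTrans.naturality_assoc, reassoc_of% dayι_whiskerLeft,
      reassoc_of% dayι_wedgeDayμ, ← MonoidalCategory.whiskerLeft_comp_assoc, ν_wedgeDayε, h1,
      eq_comm, Iso.inv_comp_eq, Category.comp_id]
    rw [← h2] at h
    exact h

instance wedgeDayLaxBraided : (wedgeDay P).LaxBraided where
  braided F G := by
    refine tensor_hom_ext (fun a b ↦ ?_)
    change dayι _ _ a b ≫ (wedgeDayμ P F G ≫ _).natTrans.app _ =
      dayι _ _ a b ≫ (_ ≫ wedgeDayμ P G F).natTrans.app _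
    rw [natTrans_comp, natTrans_comp, reassoc_of% dayι_wedgeDayμ, reassoc_of% dayι_braid,
      NatTrans.naturality, reassoc_of% dayι_wedgeDayμ]
    have h := vpair_braid (F := (bigP P).obj a) (G := (bigP P).obj b)
      (dayPairing F G) (dayPairing G F) (β_ F G).hom.natTrans (fun x y ↦ dayι_braid F G x y)
    have h1 : ((wedgeDay P).obj (G ⊗ F)).functor.map (β_ b a).hom =
        vmap (β_ ((bigP P).obj a) ((bigP P).obj b)).hom.natTrans (𝟙 _) :=
      (wedgeObj_map_braid P _ b a).trans rfl
    have h2 : vmap (β_ ((bigP P).obj a) ((bigP P).obj b)).inv.natTrans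
        (β_ F G).hom.natTrans ≫
        vmap (β_ ((bigP P).obj a) ((bigP P).obj b)).hom.natTrans (𝟙 _) =
          ((wedgeDay P).map (β_ F G).hom).natTrans.app (a ⊗ b) := by
      rw [vmap_comp, Category.comp_id]
      exact congrArg (fun t ↦ vmap (Hom.natTrans t) (β_ F G).hom.natTrans)
        (β_ ((bigP P).obj a) ((bigP P).obj b)).hom_inv_id
    have h3 := congrArg (· ≫ vmap (β_ ((bigP P).obj a) ((bigP P).obj b)).hom.natTrans (𝟙 _)) h
    simp only [Category.assoc] at h3
    rw [h1, ← h2]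
    exact h3
end WedgeDay

/-! ### Colored operads -/

/-- Composition of natural transformations: `∫ [B, C] ⊗ ∫ [A, B] ⟶ ∫ [A, C]`. -/
def vcomp (A B C : Word X ⥤ V) : vhom B C ⊗ vhom A B ⟶ vhom A C :=
  vlift
    { app := fun x ↦ (α_ _ _ _).hom ≫ (_ ◁ (vev A B).app x) ≫ (vev B C).app x
      naturality := fun x y f ↦ by
        have h1 := (vev A B).naturality f
        have h2 := (vev B C).naturality f
        dsimp at h1 h2 ⊢
        simp only [Category.assoc]
        rw [← h2, associator_naturality_right_assoc, ← MonoidalCategory.whiskerLeft_comp_assoc,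
          h1, MonoidalCategory.whiskerLeft_comp_assoc] }

theorem act_vcomp {A B C : Word X ⥤ V} {Z Z' D : V} {x : Word X} (f : Z ⟶ vhom B C)
    (g : Z' ⟶ vhom A B) (a : D ⟶ A.obj x) :
    act ((f ⊗ₘ g) ≫ vcomp A B C) a = (α_ _ _ _).hom ≫ act f (act g a) := by
  have h : act (vcomp A B C) (𝟙 (A.obj x)) =
      (α_ _ _ _).hom ≫ (_ ◁ (vev A B).app x) ≫ (vev B C).app x := by
    rw [act, tensorHom_id]
    exact vlift_vev _ _
  have h2 := act_comp (f ⊗ₘ g) (vcomp A B C) a (𝟙 _)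
  rw [Category.comp_id] at h2
  rw [h2, h, act, act, associator_naturality_assoc, tensorHom_comp_whiskerLeft_assoc]

theorem act_vlift {A K : Word X ⥤ V} {Z D : V} (t : A ⋙ tensorLeft Z ⟶ K) {x : Word X}
    (a : D ⟶ A.obj x) : act (vlift t) a = (Z ◁ a) ≫ t.app x := by
  rw [act, MonoidalCategory.tensorHom_def', Category.assoc, vlift_vev]

section Elements

variable {A A' B B' C : SMod V X} {a a' b b' c : Word X} (i : 𝟙_ V ⟶ A.functor.obj a)
  (j : 𝟙_ V ⟶ B.functor.obj b) (k : 𝟙_ V ⟶ C.functor.obj c)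

/-- The element of `A ⊗ B` given by elements of `A` and `B`. -/
def dayElt : 𝟙_ V ⟶ (A ⊗ B).functor.obj (a ⊗ b) :=
  (λ_ (𝟙_ V)).inv ≫ (i ⊗ₘ j) ≫ dayι A B a b

theorem dayElt_natural (s : A ⟶ A') (t : B ⟶ B') (f : a ⟶ a') (g : b ⟶ b') :
    dayElt i j ≫ (A ⊗ B).functor.map (f ⊗ₘ g) ≫ (s ⊗ₘ t).natTrans.app (a' ⊗ b') =
      dayElt (i ≫ A.functor.map f ≫ s.natTrans.app a')
        (j ≫ B.functor.map g ≫ t.natTrans.app b') := by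
  rw [dayElt, dayElt, Category.assoc, Category.assoc,
    ← reassoc_of% dayι_natural, dayι_map, tensorHom_comp_tensorHom_assoc,
    tensorHom_comp_tensorHom_assoc]
  simp only [Category.assoc]

theorem dayElt_assoc : dayElt (dayElt i j) k ≫ ((A ⊗ B) ⊗ C).functor.map (α_ a b c).hom ≫
    (α_ A B C).hom.natTrans.app (a ⊗ b ⊗ c) = dayElt i (dayElt j k) := by
  have h2 : dayElt (dayElt i j) k = (λ_ (𝟙_ V)).inv ≫ ((λ_ (𝟙_ V)).inv ▷ _) ≫
      ((i ⊗ₘ j) ⊗ₘ k) ≫ (dayι A B a b ▷ _) ≫ dayι (A ⊗ B) C (a ⊗ b) c := by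
    rw [tensorHom_comp_whiskerRight_assoc, whiskerRight_comp_tensorHom_assoc]
    rfl
  have h3 : dayElt i (dayElt j k) = (λ_ (𝟙_ V)).inv ≫ (_ ◁ (λ_ (𝟙_ V)).inv) ≫
      (i ⊗ₘ (j ⊗ₘ k)) ≫ (_ ◁ dayι B C b c) ≫ dayι A (B ⊗ C) a (b ⊗ c) := by
    rw [tensorHom_comp_whiskerLeft_assoc, whiskerLeft_comp_tensorHom_assoc]
    rfl
  have h4 := dayι_assoc A B C a b c
  rw [NatTrans.naturality, h2, h3]
  simp only [Category.assoc]
  rw [reassoc_of% h4, ← CategoryTheory.Functor.map_comp, Iso.inv_hom_id,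
    CategoryTheory.Functor.map_id, Category.comp_id, associator_naturality_assoc]
  simp only [← Category.assoc]
  congr 3
  monoidal

theorem dayElt_left : dayElt (ν (Word X) V) i ≫ (𝟙_ _ ⊗ A).functor.map (λ_ a).hom ≫
    (λ_ A).hom.natTrans.app a = i := by
  rw [NatTrans.naturality, dayElt, MonoidalCategory.tensorHom_def']
  simp only [Category.assoc]
  rw [reassoc_of% dayι_leftUnit, ← CategoryTheory.Functor.map_comp, Iso.inv_hom_id,
    CategoryTheory.Functor.map_id, Category.comp_id, leftUnitor_naturality, Iso.inv_hom_id_assoc]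

theorem dayElt_right : dayElt i (ν (Word X) V) ≫ (A ⊗ 𝟙_ _).functor.map (ρ_ a).hom ≫
    (ρ_ A).hom.natTrans.app a = i := by
  rw [NatTrans.naturality, dayElt, MonoidalCategory.tensorHom_def]
  simp only [Category.assoc]
  rw [reassoc_of% dayι_rightUnit, ← CategoryTheory.Functor.map_comp, Iso.inv_hom_id,
    CategoryTheory.Functor.map_id, Category.comp_id, rightUnitor_naturality, ← unitors_equal,
    Iso.inv_hom_id_assoc]

theorem dayElt_braid : dayElt i j ≫ (A ⊗ B).functor.map (β_ a b).hom ≫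
    (β_ A B).hom.natTrans.app (b ⊗ a) = dayElt j i := by
  rw [NatTrans.naturality, dayElt, dayElt]
  simp only [Category.assoc]
  rw [reassoc_of% dayι_braid, ← CategoryTheory.Functor.map_comp, SymmetricCategory.symmetry,
    CategoryTheory.Functor.map_id, Category.comp_id, BraidedCategory.braiding_naturality_assoc]
  simp [← unitors_equal]

end Elements

/-- The data of a colored operad with set of colors `X`: the objects of operations `P(w; y)`,
the identities and the compositions. -/
structure OperadData (V : Type u) [Category.{v} V] [MonoidalCategory V] [SymmetricCategory V]
    [MonoidalClosed V] [HasLimits V] [HasColimits V] (X : Type v) where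
  /-- `(obj y).functor.obj w` is the object `P(w; y)` of operations with inputs `w` and
  output `y`. -/
  obj : X → SMod V X
  /-- the identities -/
  one (y : X) : 𝟙_ V ⟶ (obj y).functor.obj (Word.of y)
  /-- the compositions -/
  mul (y : X) (w x : Word X) : (obj y).functor.obj w ⊗ ((bigP obj).obj w).functor.obj x ⟶
    (obj y).functor.obj x
  mul_natural (y : X) (w : Word X) {x x' : Word X} (f : x ⟶ x') :
    (_ ◁ ((bigP obj).obj w).functor.map f) ≫ mul y w x' = mul y w x ≫ (obj y).functor.map f
  mul_balanced (y : X) {w w' : Word X} (f : w ⟶ w') (x : Word X) :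
    ((obj y).functor.map f ▷ _) ≫ mul y w' x =
      (_ ◁ ((bigP obj).map (inv f)).natTrans.app x) ≫ mul y w x

namespace OperadData

variable (P : OperadData V X)

/-- The object of operations `P(x; w) = ⨂ P(xᵢ; wᵢ)` with several outputs. -/
abbrev ops (w x : Word X) : V := ((bigP P.obj).obj w).functor.obj x

/-- The transpose of the composition. -/
def mulT (y : X) : P.obj y ⟶ (wedgeDay P.obj).obj (P.obj y) where
  natTrans :=
    { app := fun w ↦ vlift
        { app := fun x ↦ P.mul y w x
          naturality := fun _ _ f ↦ P.mul_natural y w f }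
      naturality := fun w w' f ↦ by
        refine act_ext (fun x ↦ ?_)
        refine Eq.trans (act_comp_left _ _ _)
          (Eq.trans ?_ (act_vmap _ ((bigP P.obj).map (inv f)).natTrans (𝟙 _) _).symm)
        rw [act_vlift, act_vlift, MonoidalCategory.whiskerLeft_id,
          Category.id_comp, Category.id_comp, NatTrans.id_app, Category.comp_id]
        exact P.mul_balanced y f x }

/-- The extension of the composition to operations with several outputs. -/
def compT : bigP P.obj ⟶ bigP P.obj ⋙ wedgeDay P.obj :=
  Word.liftDesc (bigP P.obj ⋙ wedgeDay P.obj) P.mulT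

/-- The composition `P(z; w) ⊗ P(x; z) ⟶ P(x; w)` of operations with several outputs. -/
def comp (w z x : Word X) : P.ops w z ⊗ P.ops z x ⟶ P.ops w x :=
  act (A := ((bigP P.obj).obj z).functor) (K := ((bigP P.obj).obj w).functor)
    ((P.compT.app w).natTrans.app z) (𝟙 _)

/-- The identities `𝟙_ V ⟶ P(w; w)`. -/
def ident : ∀ w : Word X, 𝟙_ V ⟶ P.ops w w
  | .of y => P.one y
  | .unit => ν (Word X) V
  | .tensor a b => dayElt (A := (bigP P.obj).obj a) (B := (bigP P.obj).obj b) (ident a) (ident b)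

/-- The naturality condition for the identities. -/
def IdentNat {a b : Word X} (f : a ⟶ b) : Prop :=
  P.ident a ≫ ((bigP P.obj).obj a).functor.map f ≫ ((bigP P.obj).map f).natTrans.app b =
    P.ident b

theorem identNat_id (a : Word X) : P.IdentNat (𝟙 a) := by
  rw [IdentNat, CategoryTheory.Functor.map_id, CategoryTheory.Functor.map_id, natTrans_id,
    Category.comp_id, Category.comp_id]

theorem identNat_comp {a b c : Word X} {f : a ⟶ b} {g : b ⟶ c} (hf : P.IdentNat f)
    (hg : P.IdentNat g) : P.IdentNat (f ≫ g) := by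
  rw [IdentNat] at hf hg ⊢
  rw [← hg, ← hf, CategoryTheory.Functor.map_comp, CategoryTheory.Functor.map_comp, natTrans_comp]
  simp only [Category.assoc, NatTrans.naturality_assoc]

theorem identNat_inv {a b : Word X} {e : a ≅ b} (h : P.IdentNat e.hom) :
    P.IdentNat e.inv := by
  rw [IdentNat] at h ⊢
  have h1 := ((bigP P.obj).map e.hom).natTrans.naturality e.inv
  rw [← h]
  simp only [Category.assoc]
  rw [← reassoc_of% h1, ← natTrans_comp, ← CategoryTheory.Functor.map_comp, Iso.hom_inv_id,
    ← CategoryTheory.Functor.map_comp_assoc, Iso.hom_inv_id, CategoryTheory.Functor.map_id,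
    CategoryTheory.Functor.map_id, natTrans_id, Category.comp_id, Category.comp_id]

theorem identNat_tensor {a b c d : Word X} {f : a ⟶ c} {g : b ⟶ d} (hf : P.IdentNat f)
    (hg : P.IdentNat g) : P.IdentNat (f ⊗ₘ g) := by
  have h1 : ∀ (f : a ⟶ c) (g : b ⟶ d), (bigP P.obj).map (f ⊗ₘ g) =
      (bigP P.obj).map f ⊗ₘ (bigP P.obj).map g := by
    rintro ⟨f⟩ ⟨g⟩
    rfl
  have h2 := dayElt_natural (P.ident a) (P.ident b) ((bigP P.obj).map f) ((bigP P.obj).map g) f g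
  rw [IdentNat] at hf hg ⊢
  rw [hf, hg] at h2
  rw [h1]
  exact h2

theorem identNat_assoc (a b c : Word X) : P.IdentNat (α_ a b c).hom :=
  dayElt_assoc (P.ident a) (P.ident b) (P.ident c)

theorem identNat_left (a : Word X) : P.IdentNat (λ_ a).hom :=
  dayElt_left (P.ident a)

theorem identNat_right (a : Word X) : P.IdentNat (ρ_ a).hom :=
  dayElt_right (P.ident a)

theorem identNat_braid (a b : Word X) : P.IdentNat (β_ a b).hom :=
  dayElt_braid (P.ident a) (P.ident b)

theorem ident_natural {a b : Word X} (f : a ⟶ b) : P.IdentNat f := by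
  induction f using Word.hom_induction with
  | id a => exact P.identNat_id a
  | comp f g hf hg => exact P.identNat_comp hf hg
  | whiskerLeft a f hf =>
    rw [← id_tensorHom]
    exact P.identNat_tensor (P.identNat_id a) hf
  | whiskerRight f a hf =>
    rw [← tensorHom_id]
    exact P.identNat_tensor hf (P.identNat_id a)
  | assocHom a b c => exact P.identNat_assoc a b c
  | assocInv a b c => exact P.identNat_inv (P.identNat_assoc a b c)
  | leftHom a => exact P.identNat_left a
  | leftInv a => exact P.identNat_inv (P.identNat_left a)
  | rightHom a => exact P.identNat_right a
  | rightInv a => exact P.identNat_inv (P.identNat_right a)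
  | swap a b => exact P.identNat_braid a b

end OperadData

/-- Colored operads in `V`, with set of colors `X`. -/
structure Operad (V : Type u) [Category.{v} V] [MonoidalCategory V] [SymmetricCategory V]
    [MonoidalClosed V] [HasLimits V] [HasColimits V] (X : Type v) extends OperadData V X where
  mul_assoc (y : X) (w z x : Word X) :
    (mul y w z ▷ _) ≫ mul y z x = (α_ _ _ _).hom ≫ (_ ◁ toOperadData.comp w z x) ≫ mul y w x
  one_mul (y : X) (x : Word X) : (one y ▷ _) ≫ mul y (Word.of y) x = (λ_ _).hom
  mul_one (y : X) (w : Word X) : (_ ◁ toOperadData.ident w) ≫ mul y w w = (ρ_ _).hom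

/-! ### The comonad structure of `wedge P` -/

theorem vcomp_natural {A A' B C C' : Word X ⥤ V} (s : A' ⟶ A) (k : C ⟶ C') :
    (vmap (𝟙 B) k ⊗ₘ vmap s (𝟙 B)) ≫ vcomp A' B C' = vcomp A B C ≫ vmap s k := by
  refine act_ext (fun x ↦ ?_)
  have e1 := act_vmap (𝟙 (vhom A B)) s (𝟙 B) (𝟙 (A'.obj x))
  have e2 := act_vcomp (𝟙 (vhom B C)) (𝟙 (vhom A B)) (s.app x)
  rw [id_tensorHom_id, Category.id_comp] at e2
  rw [Category.id_comp, NatTrans.id_app, Category.comp_id, Category.id_comp] at e1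
  have e3 := act_vmap (𝟙 (vhom B C)) (𝟙 B) k (act (𝟙 (vhom A B)) (s.app x))
  rw [Category.id_comp, NatTrans.id_app, Category.comp_id] at e3
  rw [act_vcomp, act_vmap, e1, e3, Category.id_comp, e2, Category.assoc]

theorem vcomp_dinatural {A B B' C : Word X ⥤ V} (s : B' ⟶ B) :
    (vmap s (𝟙 C) ▷ _) ≫ vcomp A B' C = (_ ◁ vmap (𝟙 A) s) ≫ vcomp A B C := by
  rw [← tensorHom_id, ← id_tensorHom]
  refine act_ext (fun x ↦ ?_)
  have e1 := act_vmap (𝟙 (vhom B C)) s (𝟙 C) (act (𝟙 (vhom A B')) (𝟙 (A.obj x)))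
  have e2 := act_vmap (𝟙 (vhom A B')) (𝟙 A) s (𝟙 (A.obj x))
  rw [Category.id_comp] at e1 e2
  rw [act_vcomp, act_vcomp, e1, e2]
  simp

theorem vcomp_aux {A A' B N : Word X ⥤ V} (s : A' ⟶ A) {D D' : V} {c : D ⟶ vhom A B}
    {c' : D' ⟶ vhom A' B} {m : D ⟶ D'} (h : m ≫ c' = c ≫ vmap s (𝟙 B)) :
    (_ ◁ m) ≫ (_ ◁ c') ≫ vcomp A' B N = ((_ ◁ c) ≫ vcomp A B N) ≫ vmap s (𝟙 N) := by
  have h2 := vcomp_natural (B := B) s (𝟙 N)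
  rw [vmap_id, id_tensorHom] at h2
  rw [← MonoidalCategory.whiskerLeft_comp_assoc, h, Category.assoc, ← h2,
    MonoidalCategory.whiskerLeft_comp_assoc]

theorem vcomp_aux_left {A B B' N : Word X ⥤ V} (s : B' ⟶ B) {z : Word X}
    {c : B.obj z ⟶ vhom A B} {c' : B'.obj z ⟶ vhom A B'}
    (h : s.app z ≫ c = c' ≫ vmap (𝟙 A) s) :
    (vmap s (𝟙 N) ▷ _) ≫ (_ ◁ c') ≫ vcomp A B' N =
      (_ ◁ s.app z) ≫ (_ ◁ c) ≫ vcomp A B N := by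
  rw [← whisker_exchange_assoc, vcomp_dinatural, ← MonoidalCategory.whiskerLeft_comp_assoc,
    ← MonoidalCategory.whiskerLeft_comp_assoc, h]

theorem vcomp_aux_right {A B N N' : Word X ⥤ V} (k : N ⟶ N') {D : V} (c : D ⟶ vhom A B) :
    (vmap (𝟙 B) k ▷ _) ≫ (_ ◁ c) ≫ vcomp A B N' =
      (_ ◁ c) ≫ vcomp A B N ≫ vmap (𝟙 A) k := by
  have h := vcomp_natural (B := B) (𝟙 A) k
  rw [vmap_id, tensorHom_id] at h
  rw [← whisker_exchange_assoc, h]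

theorem ident_aux {A A' N : Word X ⥤ V} (s : A' ⟶ A) {w w' : Word X} (f : w ⟶ w')
    {i : 𝟙_ V ⟶ A.obj w} {i' : 𝟙_ V ⟶ A'.obj w'} (h : i' ≫ s.app w' = i ≫ A.map f) :
    vmap s (𝟙 N) ≫ (ρ_ _).inv ≫ act (𝟙 (vhom A' N)) i' =
      ((ρ_ _).inv ≫ act (𝟙 (vhom A N)) i) ≫ N.map f := by
  have e1 := act_vmap (𝟙 (vhom A N)) s (𝟙 N) i'
  rw [Category.id_comp, h, NatTrans.id_app, Category.comp_id] at e1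
  rw [Category.assoc, ← act_map, ← e1, rightUnitor_inv_naturality_assoc]
  rw [← Category.comp_id (vmap s (𝟙 N)), act_comp_left, Category.comp_id]

theorem ident_aux_right {A N N' : Word X ⥤ V} (k : N ⟶ N') {w : Word X} (i : 𝟙_ V ⟶ A.obj w) :
    vmap (𝟙 A) k ≫ (ρ_ _).inv ≫ act (𝟙 (vhom A N')) i =
      ((ρ_ _).inv ≫ act (𝟙 (vhom A N)) i) ≫ k.app w := by
  have e1 := act_vmap (𝟙 (vhom A N)) (𝟙 A) k i
  rw [Category.id_comp, NatTrans.id_app, Category.comp_id] at e1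
  rw [Category.assoc, ← e1, rightUnitor_inv_naturality_assoc]
  rw [← Category.comp_id (vmap (𝟙 A) k), act_comp_left, Category.comp_id]

namespace OperadData

variable (P : OperadData V X)

/-- The element of `vhom` given by the composition. -/
def compNat (w : Word X) :
    ((bigP P.obj).obj w).functor ⟶ wedgeObj P.obj ((bigP P.obj).obj w).functor :=
  (P.compT.app w).natTrans

theorem compNat_natural {w w' : Word X} (f : w ⟶ w') (z : Word X) :
    ((bigP P.obj).map f).natTrans.app z ≫ (P.compNat w').app z =
      (P.compNat w).app z ≫ vmap (𝟙 _) ((bigP P.obj).map f).natTrans :=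
  congrArg (fun t ↦ (Hom.natTrans t).app z) (P.compT.naturality f)

/-- The components of the comultiplication. -/
def wedgeΔApp (N : Word X ⥤ V) (w : Word X) :
    (wedgeObj P.obj N).obj w ⟶ (wedgeObj P.obj (wedgeObj P.obj N)).obj w :=
  vlift (A := ((bigP P.obj).obj w).functor) (K := wedgeObj P.obj N)
    { app := fun z ↦ (_ ◁ (P.compNat w).app z) ≫ vcomp ((bigP P.obj).obj z).functor
        ((bigP P.obj).obj w).functor N
      naturality := fun z z' f ↦ by
        exact vcomp_aux ((bigP P.obj).map (inv f)).natTrans ((P.compNat w).naturality f) }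

theorem act_wedgeΔApp (N : Word X ⥤ V) (w z : Word X) {D : V}
    (a : D ⟶ ((bigP P.obj).obj w).functor.obj z) :
    act (A := ((bigP P.obj).obj w).functor) (K := wedgeObj P.obj N) (P.wedgeΔApp N w) a =
      (vhom ((bigP P.obj).obj w).functor N ◁ a) ≫ (_ ◁ (P.compNat w).app z) ≫
        vcomp ((bigP P.obj).obj z).functor ((bigP P.obj).obj w).functor N :=
  act_vlift _ _

theorem act_wedgeΔApp_id (N : Word X ⥤ V) (w z : Word X) :
    act (A := ((bigP P.obj).obj w).functor) (K := wedgeObj P.obj N) (P.wedgeΔApp N w)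
        (𝟙 (((bigP P.obj).obj w).functor.obj z)) =
      (vhom ((bigP P.obj).obj w).functor N ◁ (P.compNat w).app z) ≫
        vcomp ((bigP P.obj).obj z).functor ((bigP P.obj).obj w).functor N := by
  refine (P.act_wedgeΔApp N w z _).trans ?_
  rw [MonoidalCategory.whiskerLeft_id, Category.id_comp]

/-- The comultiplication `P^∧ ⟶ P^∧ P^∧` of the comonad `wedge P`. -/
def wedgeΔ : wedge P.obj ⟶ wedge P.obj ⋙ wedge P.obj where
  app N :=
    { app := fun w ↦ P.wedgeΔApp N w
      naturality := fun w w' f ↦ by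
        refine act_ext (fun z ↦ ?_)
        refine Eq.trans (act_comp_left _ _ _)
          (Eq.trans ?_ (act_vmap _ ((bigP P.obj).map (inv f)).natTrans (𝟙 _) _).symm)
        rw [Category.id_comp, NatTrans.id_app, Category.comp_id]
        refine Eq.trans (congrArg (((wedge P.obj).obj N).map f ▷ _ ≫ ·)
          (P.act_wedgeΔApp_id N w' z)) (Eq.trans ?_ (P.act_wedgeΔApp N w z _).symm)
        exact vcomp_aux_left ((bigP P.obj).map (inv f)).natTrans
          (P.compNat_natural (inv f) z) }
  naturality N N' k := by
    ext w
    refine act_ext (fun z ↦ ?_)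
    refine Eq.trans (act_comp_left _ _ _)
      (Eq.trans ?_ (act_vmap (P.wedgeΔApp N w) (𝟙 _) ((wedge P.obj).map k) _).symm)
    rw [Category.id_comp, NatTrans.id_app]
    refine Eq.trans (congrArg (vmap (𝟙 _) k ▷ _ ≫ ·) (P.act_wedgeΔApp_id N' w z))
      (Eq.trans ?_ (congrArg (· ≫ vmap (𝟙 _) k) (P.act_wedgeΔApp_id N w z)).symm)
    exact (vcomp_aux_right k ((P.compNat w).app z)).trans (Category.assoc _ _ _).symm

/-- The counit `P^∧ ⟶ 𝟭` of the comonad `wedge P`. -/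
def wedgeε : wedge P.obj ⟶ 𝟭 (Word X ⥤ V) where
  app N :=
    { app := fun w ↦ (ρ_ _).inv ≫
        act (𝟙 (vhom ((bigP P.obj).obj w).functor N)) (P.ident w)
      naturality := fun w w' f ↦ by
        refine ident_aux ((bigP P.obj).map (inv f)).natTrans f ?_
        have h := P.ident_natural (inv f)
        have h2 := ((bigP P.obj).map (inv f)).natTrans.naturality f
        rw [← h]
        simp only [Category.assoc]
        rw [← h2, ← CategoryTheory.Functor.map_comp_assoc, IsIso.inv_hom_id,
          CategoryTheory.Functor.map_id, Category.id_comp] }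
  naturality N N' k := by
    ext w
    exact ident_aux_right k (P.ident w)

end OperadData

/-! ### The functors `ε` and `π` -/

namespace Word

open Functor.LaxMonoidal

section

variable {M : Type u'} [Category.{v'} M] [MonoidalCategory M] [SymmetricCategory M]
variable {Y : Type v} {φ : Y → M}

theorem lift_hom_ext {Ψ : Word Y ⥤ M} [Ψ.LaxMonoidal] (f g : lift φ ⟶ Ψ) [f.IsMonoidal]
    [g.IsMonoidal] (h : ∀ y, f.app (of y) = g.app (of y)) : f = g := by
  have key : ∀ a : Word Y, f.app a = g.app a := by
    intro a
    induction a with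
    | of y => exact h y
    | unit =>
      have h1 := NatTrans.IsMonoidal.unit (τ := f)
      have h2 := NatTrans.IsMonoidal.unit (τ := g)
      exact (Category.id_comp _).symm.trans ((h1.trans h2.symm).trans (Category.id_comp _))
    | tensor a b ha hb =>
      have h1 := NatTrans.IsMonoidal.tensor (τ := f) a b
      have h2 := NatTrans.IsMonoidal.tensor (τ := g) a b
      rw [ha, hb] at h1
      exact (Category.id_comp _).symm.trans ((h1.trans h2.symm).trans (Category.id_comp _))
  exact NatTrans.ext (funext key)

instance liftDesc_isMonoidal (Ψ : Word Y ⥤ M) [Ψ.LaxBraided] (f : ∀ y, φ y ⟶ Ψ.obj (of y)) :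
    (liftDesc Ψ f).IsMonoidal where
  unit := Category.id_comp _
  tensor _ _ := Category.id_comp _

theorem liftDesc_of (Ψ : Word Y ⥤ M) [Ψ.LaxBraided] (f : ∀ y, φ y ⟶ Ψ.obj (of y)) (y : Y) :
    (liftDesc Ψ f).app (of y) = f y := rfl

end

end Word

/-- The action of the functor `ε` on morphisms. -/
def epsMap {C D : X → V} (f : C ⟶ D) : Word.lift C ⟶ Word.lift D :=
  Word.liftDesc (φ := C) (Word.lift D) f

instance epsMap_isMonoidal {C D : X → V} (f : C ⟶ D) : (epsMap f).IsMonoidal :=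
  Word.liftDesc_isMonoidal (φ := C) (Word.lift D) f

variable (V X) in
/-- The functor `ε` extending a family of objects to the symmetric monoidal functor
`x₁ ⊗ ⋯ ⊗ xₙ ↦ C x₁ ⊗ ⋯ ⊗ C xₙ`. -/
def epsF : (X → V) ⥤ (Word X ⥤ V) where
  obj C := Word.lift C
  map f := epsMap f
  map_id C := Word.lift_hom_ext (epsMap (𝟙 C)) (𝟙 _) (fun _ ↦ rfl)
  map_comp f g := Word.lift_hom_ext (epsMap (f ≫ g)) (epsMap f ≫ epsMap g) (fun _ ↦ rfl)

variable (V X) in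
/-- The functor `π` restricting a functor on `S(X)` to the words with one letter. -/
def piF : (Word X ⥤ V) ⥤ (X → V) where
  obj N := fun x ↦ N.obj (Word.of x)
  map k := fun x ↦ k.app (Word.of x)

instance epsF_obj_laxBraided (C : X → V) : ((epsF V X).obj C).LaxBraided :=
  inferInstanceAs (Word.lift C).LaxBraided

instance epsF_map_isMonoidal {C D : X → V} (f : C ⟶ D) : ((epsF V X).map f).IsMonoidal :=
  epsMap_isMonoidal f

/-- The transformation `ε π M ⟶ M` for a lax symmetric monoidal functor `M`. -/
def kap (M : Word X ⥤ V) [M.LaxBraided] : (epsF V X).obj ((piF V X).obj M) ⟶ M :=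
  Word.liftDesc (φ := (piF V X).obj M) M (fun _ ↦ 𝟙 _)

instance kap_isMonoidal (M : Word X ⥤ V) [M.LaxBraided] : (kap M).IsMonoidal :=
  Word.liftDesc_isMonoidal M _

theorem kap_natural {M M' : Word X ⥤ V} [M.LaxBraided] [M'.LaxBraided] (k : M ⟶ M')
    [k.IsMonoidal] : (epsF V X).map ((piF V X).map k) ≫ kap M' = kap M ≫ k :=
  letI f : Word.lift ((piF V X).obj M) ⟶ Word.lift ((piF V X).obj M') :=
    epsMap ((piF V X).map k)
  letI g : Word.lift ((piF V X).obj M') ⟶ M' := kap M'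
  letI g' : Word.lift ((piF V X).obj M) ⟶ M := kap M
  haveI : g.IsMonoidal := kap_isMonoidal M'
  haveI : g'.IsMonoidal := kap_isMonoidal M
  Word.lift_hom_ext (φ := (piF V X).obj M) (f ≫ g) (g' ≫ k) (fun _ ↦
    (Category.comp_id _).trans (Category.id_comp _).symm)

/-! ### Lax comonads -/

section LaxComonads

variable {C : Type u'} [Category.{v'} C]

/-- The powers of an endofunctor. -/
def pow (T : C ⥤ C) : ℕ → C ⥤ C
  | 0 => 𝟭 C
  | n + 1 => pow T n ⋙ T

/-- A transformation `T ⟶ T T` applied to the `i`-th factor of `Tⁿ`. The outermost factor is the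
factor `0`. -/
def powS {T : C ⥤ C} (δ : T ⟶ T ⋙ T) : ∀ (n : ℕ) (_ : Fin n), pow T n ⟶ pow T (n + 1)
  | 0 => fun i ↦ i.elim0
  | n + 1 => Fin.cases (Functor.whiskerLeft (pow T n) δ ≫ (Functor.associator _ _ _).inv)
      (fun i ↦ Functor.whiskerRight (powS δ n i) T)

/-- A transformation `T ⟶ 𝟭` applied to the `i`-th factor of `Tⁿ⁺¹`. The outermost factor is
the factor `0`. -/
def powD {T : C ⥤ C} (ε : T ⟶ 𝟭 C) : ∀ (n : ℕ) (_ : Fin (n + 1)), pow T (n + 1) ⟶ pow T n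
  | 0 => fun _ ↦ Functor.whiskerLeft (𝟭 C) ε
  | n + 1 => Fin.cases (Functor.whiskerLeft (pow T (n + 1)) ε ≫ (Functor.rightUnitor _).hom)
      (fun i ↦ Functor.whiskerRight (powD ε n i) T)

/-- The canonical isomorphism `Tⁿ Tᵐ ⟶ Tᵐ⁺ⁿ`. -/
def powAdd (T : C ⥤ C) {m : ℕ} : ∀ {n k : ℕ} (_ : m + n = k), pow T m ⋙ pow T n ⟶ pow T k
  | 0, _, h => (Functor.rightUnitor _).hom ≫ eqToHom (congrArg (pow T) h)
  | n + 1, _, h => (Functor.associator (pow T m) (pow T n) T).inv ≫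
      Functor.whiskerRight (powAdd T (rfl : m + n = m + n)) T ≫ eqToHom (congrArg (pow T) h)

/-- The transformation `Tⁿ ⟶ T'ⁿ` induced by `T ⟶ T'`. -/
def powMap {T T' : C ⥤ C} (f : T ⟶ T') : ∀ n : ℕ, pow T n ⟶ pow T' n
  | 0 => 𝟙 _
  | n + 1 => powMap f n ◫ f

variable (C) in
/-- The data of a lax monoidal functor `n ↦ Q n` from the opposite of the category of finite
ordinals and monotone maps to the category of endofunctors of `C`, whose
values on the elementary surjections `n + 1 → n` and injections `n → n + 1` are
`s n i` and `d n i`, and whose lax structure is given by `α : Q n ∘ Q m ⟶ Q (m + n)` and `η`. -/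
structure LaxComonadData where
  /-- the endofunctors -/
  Q : ℕ → C ⥤ C
  /-- the degeneracies -/
  s (n : ℕ) (i : Fin n) : Q n ⟶ Q (n + 1)
  /-- the faces -/
  d (n : ℕ) (i : Fin (n + 1)) : Q (n + 1) ⟶ Q n
  /-- the lax structure -/
  α {m n k : ℕ} (h : m + n = k) : Q m ⋙ Q n ⟶ Q k
  /-- the unit of the lax structure -/
  η : 𝟭 C ⟶ Q 0

/-- The data `L` is a lax comonad: the simplicial identities hold, and the lax structure is
natural, associative and unital. In `Q m ⋙ Q n` the outer functor `Q n` occupies the first `n`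
places. -/
structure IsLaxComonad (L : LaxComonadData C) : Prop where
  d_d (n : ℕ) (i j : Fin (n + 1)) (h : i ≤ j) :
    L.d (n + 1) j.succ ≫ L.d n i = L.d (n + 1) i.castSucc ≫ L.d n j
  s_s (n : ℕ) (i j : Fin n) (h : i ≤ j) :
    L.s n j ≫ L.s (n + 1) i.castSucc = L.s n i ≫ L.s (n + 1) j.succ
  s_d_self (n : ℕ) (j : Fin n) : L.s n j ≫ L.d n j.castSucc = 𝟙 _
  s_d_succ (n : ℕ) (j : Fin n) : L.s n j ≫ L.d n j.succ = 𝟙 _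
  s_d_lt (n : ℕ) (i : Fin (n + 1)) (j : Fin n) (h : i ≤ j.castSucc) :
    L.s (n + 1) j.succ ≫ L.d (n + 1) i.castSucc = L.d n i ≫ L.s n j
  s_d_gt (n : ℕ) (i : Fin (n + 1)) (j : Fin n) (h : j.castSucc < i) :
    L.s (n + 1) j.castSucc ≫ L.d (n + 1) i.succ = L.d n i ≫ L.s n j
  α_s_outer {m n k : ℕ} (h : m + n = k) (h' : m + (n + 1) = k + 1) (i : Fin n) (i' : Fin k)
    (hi : i'.val = i.val) :
    Functor.whiskerLeft (L.Q m) (L.s n i) ≫ L.α h' = L.α h ≫ L.s k i'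
  α_s_inner {m n k : ℕ} (h : m + n = k) (h' : (m + 1) + n = k + 1) (i : Fin m) (i' : Fin k)
    (hi : i'.val = n + i.val) :
    Functor.whiskerRight (L.s m i) (L.Q n) ≫ L.α h' = L.α h ≫ L.s k i'
  α_d_outer {m n k : ℕ} (h : m + n = k) (h' : m + (n + 1) = k + 1) (i : Fin (n + 1))
    (i' : Fin (k + 1)) (hi : i'.val = i.val) :
    Functor.whiskerLeft (L.Q m) (L.d n i) ≫ L.α h = L.α h' ≫ L.d k i'
  α_d_inner {m n k : ℕ} (h : m + n = k) (h' : (m + 1) + n = k + 1) (i : Fin (m + 1))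
    (i' : Fin (k + 1)) (hi : i'.val = n + i.val) :
    Functor.whiskerRight (L.d m i) (L.Q n) ≫ L.α h = L.α h' ≫ L.d k i'
  α_assoc {l m n a b k : ℕ} (h₁ : l + m = a) (h₂ : a + n = k) (h₃ : m + n = b) (h₄ : l + b = k) :
    Functor.whiskerRight (L.α h₁) (L.Q n) ≫ L.α h₂ =
      (Functor.associator _ _ _).hom ≫ Functor.whiskerLeft (L.Q l) (L.α h₃) ≫ L.α h₄
  η_inner {n : ℕ} (h : 0 + n = n) :
    Functor.whiskerRight L.η (L.Q n) ≫ L.α h = (Functor.leftUnitor _).hom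
  η_outer {n : ℕ} (h : n + 0 = n) :
    Functor.whiskerLeft (L.Q n) L.η ≫ L.α h = (Functor.rightUnitor _).hom

/-- Morphisms of lax comonads: the monoidal natural transformations. -/
structure LaxComonadHom (L L' : LaxComonadData C) where
  /-- the components -/
  app (n : ℕ) : L.Q n ⟶ L'.Q n
  app_s (n : ℕ) (i : Fin n) : L.s n i ≫ app (n + 1) = app n ≫ L'.s n i
  app_d (n : ℕ) (i : Fin (n + 1)) : L.d n i ≫ app n = app (n + 1) ≫ L'.d n i
  app_α {m n k : ℕ} (h : m + n = k) : L.α h ≫ app k = (app m ◫ app n) ≫ L'.α h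
  app_η : L.η ≫ app 0 = L'.η

/-- A comonad as a lax comonad. -/
def ofComonad (K : Comonad C) : LaxComonadData C where
  Q := pow K.toFunctor
  s := powS K.δ
  d := powD K.ε
  α h := powAdd K.toFunctor h
  η := 𝟙 _

/-- The structure of a comonad on an endofunctor. -/
structure ComonadOn (F : C ⥤ C) where
  /-- the counit -/
  ε : F ⟶ 𝟭 C
  /-- the comultiplication -/
  δ : F ⟶ F ⋙ F
  coassoc (c : C) : δ.app c ≫ F.map (δ.app c) = δ.app c ≫ δ.app (F.obj c)
  left_counit (c : C) : δ.app c ≫ ε.app (F.obj c) = 𝟙 (F.obj c)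
  right_counit (c : C) : δ.app c ≫ F.map (ε.app c) = 𝟙 (F.obj c)

/-- The comonad with a given underlying endofunctor. -/
def ComonadOn.toComonad {F : C ⥤ C} (K : ComonadOn F) : Comonad C where
  toFunctor := F
  ε := K.ε
  δ := K.δ
  coassoc := K.coassoc
  left_counit := K.left_counit
  right_counit := K.right_counit

end LaxComonads

/-! ### The lax comonad `P^∧` -/

section Hat

variable (P : OperadData V X)

/-- The values of `(P^∧)ⁿ` on lax symmetric monoidal functors are lax symmetric monoidal. -/
instance powLaxBraided (N : Word X ⥤ V) [N.LaxBraided] :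
    ∀ n : ℕ, ((pow (wedge P.obj) n).obj N).LaxBraided
  | 0 => inferInstanceAs N.LaxBraided
  | n + 1 =>
    haveI := powLaxBraided N n
    wedgeLaxBraided P.obj ((pow (wedge P.obj) n).obj N)

instance pow_map_isMonoidal {N N' : Word X ⥤ V} [N.LaxBraided] [N'.LaxBraided] (k : N ⟶ N')
    [k.IsMonoidal] : ∀ n : ℕ, ((pow (wedge P.obj) n).map k).IsMonoidal
  | 0 => inferInstanceAs k.IsMonoidal
  | n + 1 =>
    haveI := pow_map_isMonoidal k n
    wedge_map_isMonoidal P.obj ((pow (wedge P.obj) n).map k)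

/-- The endofunctor `P^∧_n = π (P^∧)ⁿ ε`. -/
def hatQ (n : ℕ) : (X → V) ⥤ (X → V) :=
  epsF V X ⋙ pow (wedge P.obj) n ⋙ piF V X

theorem hat_aux {M M' R R' : Word X ⥤ V} [M.LaxBraided] [M'.LaxBraided] (k : M ⟶ M')
    [k.IsMonoidal] (W : (Word X ⥤ V) ⥤ (Word X ⥤ V)) (a : W.obj M ⟶ R) (a' : W.obj M' ⟶ R')
    (r : R ⟶ R') (h : W.map k ≫ a' = a ≫ r) :
    (piF V X).map (W.map ((epsF V X).map ((piF V X).map k))) ≫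
        (piF V X).map (W.map (kap M') ≫ a') =
      (piF V X).map (W.map (kap M) ≫ a) ≫ (piF V X).map r := by
  rw [← CategoryTheory.Functor.map_comp, ← CategoryTheory.Functor.map_comp, Category.assoc,
    ← h, ← CategoryTheory.Functor.map_comp_assoc, kap_natural,
    CategoryTheory.Functor.map_comp_assoc]

/-- The transformation `P^∧_n P^∧_m ⟶ P^∧_{m+n}`. -/
def hatα {m n k : ℕ} (h : m + n = k) : hatQ P m ⋙ hatQ P n ⟶ hatQ P k where
  app C := (piF V X).map
    ((pow (wedge P.obj) n).map (kap ((pow (wedge P.obj) m).obj ((epsF V X).obj C))) ≫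
      (powAdd (wedge P.obj) h).app ((epsF V X).obj C))
  naturality _ _ f :=
    hat_aux ((pow (wedge P.obj) m).map ((epsF V X).map f)) (pow (wedge P.obj) n) _ _ _
      ((powAdd (wedge P.obj) h).naturality ((epsF V X).map f))

/-- The (data of the) lax comonad `P^∧` on `X → V`. -/
def hat : LaxComonadData (X → V) where
  Q := hatQ P
  s n i := Functor.whiskerLeft (epsF V X) (Functor.whiskerRight (powS P.wedgeΔ n i) (piF V X))
  d n i := Functor.whiskerLeft (epsF V X) (Functor.whiskerRight (powD P.wedgeε n i) (piF V X))
  α h := hatα P h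
  η := { app := fun C ↦ 𝟙 C
         naturality := fun _ _ f ↦ (Category.comp_id f).trans (Category.id_comp f).symm }

/-- The counit `P^∧_1 ⟶ 𝟭`. -/
def hatCounit : (hat P).Q 1 ⟶ 𝟭 (X → V) where
  app C := (piF V X).map (P.wedgeε.app ((epsF V X).obj C))
  naturality _ _ f :=
    congrArg (piF V X).map (P.wedgeε.naturality ((epsF V X).map f))

end Hat

/-! ### The tower approximating the comonadic coreflection -/

section PiLimits

instance hasLimitsOfSize_family {Y : Type v} {D : Type u'} [Category.{v'} D]
    [HasLimitsOfSize.{0, 0} D] : HasLimitsOfSize.{0, 0} (Y → D) where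
  has_limits_of_shape _ _ :=
    { has_limit := fun F ↦ HasLimit.mk
        { cone :=
            { pt := fun y ↦ limit (F ⋙ Pi.eval (fun _ ↦ D) y)
              π :=
                { app := fun j y ↦ limit.π (F ⋙ Pi.eval (fun _ ↦ D) y) j
                  naturality := fun _ _ f ↦ funext fun y ↦
                    (limit.cone (F ⋙ Pi.eval (fun _ ↦ D) y)).π.naturality f } }
          isLimit :=
            { lift := fun s y ↦ limit.lift (F ⋙ Pi.eval (fun _ ↦ D) y)
                ((Pi.eval (fun _ ↦ D) y).mapCone s)
              fac := fun _ _ ↦ funext fun _ ↦ limit.lift_π _ _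
              uniq := fun s _ w ↦ funext fun y ↦ limit.hom_ext fun j ↦
                (congrFun (w j) y).trans
                  (limit.lift_π ((Pi.eval (fun _ ↦ D) y).mapCone s) j).symm } } }

end PiLimits

section Tower

variable {C : Type u'} [Category.{v'} C] [HasLimitsOfSize.{0, 0} C]

variable (C) in
/-- Two consecutive steps `χ : Q_k ⟶ Q_{k-1}` of the tower, with the map
`δ : Q_k ⟶ Q_{k-1} Q_{k-1}`. -/
structure Stage where
  /-- the functor `Q_{k-1}` -/
  prev : C ⥤ C
  /-- the functor `Q_k` -/
  cur : C ⥤ C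
  /-- the projection -/
  χ : cur ⟶ prev
  /-- the partial diagonal -/
  δ : cur ⟶ prev ⋙ prev

/-- The first step: `Q₀ = P₁` and `Q₁` is the pullback of `P₁ ⟶ P₂ ⟵ P₁ P₁`. -/
def firstStage (L : LaxComonadData C) : Stage C where
  prev := L.Q 1
  cur := pullback (L.s 1 0) (L.α (rfl : 1 + 1 = 2))
  χ := pullback.fst _ _
  δ := pullback.snd _ _

namespace Stage

variable (S : Stage C)

/-- The pullback of `Q_k ⟶ Q_{k-1} Q_{k-1} ⟵ Q_k Q_k`. -/
def square : C ⥤ C := pullback S.δ (S.χ ◫ S.χ)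

/-- The limit `Q_{k+1}` of the diagram formed by `Q_k ⟶ Q_{k-1} Q_{k-1} ⟵ Q_k Q_k` and by the two
maps `Q_k Q_k ⇉ Q_{k-1} Q_{k-1} Q_{k-1}`. -/
def next : Stage C where
  prev := S.cur
  cur := equalizer
    ((pullback.snd _ _ : S.square ⟶ S.cur ⋙ S.cur) ≫ (S.χ ◫ S.δ))
    ((pullback.snd _ _ : S.square ⟶ S.cur ⋙ S.cur) ≫ (S.δ ◫ S.χ) ≫
      (Functor.associator _ _ _).hom)
  χ := equalizer.ι _ _ ≫ pullback.fst _ _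
  δ := equalizer.ι _ _ ≫ pullback.snd _ _

end Stage

variable (L : LaxComonadData C)

/-- The steps of the tower. -/
def stage : ℕ → Stage C
  | 0 => firstStage L
  | k + 1 => (stage k).next

/-- The functors `Q_k` of the tower. -/
def towerQ (k : ℕ) : C ⥤ C := (stage L k).prev

/-- The maps `Q_{k+1} ⟶ Q_k`. -/
def towerχ (k : ℕ) : towerQ L (k + 1) ⟶ towerQ L k := (stage L k).χ

/-- The maps `Q_{k+1} ⟶ Q_k Q_k`. -/
def towerδ (k : ℕ) : towerQ L (k + 1) ⟶ towerQ L k ⋙ towerQ L k := (stage L k).δ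

/-- The limit `Q_∞` of the tower. -/
def towerLim : C ⥤ C := limit (Functor.ofOpSequence (towerχ L))

/-- The projections `Q_∞ ⟶ Q_k`. -/
def towerProj (k : ℕ) : towerLim L ⟶ towerQ L k :=
  limit.π (Functor.ofOpSequence (towerχ L)) (op k)

/-- The projection `Q_∞ ⟶ P₁`. -/
def towerBase : towerLim L ⟶ L.Q 1 := towerProj L 0

end Tower

/-! ### The hypothesis on the monoidal category -/

section Hypothesis

/-- The canonical morphism `[A, A'] ⊗ [B, B'] ⟶ [A ⊗ B, A' ⊗ B']`. -/
def homTensor (A A' B B' : V) :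
    (ihom A).obj A' ⊗ (ihom B).obj B' ⟶ (ihom (A ⊗ B)).obj (A' ⊗ B') :=
  MonoidalClosed.curry (tensorμ A B ((ihom A).obj A') ((ihom B).obj B') ≫
    ((ihom.ev A).app A' ⊗ₘ (ihom.ev B).app B'))

/-- The canonical morphism `[A, A'] ⊗ [B, B'] ⟶ [A ⊗ B, A' ⊗ B']`, for families of objects. -/
def homTensorFamily {I J : Type v} (A A' : I → V) (B B' : J → V) :
    (∏ᶜ fun i ↦ (ihom (A i)).obj (A' i)) ⊗ (∏ᶜ fun j ↦ (ihom (B j)).obj (B' j)) ⟶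
      ∏ᶜ fun p : I × J ↦ (ihom (A p.1 ⊗ B p.2)).obj (A' p.1 ⊗ B' p.2) :=
  Pi.lift (fun p ↦ (Pi.π _ p.1 ⊗ₘ Pi.π _ p.2) ≫ homTensor (A p.1) (A' p.1) (B p.2) (B' p.2))

variable (V) in
/-- The hypothesis on the monoidal category `V`: the canonical morphisms
`[A, A'] ⊗ [B, B'] ⟶ [A ⊗ B, A' ⊗ B']` are monomorphisms, for families `A` and `B` that have
an element, and the tensor product commutes with countable intersections in each variable. -/
structure CoreflectionHypothesis : Prop where
  mono_homTensor {I J : Type v} (A A' : I → V) (B B' : J → V)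
    (hA : ∃ i, Nonempty (𝟙_ V ⟶ A i)) (hB : ∃ j, Nonempty (𝟙_ V ⟶ B j)) :
    Mono (homTensorFamily A A' B B')
  preservesMono (A : V) : (tensorLeft A).PreservesMonomorphisms
  preservesIntersection (A : V) (F : ℕᵒᵖ ⥤ V)
    (hF : ∀ n : ℕ, Mono (F.map (homOfLE n.le_succ).op)) : PreservesLimit F (tensorLeft A)

end Hypothesis

end

end ColoredOperad

open ColoredOperad

/-!
The argument has an abstract half, about an arbitrary lax comonad, and a half about operads that
supplies its input.

*Coreflection of a lax comonad.* Let `L` be a lax comonad on `C` such that `α : L₁ L₁ ⟶ L₂` and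
`η : 𝟭 ⟶ L₀` are monomorphisms, the face `L₁ ⟶ L₀` factors through `η`, and every `Lₙ` preserves
monomorphisms and the limits of towers of monomorphisms. The projection `Q₁ ⟶ L₁` is then a
pullback of `α`, so by induction all `Q_{k+1} ⟶ Q_k` are monomorphisms and all `Q_k` preserve
monomorphisms and limits of towers of monomorphisms, these properties being stable under
composition and finite limits (`stage_mono`). Hence `Q_∞` is a subfunctor of `L₁` and
`Q_∞ Q_∞ = lim_k Q_k Q_k`, so that the maps `Q_∞ ⟶ Q_{k+1} ⟶ Q_k Q_k` assemble into a
comultiplication (`exists_towerComul`). Coassociativity may be tested after the monomorphism to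
`L₁ L₁ L₁`, where it is the equalizer condition in the definition of `Q₂`; counitality may be
tested in `L₁`, where it follows from the simplicial identities (`exists_towerComonad`).

A morphism of lax comonads `Ψ` from a comonad `R` to `L` is determined by `Ψ₁`, because `Ψₙ` is
`Rⁿ ⟶ L₁ⁿ ⟶ Lₙ`; conversely a transformation `R ⟶ L₁` extends as soon as it is compatible with
the comultiplications and counits (`IsLaxComonad.app_eq_powHom`, `IsLaxComonad.homOfComonad`).
Compatibility and the coassociativity of `R` lift `R ⟶ L₁` step by step along the tower
(`stageLift`), uniquely because `Q_∞ ⟶ L₁` is a monomorphism. This is `exists_coreflection`.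

*The lax comonad `P^∧`.* The associativity and unit laws of an operad, which concern operations
with one output, extend to operations with several outputs by induction on the word of outputs,
since the comultiplication and the counit of `N ↦ ∫_x [P(x; -), N x]` are compatible with the
pairings that define its lax symmetric monoidal structure (`Operad.compT_assoc`,
`Operad.ident_compNat`). So this functor is a comonad (`Operad.wedgeComonad`) whose structure maps
are monoidal at lax monoidal functors. The transformation `kap : ε π M ⟶ M` is natural for
monoidal transformations, and conjugating the powers of the comonad by `ε` and `π` gives a lax
comonad (`isLaxComonad_hat`).

*The hypothesis on `V`.* The first condition says that the pairings
`(∫_x [F x, M x]) ⊗ (∫_y [G y, N y]) ⟶ ∫ [F ⊗ G, K]` induced by monomorphisms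
`M x ⊗ N y ⟶ K (x ⊗ y)` are monomorphisms (`mono_vpair`); the required elements of `P(w; w)` are the identities. Hence the
lax structure of `P^∧ ε C`, and with it `α`, consists of monomorphisms (`mono_hatα`). By the second
condition `ε` preserves monomorphisms and limits of towers of monomorphisms; the ends and `π`
preserve all limits (`preservesTowers_hatQ`).
-/

namespace ColoredOperad

/-! ### Powers of an endofunctor and of a comonad -/

section Powers

variable {C : Type u'} [Category.{v'} C] {T : C ⥤ C}

/-- The outermost factor is the factor `0`: it acts by evaluation at an iterate, and the other
factors act under `T`. -/
theorem powS_zero_app (δ : T ⟶ T ⋙ T) (n : ℕ) (c : C) :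
    (powS δ (n + 1) 0).app c = δ.app ((pow T n).obj c) := by
  change δ.app ((pow T n).obj c) ≫ 𝟙 _ = _
  exact Category.comp_id _

theorem powS_succ_app (δ : T ⟶ T ⋙ T) (n : ℕ) (i : Fin n) (c : C) :
    (powS δ (n + 1) i.succ).app c = T.map ((powS δ n i).app c) := rfl

theorem powD_zero_app (ε : T ⟶ 𝟭 C) (n : ℕ) (c : C) :
    (powD ε n 0).app c = ε.app ((pow T n).obj c) := by
  cases n with
  | zero => rfl
  | succ n => exact Category.comp_id (ε.app ((pow T (n + 1)).obj c))

theorem powD_succ_app (ε : T ⟶ 𝟭 C) (n : ℕ) (i : Fin (n + 1)) (c : C) :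
    (powD ε (n + 1) i.succ).app c = T.map ((powD ε n i).app c) := rfl

theorem powAdd_zero_app {m : ℕ} (h : m + 0 = m) (c : C) :
    (powAdd T h).app c = 𝟙 _ :=
  Category.comp_id (𝟙 ((pow T m).obj c))

/-- The identifications `Tⁿ Tᵐ = Tᵐ⁺ⁿ` are built by adding outer factors, so they are computed by
applying `T`. -/
theorem powAdd_succ_app {m n k : ℕ} (h : m + n = k) (h' : m + (n + 1) = k + 1) (c : C) :
    (powAdd T h').app c = T.map ((powAdd T h).app c) := by
  subst h
  exact (Category.id_comp _).trans (Category.comp_id _)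

theorem powAdd_zero_left_app {n : ℕ} (h : 0 + n = n) (c : C) : (powAdd T h).app c = 𝟙 _ := by
  induction n with
  | zero => exact powAdd_zero_app h c
  | succ n ih =>
    rw [powAdd_succ_app (Nat.zero_add n) h, ih]
    exact T.map_id _

end Powers

section ComonadPowers

variable {C : Type u'} [Category.{v'} C] (K : Comonad C)

/-! The next six lemmas are the simplicial identities between the transformations `δ` and `ε`
applied to the factors of the powers of a comonad. -/

theorem powD_powD (n : ℕ) (i j : Fin (n + 1)) (h : i ≤ j) (c : C) :
    (powD K.ε (n + 1) j.succ).app c ≫ (powD K.ε n i).app c =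
      (powD K.ε (n + 1) i.castSucc).app c ≫ (powD K.ε n j).app c := by
  induction n with
  | zero =>
    obtain rfl : i = 0 := Fin.eq_zero i
    obtain rfl : j = 0 := Fin.eq_zero j
    rw [Fin.castSucc_zero, powD_succ_app, powD_zero_app, powD_zero_app]
    exact K.ε.naturality _
  | succ n ih =>
    induction i using Fin.cases with
    | zero =>
      rw [Fin.castSucc_zero, powD_succ_app, powD_zero_app, powD_zero_app]
      exact K.ε.naturality _
    | succ i =>
      induction j using Fin.cases with
      | zero => exact absurd h (by simp)
      | succ j =>
        rw [← Fin.succ_castSucc, powD_succ_app, powD_succ_app, powD_succ_app, powD_succ_app]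
        erw [← K.map_comp, ih i j (Fin.succ_le_succ_iff.1 h), K.map_comp]
        rfl

theorem powS_powS (n : ℕ) (i j : Fin n) (h : i ≤ j) (c : C) :
    (powS K.δ n j).app c ≫ (powS K.δ (n + 1) i.castSucc).app c =
      (powS K.δ n i).app c ≫ (powS K.δ (n + 1) j.succ).app c := by
  induction n with
  | zero => exact i.elim0
  | succ n ih =>
    induction i using Fin.cases with
    | zero =>
      rw [Fin.castSucc_zero, powS_succ_app, powS_zero_app, powS_zero_app]
      induction j using Fin.cases with
      | zero =>
        rw [powS_zero_app]
        exact (K.coassoc _).symm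
      | succ j =>
        rw [powS_succ_app]
        exact K.δ.naturality _
    | succ i =>
      induction j using Fin.cases with
      | zero => exact absurd h (by simp)
      | succ j =>
        rw [← Fin.succ_castSucc, powS_succ_app, powS_succ_app, powS_succ_app, powS_succ_app]
        exact (K.map_comp _ _).symm.trans
          ((congrArg K.map (ih i j (Fin.succ_le_succ_iff.1 h))).trans (K.map_comp _ _))

theorem powS_powD_self (n : ℕ) (j : Fin n) (c : C) :
    (powS K.δ n j).app c ≫ (powD K.ε n j.castSucc).app c = 𝟙 _ := by
  induction n with
  | zero => exact j.elim0
  | succ n ih =>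
    induction j using Fin.cases with
    | zero =>
      rw [Fin.castSucc_zero, powS_zero_app, powD_zero_app]
      exact K.left_counit _
    | succ j =>
      rw [← Fin.succ_castSucc, powS_succ_app, powD_succ_app]
      exact (K.map_comp _ _).symm.trans ((congrArg K.map (ih j)).trans (K.map_id _))

theorem powS_powD_succ (n : ℕ) (j : Fin n) (c : C) :
    (powS K.δ n j).app c ≫ (powD K.ε n j.succ).app c = 𝟙 _ := by
  induction n with
  | zero => exact j.elim0
  | succ n ih =>
    rw [powD_succ_app]
    induction j using Fin.cases with
    | zero =>
      rw [powS_zero_app, powD_zero_app]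
      exact K.right_counit _
    | succ j =>
      rw [powS_succ_app]
      exact (K.map_comp _ _).symm.trans ((congrArg K.map (ih j)).trans (K.map_id _))

theorem powS_powD_lt (n : ℕ) (i : Fin (n + 1)) (j : Fin n) (h : i ≤ j.castSucc) (c : C) :
    (powS K.δ (n + 1) j.succ).app c ≫ (powD K.ε (n + 1) i.castSucc).app c =
      (powD K.ε n i).app c ≫ (powS K.δ n j).app c := by
  induction n with
  | zero => exact j.elim0
  | succ n ih =>
    rw [powS_succ_app]
    induction i using Fin.cases with
    | zero =>
      rw [Fin.castSucc_zero, powD_zero_app, powD_zero_app]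
      exact K.ε.naturality _
    | succ i =>
      induction j using Fin.cases with
      | zero => exact absurd h (by simp)
      | succ j =>
        rw [← Fin.succ_castSucc, powD_succ_app, powD_succ_app, powS_succ_app]
        rw [← Fin.succ_castSucc] at h
        exact (K.map_comp _ _).symm.trans
          ((congrArg K.map (ih i j (Fin.succ_le_succ_iff.1 h))).trans (K.map_comp _ _))

theorem powS_powD_gt (n : ℕ) (i : Fin (n + 1)) (j : Fin n) (h : j.castSucc < i) (c : C) :
    (powS K.δ (n + 1) j.castSucc).app c ≫ (powD K.ε (n + 1) i.succ).app c =
      (powD K.ε n i).app c ≫ (powS K.δ n j).app c := by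
  induction n with
  | zero => exact j.elim0
  | succ n ih =>
    rw [powD_succ_app]
    induction i using Fin.cases with
    | zero => exact absurd h (by simp)
    | succ i =>
      induction j using Fin.cases with
      | zero =>
        rw [Fin.castSucc_zero, powS_zero_app, powS_zero_app, powD_succ_app]
        exact (K.δ.naturality _).symm
      | succ j =>
        rw [← Fin.succ_castSucc, powD_succ_app, powS_succ_app, powS_succ_app]
        rw [← Fin.succ_castSucc] at h
        exact (K.map_comp _ _).symm.trans
          ((congrArg K.map (ih i j (Fin.succ_lt_succ_iff.1 h))).trans (K.map_comp _ _))

/-! In the identification `Kⁿ Kᵐ = Kᵐ⁺ⁿ` the factors of `Kⁿ` are the outer ones: their numbers are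
unchanged, while those of the factors of `Kᵐ` are shifted by `n`. -/

theorem powAdd_powS_outer {m n k : ℕ} (h : m + n = k) (h' : m + (n + 1) = k + 1) (i : Fin n)
    (i' : Fin k) (hi : i'.val = i.val) (c : C) :
    (powS K.δ n i).app ((pow K.toFunctor m).obj c) ≫ (powAdd K.toFunctor h').app c =
      (powAdd K.toFunctor h).app c ≫ (powS K.δ k i').app c := by
  induction n generalizing k with
  | zero => exact i.elim0
  | succ n ih =>
    obtain _ | k := k
    · exact i'.elim0
    have h₁ : m + n = k := by omega
    rw [powAdd_succ_app h h']
    induction i using Fin.cases with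
    | zero =>
      obtain rfl : i' = 0 := Fin.ext hi
      rw [powAdd_succ_app h₁ h, powS_zero_app, powS_zero_app]
      exact (K.δ.naturality _).symm
    | succ i =>
      induction i' using Fin.cases with
      | zero => simp at hi
      | succ i' =>
        rw [powS_succ_app, powS_succ_app]
        exact (K.map_comp _ _).symm.trans
          ((congrArg K.map (ih h₁ h i i' (by simpa using hi))).trans
            ((K.map_comp _ _).trans (congrArg (· ≫ _) (powAdd_succ_app h₁ h c).symm)))

theorem powAdd_powD_outer {m n k : ℕ} (h : m + n = k) (h' : m + (n + 1) = k + 1)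
    (i : Fin (n + 1)) (i' : Fin (k + 1)) (hi : i'.val = i.val) (c : C) :
    (powD K.ε n i).app ((pow K.toFunctor m).obj c) ≫ (powAdd K.toFunctor h).app c =
      (powAdd K.toFunctor h').app c ≫ (powD K.ε k i').app c := by
  induction n generalizing k with
  | zero =>
    rw [powAdd_succ_app h h']
    obtain rfl : i = 0 := Fin.eq_zero i
    obtain rfl : i' = 0 := Fin.ext hi
    rw [powD_zero_app, powD_zero_app]
    exact (K.ε.naturality _).symm
  | succ n ih =>
    obtain _ | k := k
    · omega
    have h₁ : m + n = k := by omega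
    induction i using Fin.cases with
    | zero =>
      obtain rfl : i' = 0 := Fin.ext hi
      rw [powAdd_succ_app h h', powD_zero_app, powD_zero_app]
      exact (K.ε.naturality _).symm
    | succ i =>
      induction i' using Fin.cases with
      | zero => simp at hi
      | succ i' =>
        rw [powD_succ_app, powD_succ_app]
        exact (congrArg (_ ≫ ·) (powAdd_succ_app h₁ h c)).trans ((K.map_comp _ _).symm.trans
          ((congrArg K.map (ih h₁ h i i' (by simpa using hi))).trans
            ((K.map_comp _ _).trans (congrArg (· ≫ _) (powAdd_succ_app h h' c).symm))))

theorem powAdd_powS_inner {m n k : ℕ} (h : m + n = k) (h' : (m + 1) + n = k + 1) (i : Fin m)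
    (i' : Fin k) (hi : i'.val = n + i.val) (c : C) :
    (pow K.toFunctor n).map ((powS K.δ m i).app c) ≫ (powAdd K.toFunctor h').app c =
      (powAdd K.toFunctor h).app c ≫ (powS K.δ k i').app c := by
  induction n generalizing k with
  | zero =>
    obtain rfl : m = k := h
    obtain rfl : i = i' := Fin.ext (by omega)
    rw [powAdd_zero_app, powAdd_zero_app]
    exact (Category.comp_id _).trans (Category.id_comp _).symm
  | succ n ih =>
    obtain _ | k := k
    · exact i'.elim0
    have h₁ : m + n = k := by omega
    have h₂ : (m + 1) + n = k + 1 := by omega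
    rw [powAdd_succ_app h₂ h', powAdd_succ_app h₁ h]
    induction i' using Fin.cases with
    | zero => exact absurd hi (by simp; omega)
    | succ i' =>
      rw [powS_succ_app]
      exact (K.map_comp _ _).symm.trans
        ((congrArg K.map (ih h₁ h₂ i' (by simp at hi; omega))).trans (K.map_comp _ _))

theorem powAdd_powD_inner {m n k : ℕ} (h : m + n = k) (h' : (m + 1) + n = k + 1)
    (i : Fin (m + 1)) (i' : Fin (k + 1)) (hi : i'.val = n + i.val) (c : C) :
    (pow K.toFunctor n).map ((powD K.ε m i).app c) ≫ (powAdd K.toFunctor h).app c =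
      (powAdd K.toFunctor h').app c ≫ (powD K.ε k i').app c := by
  induction n generalizing k with
  | zero =>
    obtain rfl : m = k := h
    obtain rfl : i = i' := Fin.ext (by omega)
    rw [powAdd_zero_app, powAdd_zero_app]
    exact (Category.comp_id _).trans (Category.id_comp _).symm
  | succ n ih =>
    obtain _ | k := k
    · omega
    have h₁ : m + n = k := by omega
    have h₂ : (m + 1) + n = k + 1 := by omega
    rw [powAdd_succ_app h₂ h', powAdd_succ_app h₁ h]
    induction i' using Fin.cases with
    | zero => exact absurd hi (by simp; omega)
    | succ i' =>
      rw [powD_succ_app]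
      exact (K.map_comp _ _).symm.trans
        ((congrArg K.map (ih h₁ h₂ i' (by simp at hi; omega))).trans (K.map_comp _ _))

theorem powAdd_assoc (T : C ⥤ C) {l m n a b k : ℕ} (h₁ : l + m = a) (h₂ : a + n = k)
    (h₃ : m + n = b) (h₄ : l + b = k) (c : C) :
    (pow T n).map ((powAdd T h₁).app c) ≫ (powAdd T h₂).app c =
      (powAdd T h₃).app ((pow T l).obj c) ≫ (powAdd T h₄).app c := by
  induction n generalizing k b with
  | zero =>
    obtain rfl : a = k := h₂
    obtain rfl : m = b := h₃
    rw [powAdd_zero_app, powAdd_zero_app]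
    exact (Category.comp_id _).trans (Category.id_comp _).symm
  | succ n ih =>
    obtain _ | b := b
    · omega
    obtain _ | k := k
    · omega
    have h₅ : a + n = k := by omega
    have h₆ : m + n = b := by omega
    have h₇ : l + b = k := by omega
    rw [powAdd_succ_app h₅ h₂, powAdd_succ_app h₆ h₃, powAdd_succ_app h₇ h₄]
    exact (T.map_comp _ _).symm.trans ((congrArg T.map (ih h₅ h₆ h₇)).trans (T.map_comp _ _))

end ComonadPowers

/-! ### Maps from comonads into lax comonads -/

section Extension

variable {C : Type u'} [Category.{v'} C]

/-- The transformations `Tⁿ ⟶ Lₙ` induced by a transformation `p : T ⟶ L₁`: the composites of `pⁿ :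
Tⁿ ⟶ L₁ⁿ` with the lax structure of `L`. -/
def powHom (L : LaxComonadData C) {T : C ⥤ C} (p : T ⟶ L.Q 1) : ∀ n : ℕ, pow T n ⟶ L.Q n
  | 0 => L.η
  | n + 1 => (powHom L p n ◫ p) ≫ L.α rfl

variable {L : LaxComonadData C}

theorem powHom_succ_app {T : C ⥤ C} (p : T ⟶ L.Q 1) (n : ℕ) (c : C) :
    (powHom L p (n + 1)).app c =
      T.map ((powHom L p n).app c) ≫ p.app ((L.Q n).obj c) ≫ (L.α (rfl : n + 1 = n + 1)).app c :=
  (congrArg (· ≫ _) (p.naturality _).symm).trans (Category.assoc _ _ _)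

namespace IsLaxComonad

variable (hL : IsLaxComonad L)
include hL

theorem α_s_outer_app {m n k : ℕ} (h : m + n = k) (h' : m + (n + 1) = k + 1) (i : Fin n)
    (i' : Fin k) (hi : i'.val = i.val) (c : C) :
    (L.s n i).app ((L.Q m).obj c) ≫ (L.α h').app c = (L.α h).app c ≫ (L.s k i').app c :=
  NatTrans.congr_app (hL.α_s_outer h h' i i' hi) c

theorem α_s_inner_app {m n k : ℕ} (h : m + n = k) (h' : (m + 1) + n = k + 1) (i : Fin m)
    (i' : Fin k) (hi : i'.val = n + i.val) (c : C) :
    (L.Q n).map ((L.s m i).app c) ≫ (L.α h').app c = (L.α h).app c ≫ (L.s k i').app c :=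
  NatTrans.congr_app (hL.α_s_inner h h' i i' hi) c

theorem α_d_outer_app {m n k : ℕ} (h : m + n = k) (h' : m + (n + 1) = k + 1) (i : Fin (n + 1))
    (i' : Fin (k + 1)) (hi : i'.val = i.val) (c : C) :
    (L.d n i).app ((L.Q m).obj c) ≫ (L.α h).app c = (L.α h').app c ≫ (L.d k i').app c :=
  NatTrans.congr_app (hL.α_d_outer h h' i i' hi) c

theorem α_d_inner_app {m n k : ℕ} (h : m + n = k) (h' : (m + 1) + n = k + 1) (i : Fin (m + 1))
    (i' : Fin (k + 1)) (hi : i'.val = n + i.val) (c : C) :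
    (L.Q n).map ((L.d m i).app c) ≫ (L.α h).app c = (L.α h').app c ≫ (L.d k i').app c :=
  NatTrans.congr_app (hL.α_d_inner h h' i i' hi) c

theorem α_assoc_app {l m n a b k : ℕ} (h₁ : l + m = a) (h₂ : a + n = k) (h₃ : m + n = b)
    (h₄ : l + b = k) (c : C) :
    (L.Q n).map ((L.α h₁).app c) ≫ (L.α h₂).app c =
      (L.α h₃).app ((L.Q l).obj c) ≫ (L.α h₄).app c :=
  (NatTrans.congr_app (hL.α_assoc h₁ h₂ h₃ h₄) c).trans (Category.id_comp _)

theorem η_inner_app {n : ℕ} (h : 0 + n = n) (c : C) :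
    (L.Q n).map (L.η.app c) ≫ (L.α h).app c = 𝟙 _ :=
  NatTrans.congr_app (hL.η_inner h) c

theorem η_outer_app {n : ℕ} (h : n + 0 = n) (c : C) :
    L.η.app ((L.Q n).obj c) ≫ (L.α h).app c = 𝟙 _ :=
  NatTrans.congr_app (hL.η_outer h) c

theorem powHom_one {T : C ⥤ C} (p : T ⟶ L.Q 1) :
    powHom L p 1 = (Functor.leftUnitor T).hom ≫ p := by
  ext c
  rw [powHom_succ_app, p.naturality_assoc]
  erw [hL.η_inner_app (n := 1) rfl c, Category.comp_id]
  exact (Category.id_comp _).symm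

/-- The transformations `powHom L p` are compatible with the lax structures, whatever `p` is. -/
theorem powHom_α {T : C ⥤ C} (p : T ⟶ L.Q 1) {m n k : ℕ} (h : m + n = k) (c : C) :
    (powAdd T h).app c ≫ (powHom L p k).app c =
      (powHom L p n).app ((pow T m).obj c) ≫ (L.Q n).map ((powHom L p m).app c) ≫
        (L.α h).app c := by
  induction n generalizing k with
  | zero =>
    obtain rfl : m = k := h
    have h1 := L.η.naturality ((powHom L p m).app c)
    have h2 := hL.η_outer_app (n := m) rfl c
    rw [powAdd_zero_app]
    refine (Category.id_comp _).trans ?_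
    have h3 := congrArg ((powHom L p m).app c ≫ ·) h2
    refine ((Category.comp_id _).symm.trans h3.symm).trans ?_
    have h4 := congrArg (· ≫ (L.α (n := 0) rfl).app c) h1
    simp only [Category.assoc] at h4
    exact h4
  | succ n ih =>
    obtain _ | k := k
    · omega
    have h₁ : m + n = k := by omega
    have e := ih h₁
    have h2 := hL.α_assoc_app h₁ (rfl : k + 1 = k + 1) (rfl : n + 1 = n + 1) h c
    rw [powAdd_succ_app h₁ h, powHom_succ_app, powHom_succ_app]
    have e1 := congrArg T.map e
    simp only [T.map_comp] at e1
    have n1 := p.naturality ((L.Q n).map ((powHom L p m).app c))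
    have n2 := p.naturality ((L.α h₁).app c)
    have n3 := (L.α (rfl : n + 1 = n + 1)).naturality ((powHom L p m).app c)
    simp only [Functor.comp_map] at n3
    erw [reassoc_of% e1, reassoc_of% n2, h2]
    refine Eq.trans ?_ (Category.assoc _ _ _).symm
    refine congrArg (_ ≫ ·) (Eq.trans ?_ (Category.assoc _ _ _).symm)
    erw [← reassoc_of% n3, ← reassoc_of% n1]

omit hL in
/-- A rearrangement by naturality: precomposing two applications of `p` with the comultiplication
of `K` brings out `δ ≫ p p`. -/
theorem comonad_δ_powHom {K : Comonad C} {S : C ⥤ C} (p : K.toFunctor ⟶ S) {X Y Z W : C}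
    (φ : X ⟶ Y) (a : S.obj Y ⟶ Z) (b : S.obj Z ⟶ W) :
    K.δ.app X ≫ K.map (K.map φ ≫ p.app Y ≫ a) ≫ p.app Z ≫ b =
      K.map φ ≫ (K.δ.app Y ≫ p.app (K.obj Y) ≫ S.map (p.app Y)) ≫ S.map a ≫ b := by
  have h := K.δ.naturality φ
  have h' := p.naturality φ
  simp only [Functor.map_comp, Category.assoc, NatTrans.naturality_assoc]
  rw [Functor.comp_map, p.naturality_assoc, ← S.map_comp_assoc,
    ← S.map_comp_assoc (K.map φ), h', S.map_comp_assoc]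

omit hL in
/-- The inductive step for structure maps that act on inner factors, in the form common to
degeneracies and faces. -/
theorem map_comp_powHom {T S : C ⥤ C} (p : T ⟶ S) {X X' Y Y' Z Z' : C} {u : X ⟶ X'}
    {f : X' ⟶ Y'} {g : X ⟶ Y} {w : Y ⟶ Y'} (e : u ≫ f = g ≫ w) {a : S.obj Y ⟶ Z}
    {a' : S.obj Y' ⟶ Z'} {w' : Z ⟶ Z'} (h : S.map w ≫ a' = a ≫ w') :
    T.map u ≫ T.map f ≫ p.app Y' ≫ a' = (T.map g ≫ p.app Y ≫ a) ≫ w' := by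
  rw [← T.map_comp_assoc, e, T.map_comp_assoc, p.naturality_assoc, h, Category.assoc,
    Category.assoc]

/-- If `p` is compatible with the comultiplications, then `powHom L p` is compatible with all
degeneracies. -/
theorem powHom_s {K : Comonad C} (p : K.toFunctor ⟶ L.Q 1)
    (hs : ∀ c, p.app c ≫ (L.s 1 0).app c =
      K.δ.app c ≫ p.app (K.obj c) ≫ (L.Q 1).map (p.app c) ≫ (L.α (rfl : 1 + 1 = 2)).app c)
    (n : ℕ) (i : Fin n) (c : C) : (powS K.δ n i).app c ≫ (powHom L p (n + 1)).app c =
      (powHom L p n).app c ≫ (L.s n i).app c := by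
  induction n with
  | zero => exact i.elim0
  | succ n ih =>
    induction i using Fin.cases with
    | zero =>
      have h1 := hL.α_s_outer_app (rfl : n + 1 = n + 1) rfl 0 0 rfl c
      have h2 := hL.α_assoc_app (rfl : n + 1 = n + 1) (rfl : n + 1 + 1 = n + 2)
        (rfl : 1 + 1 = 2) rfl c
      rw [powS_zero_app, powHom_succ_app, powHom_succ_app]
      refine (comonad_δ_powHom p _ _ _).trans ?_
      refine Eq.trans ?_ (Category.assoc _ _ _).symm
      refine congrArg (_ ≫ ·) (Eq.trans ?_ (Category.assoc _ _ _).symm)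
      rw [h2, ← h1, reassoc_of% hs]
      simp only [Category.assoc]
    | succ i =>
      rw [powS_succ_app]
      exact (congrArg (_ ≫ ·) (powHom_succ_app p (n + 1) c)).trans ((map_comp_powHom p (ih i)
        (hL.α_s_inner_app (rfl : n + 1 = n + 1) rfl i i.succ (by rw [Fin.val_succ, add_comm])
          c)).trans (congrArg (· ≫ _) (powHom_succ_app p n c).symm))

/-- If `p` is compatible with the counits, then `powHom L p` is compatible with all faces. -/
theorem powHom_d {K : Comonad C} (p : K.toFunctor ⟶ L.Q 1)
    (hd : ∀ c, p.app c ≫ (L.d 0 0).app c = K.ε.app c ≫ L.η.app c)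
    (n : ℕ) (i : Fin (n + 1)) (c : C) : (powD K.ε n i).app c ≫ (powHom L p n).app c =
      (powHom L p (n + 1)).app c ≫ (L.d n i).app c := by
  -- The face that deletes the outermost factor; the other ones are reduced to it by induction.
  have key (n : ℕ) : (powD K.ε n 0).app c ≫ (powHom L p n).app c =
      (powHom L p (n + 1)).app c ≫ (L.d n 0).app c := by
    have h1 := hL.α_d_outer_app (k := n) (n := 0) rfl (rfl : n + 1 = n + 1) 0 0 rfl c
    have h2 := hL.η_outer_app (n := n) rfl c
    have h3 : p.app _ ≫ (L.α (rfl : n + 1 = n + 1)).app c ≫ (L.d n 0).app c =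
        K.ε.app _ := by
      rw [← h1, reassoc_of% hd, h2]
      exact Category.comp_id _
    rw [powD_zero_app, powHom_succ_app]
    exact (K.ε.naturality _).symm.trans ((congrArg (_ ≫ ·) h3.symm).trans
      ((congrArg (_ ≫ ·) (Category.assoc _ _ _).symm).trans (Category.assoc _ _ _).symm))
  induction n with
  | zero =>
    obtain rfl : i = 0 := Fin.eq_zero i
    exact key 0
  | succ n ih =>
    induction i using Fin.cases with
    | zero => exact key (n + 1)
    | succ i =>
      rw [powD_succ_app]
      exact (congrArg (_ ≫ ·) (powHom_succ_app p n c)).trans ((map_comp_powHom p (ih i)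
        (hL.α_d_inner_app rfl (rfl : n + 1 + 1 = n + 1 + 1) i i.succ
          (by rw [Fin.val_succ, add_comm]) c)).trans
            (congrArg (· ≫ _) (powHom_succ_app p (n + 1) c).symm))

/-- The morphism of lax comonads from a comonad `K` to `L` induced by a transformation from `K` to
`L₁` that is compatible with the comultiplications and the counits. -/
def homOfComonad (K : Comonad C) (p : K.toFunctor ⟶ L.Q 1)
    (hs : ∀ c, p.app c ≫ (L.s 1 0).app c =
      K.δ.app c ≫ p.app (K.obj c) ≫ (L.Q 1).map (p.app c) ≫ (L.α (rfl : 1 + 1 = 2)).app c)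
    (hd : ∀ c, p.app c ≫ (L.d 0 0).app c = K.ε.app c ≫ L.η.app c) :
    LaxComonadHom (ofComonad K) L where
  app := powHom L p
  app_s n i := by
    ext c
    change (powS K.δ n i).app c ≫ _ = _
    exact hL.powHom_s p hs n i c
  app_d n i := by
    ext c
    exact hL.powHom_d p hd n i c
  app_α {m n k} h := by
    ext c
    exact (hL.powHom_α p h c).trans (Category.assoc _ _ _).symm
  app_η := Category.id_comp _

omit hL in
/-- A morphism of lax comonads from a comonad is determined by its component at `1`. -/
theorem app_eq_powHom {R : Comonad C} (Ψ : LaxComonadHom (ofComonad R) L) (n : ℕ) :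
    Ψ.app n = powHom L ((Functor.leftUnitor R.toFunctor).inv ≫ Ψ.app 1) n := by
  induction n with
  | zero => exact (Category.id_comp _).symm.trans Ψ.app_η
  | succ n ih =>
    ext c
    have h := NatTrans.congr_app (Ψ.app_α (rfl : n + 1 = n + 1)) c
    rw [powHom_succ_app, ← ih]
    -- The lax structure of `n ↦ Rⁿ` is invertible, so that of `L` computes the next component.
    have e : ((ofComonad R).α (rfl : n + 1 = n + 1)).app c =
        𝟙 ((pow R.toFunctor (n + 1)).obj c) := by
      refine (powAdd_succ_app (T := R.toFunctor) (rfl : n + 0 = n) rfl c).trans ?_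
      rw [powAdd_zero_app]
      exact R.toFunctor.map_id _
    have h' : (Ψ.app (n + 1)).app c = (((Ψ.app 1).app ((pow R.toFunctor n).obj c) ≫
        (L.Q 1).map ((Ψ.app n).app c)) ≫ (L.α rfl).app c) :=
      (Category.id_comp _).symm.trans ((congrArg (· ≫ _) e.symm).trans h)
    have n1 := (Ψ.app 1).naturality ((Ψ.app n).app c)
    refine h'.trans ((congrArg (· ≫ _) n1.symm).trans ?_)
    refine (Category.assoc _ _ _).trans (congrArg (_ ≫ ·) ?_)
    exact congrArg (· ≫ _) (Category.id_comp _).symm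

end IsLaxComonad

end Extension

/-! ### Functors preserving towers of monomorphisms -/

open Opposite

universe v₁ v₂ v₃ u₁ u₂ u₃

section Towers

variable {C : Type u₁} [Category.{v₁} C] {D : Type u₂} [Category.{v₂} D] {E : Type u₃}
  [Category.{v₃} E]

/-- The tower `⋯ ⟶ F 2 ⟶ F 1 ⟶ F 0`, a functor on `ℕᵒᵖ`, consists of monomorphisms. -/
def IsMonoTower (F : ℕᵒᵖ ⥤ C) : Prop :=
  ∀ n : ℕ, Mono (F.map (homOfLE n.le_succ).op)

/-- The functor `G` preserves monomorphisms and the limits of towers of monomorphisms. -/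
structure PreservesTowers (G : C ⥤ D) : Prop where
  mono {A B : C} (f : A ⟶ B) (_ : Mono f) : Mono (G.map f)
  lim (F : ℕᵒᵖ ⥤ C) (hF : IsMonoTower F) : PreservesLimit F G

theorem PreservesTowers.of_preservesLimits (G : C ⥤ D) [PreservesLimitsOfSize.{0, 0} G] :
    PreservesTowers G where
  mono _ _ := inferInstance
  lim _ _ := inferInstance

theorem IsMonoTower.comp {F : ℕᵒᵖ ⥤ C} (hF : IsMonoTower F) {G : C ⥤ D}
    (hG : PreservesTowers G) : IsMonoTower (F ⋙ G) :=
  fun n ↦ hG.mono _ (hF n)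

theorem PreservesTowers.comp {G : C ⥤ D} {H : D ⥤ E} (hG : PreservesTowers G)
    (hH : PreservesTowers H) : PreservesTowers (G ⋙ H) where
  mono f hf := hH.mono _ (hG.mono f hf)
  lim F hF :=
    have := hG.lim F hF
    have := hH.lim (F ⋙ G) (hF.comp hG)
    inferInstance

theorem PreservesTowers.of_iso {G H : C ⥤ D} (e : G ≅ H) (hG : PreservesTowers G) :
    PreservesTowers H where
  mono f hf := by
    have := hG.mono f hf
    have h : H.map f = e.inv.app _ ≫ G.map f ≫ e.hom.app _ := by simp
    rw [h]
    infer_instance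
  lim F hF :=
    have := hG.lim F hF
    preservesLimit_of_natIso F e

/-- Functors with values in a functor category preserve towers if they do so pointwise. -/
theorem PreservesTowers.of_evaluation {G : C ⥤ D ⥤ E}
    (h : ∀ d, PreservesTowers (G ⋙ (evaluation D E).obj d)) : PreservesTowers G where
  mono f hf := by
    have (d : D) : Mono ((G.map f).app d) := (h d).mono f hf
    exact NatTrans.mono_of_mono_app _
  lim F hF := preservesLimit_of_evaluation _ _ fun d ↦ (h d).lim F hF

/-- Limits commute with limits, so a limit of functors preserving towers preserves them. Finite
limits and limits of towers are covered by shapes `J` in the lowest universe. -/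
theorem PreservesTowers.limit {J : Type} [SmallCategory J] [HasLimitsOfShape J D] (K : J ⥤ C ⥤ D)
    (h : ∀ j, PreservesTowers (K.obj j)) : PreservesTowers (limit K) := by
  have h1 : PreservesTowers K.flip := .of_evaluation h
  have h2 : PreservesLimitsOfSize.{0, 0} (Limits.lim : (J ⥤ D) ⥤ D) :=
    constLimAdj.rightAdjoint_preservesLimits
  exact .of_iso (limitIsoFlipCompLim K).symm (h1.comp (.of_preservesLimits _))

theorem PreservesTowers.pullback [HasPullbacks D] {F G H : C ⥤ D} (f : F ⟶ H) (g : G ⟶ H)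
    (hF : PreservesTowers F) (hG : PreservesTowers G) (hH : PreservesTowers H) :
    PreservesTowers (pullback f g) :=
  .limit _ fun j ↦ by
    obtain _ | _ | _ := j
    exacts [hH, hF, hG]

theorem PreservesTowers.equalizer [HasEqualizers D] {F G : C ⥤ D} (f g : F ⟶ G)
    (hF : PreservesTowers F) (hG : PreservesTowers G) : PreservesTowers (equalizer f g) :=
  .limit _ fun j ↦ by
    obtain _ | _ := j
    exacts [hF, hG]

/-- The limit of a tower of a bifunctor, along the diagonal, is computed by taking the limits in
the two variables separately. Only the existence and uniqueness of factorizations are stated, for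
families `f n` into the diagonal of the double tower. -/
theorem existsUnique_lift_diagonal (G : C ⥤ D ⥤ E) {F₁ : ℕᵒᵖ ⥤ C} {F₂ : ℕᵒᵖ ⥤ D}
    {c₁ : Cone F₁} {c₂ : Cone F₂} (h₁ : IsLimit ((G.flip.obj c₂.pt).mapCone c₁))
    (h₂ : ∀ n, IsLimit ((G.obj (F₁.obj n)).mapCone c₂)) {Z : E}
    (f : ∀ n, Z ⟶ (G.obj (F₁.obj n)).obj (F₂.obj n))
    (hf : ∀ {m n : ℕᵒᵖ} (u : m ⟶ n),
      f m ≫ (G.map (F₁.map u)).app _ ≫ (G.obj _).map (F₂.map u) = f n) :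
    ∃! g : Z ⟶ (G.obj c₁.pt).obj c₂.pt,
      ∀ n, g ≫ (G.map (c₁.π.app n)).app _ ≫ (G.obj _).map (c₂.π.app n) = f n := by
  -- A map to the place `(n, m)` is obtained from any diagonal place `(k, k)` above it.
  let t (k n m : ℕᵒᵖ) (u : k ⟶ n) (w : k ⟶ m) : Z ⟶ (G.obj (F₁.obj n)).obj (F₂.obj m) :=
    f k ≫ (G.map (F₁.map u)).app _ ≫ (G.obj _).map (F₂.map w)
  have ht {k k' n m : ℕᵒᵖ} (u : k ⟶ n) (w : k ⟶ m) (u' : k' ⟶ n) (w' : k' ⟶ m) :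
      t k n m u w = t k' n m u' w' := by
    have key {l k n m : ℕᵒᵖ} (p : l ⟶ k) (u : k ⟶ n) (w : k ⟶ m) :
        t l n m (p ≫ u) (p ≫ w) = t k n m u w := by
      simp only [t, Functor.map_comp, NatTrans.comp_app, ← hf p, Category.assoc,
        NatTrans.naturality_assoc]
    let l : ℕᵒᵖ := op (max k.unop k'.unop)
    let p : l ⟶ k := (homOfLE (le_max_left _ _)).op
    let p' : l ⟶ k' := (homOfLE (le_max_right _ _)).op
    rw [← key p, ← key p']
    congr 1
  let mx (n m : ℕᵒᵖ) : ℕᵒᵖ := op (max n.unop m.unop)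
  let pl (n m : ℕᵒᵖ) : mx n m ⟶ n := (homOfLE (le_max_left _ _)).op
  let pr (n m : ℕᵒᵖ) : mx n m ⟶ m := (homOfLE (le_max_right _ _)).op
  -- Lift in the second variable for each fixed first index, then lift in the first variable.
  let s (n : ℕᵒᵖ) : Cone (F₂ ⋙ G.obj (F₁.obj n)) :=
    { pt := Z
      π :=
        { app := fun m ↦ t (mx n m) n m (pl n m) (pr n m)
          naturality := fun m m' w ↦ by
            refine (Category.id_comp _).trans ?_
            rw [ht (pl n m') (pr n m') (pl n m) (pr n m ≫ w)]
            simp only [t, Functor.map_comp, Category.assoc, Functor.comp_map] } }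
  let r : Cone (F₁ ⋙ G.flip.obj c₂.pt) :=
    { pt := Z
      π :=
        { app := fun n ↦ (h₂ n).lift (s n)
          naturality := fun n n' w ↦ by
            refine (Category.id_comp _).trans ?_
            refine (h₂ n').hom_ext fun m ↦ ?_
            refine ((h₂ n').fac (s n') m).trans ?_
            have e := (h₂ n).fac (s n) m
            have e2 := (G.map (F₁.map w)).naturality (c₂.π.app m)
            simp only [Functor.mapCone_π_app] at e ⊢
            simp only [Functor.comp_map, Functor.flip_obj_map, Category.assoc]
            erw [← e2, reassoc_of% e]
            simp only [s]
            rw [ht (pl n' m) (pr n' m) (pl n m ≫ w) (pr n m)]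
            simp only [t, Functor.map_comp, Category.assoc, NatTrans.comp_app,
              NatTrans.naturality] } }
  have fac (n m) : h₁.lift r ≫ (G.map (c₁.π.app n)).app _ ≫ (G.obj _).map (c₂.π.app m) =
      t (mx n m) n m (pl n m) (pr n m) := by
    have e1 := h₁.fac r n
    have e2 := (h₂ n).fac (s n) m
    simp only [Functor.mapCone_π_app, Functor.flip_obj_map] at e1 e2
    erw [reassoc_of% e1]
    exact e2
  refine ⟨h₁.lift r, fun n ↦ ?_, fun g hg ↦ ?_⟩
  · rw [fac, ht _ _ (𝟙 n) (𝟙 n)]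
    simp only [t]
    exact hf (𝟙 n)
  · refine h₁.hom_ext fun n ↦ (h₂ n).hom_ext fun m ↦ ?_
    have e := fac n m
    simp only [Functor.mapCone_π_app, Functor.flip_obj_map, Category.assoc]
    refine Eq.trans ?_ e.symm
    have h := hg (mx n m)
    rw [← c₁.w (pl n m), ← c₂.w (pr n m)]
    simp only [t, ← h, Category.assoc, Functor.map_comp, NatTrans.comp_app,
      NatTrans.naturality_assoc]

end Towers

/-! ### The coreflection of a lax comonad -/

section Tower

variable {C : Type u'} [Category.{v'} C]

theorem mono_hcomp [HasPullbacks C] {F G H I : C ⥤ C} (a : F ⟶ G) (b : H ⟶ I) [Mono a] [Mono b]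
    (hI : PreservesTowers I) : Mono (a ◫ b) := by
  have (c : C) : Mono ((a ◫ b).app c) := by
    have : Mono (I.map (a.app c)) := hI.mono _ inferInstance
    rw [NatTrans.hcomp_app]
    infer_instance
  exact NatTrans.mono_of_mono_app _

variable [HasLimitsOfSize.{0, 0} C] (L : LaxComonadData C)

/-- The pullback condition in the construction of `Q₁`. -/
theorem towerχ_zero_comp_s :
    towerχ L 0 ≫ L.s 1 0 = towerδ L 0 ≫ L.α (rfl : 1 + 1 = 2) :=
  pullback.condition

/-- The pullback condition in the construction of `Q_{k+2}`. -/
theorem towerδ_comp_χ (k : ℕ) :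
    towerδ L (k + 1) ≫ (towerχ L k ◫ towerχ L k) = towerχ L (k + 1) ≫ towerδ L k := by
  refine (Category.assoc _ _ _).trans (Eq.trans ?_ (Category.assoc _ _ _).symm)
  exact congrArg (_ ≫ ·) pullback.condition.symm

/-- The equalizer condition in the construction of `Q_{k+2}`: coassociativity up to projection. -/
theorem towerδ_coassoc (k : ℕ) :
    towerδ L (k + 1) ≫ (towerχ L k ◫ towerδ L k) =
      towerδ L (k + 1) ≫ (towerδ L k ◫ towerχ L k) ≫ (Functor.associator _ _ _).hom := by
  refine (Category.assoc _ _ _).trans (Eq.trans ?_ (Category.assoc _ _ _).symm)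
  exact equalizer.condition _ _

theorem towerProj_comp_χ (k : ℕ) : towerProj L (k + 1) ≫ towerχ L k = towerProj L k := by
  have h := limit.w (Functor.ofOpSequence (towerχ L)) (homOfLE (Nat.le_add_right k 1)).op
  rw [Functor.ofOpSequence_map_homOfLE_succ] at h
  exact h

variable {L} (hα : Mono (L.α (rfl : 1 + 1 = 2))) (hQ : ∀ n, PreservesTowers (L.Q n))
include hα hQ

/-- The functors of the tower preserve towers, and its maps are monomorphisms. At each step the
projection is a pullback of `χ χ`, restricted to a subobject. -/
theorem stage_mono (k : ℕ) : PreservesTowers (stage L k).prev ∧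
    PreservesTowers (stage L k).cur ∧ Mono (stage L k).χ := by
  induction k with
  | zero => exact ⟨hQ 1, .pullback _ _ (hQ 1) ((hQ 1).comp (hQ 1)) (hQ 2),
      inferInstanceAs (Mono (pullback.fst (L.s 1 0) (L.α (rfl : 1 + 1 = 2))))⟩
  | succ k ih =>
    obtain ⟨h1, h2, h3⟩ := ih
    have h4 : Mono ((stage L k).χ ◫ (stage L k).χ) := mono_hcomp _ _ h1
    have h5 : PreservesTowers (stage L k).square :=
      .pullback _ _ h2 (h2.comp h2) (h1.comp h1)
    exact ⟨h2, .equalizer _ _ h5 ((h1.comp h1).comp h1),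
      inferInstanceAs (Mono (equalizer.ι _ _ ≫ pullback.fst (stage L k).δ _))⟩

theorem towerQ_preservesTowers (k : ℕ) : PreservesTowers (towerQ L k) := (stage_mono hα hQ k).1

theorem towerχ_mono (k : ℕ) : Mono (towerχ L k) := (stage_mono hα hQ k).2.2

theorem towerLim_preservesTowers : PreservesTowers (towerLim L) :=
  .limit _ fun j ↦ towerQ_preservesTowers hα hQ j.unop

/-- The limit `Q_∞` of the tower of monomorphisms is a subfunctor of each `Q_k`. -/
theorem towerProj_mono (k : ℕ) : Mono (towerProj L k) := by
  have h0 : Mono (towerProj L 0) := by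
    refine ⟨fun {Z} f g h ↦ limit.hom_ext fun j ↦ ?_⟩
    obtain ⟨j⟩ := j
    change f ≫ towerProj L j = g ≫ towerProj L j
    induction j with
    | zero => exact h
    | succ j ih =>
      have := towerχ_mono hα hQ j
      rw [← cancel_mono (towerχ L j), Category.assoc, Category.assoc, towerProj_comp_χ, ih]
  induction k with
  | zero => exact h0
  | succ k ih =>
    have : Mono (towerProj L (k + 1) ≫ towerχ L k) := by rwa [towerProj_comp_χ]
    exact mono_of_mono _ (towerχ L k)

omit hα hQ [HasLimitsOfSize.{0, 0} C] in
/-- Coassociativity of a comultiplication `δ` on `F` that restricts partial comultiplications `F₁ ⟶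
F₀ F₀` and `F₂ ⟶ F₁ F₁`, tested after a monomorphism to `F₀ F₀ F₀`: it follows from the
coassociativity of the partial comultiplications. -/
theorem coassoc_of_mono {F F₀ F₁ F₂ : C ⥤ C} (δ : F ⟶ F ⋙ F) (p₀ : F ⟶ F₀) (p₁ : F ⟶ F₁)
    (p₂ : F ⟶ F₂) (χ : F₁ ⟶ F₀) (δ₀ : F₁ ⟶ F₀ ⋙ F₀) (δ₁ : F₂ ⟶ F₁ ⋙ F₁)
    (h₀ : ∀ c, δ.app c ≫ p₀.app (F.obj c) ≫ F₀.map (p₀.app c) = p₁.app c ≫ δ₀.app c)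
    (h₁ : ∀ c, δ.app c ≫ p₁.app (F.obj c) ≫ F₁.map (p₁.app c) = p₂.app c ≫ δ₁.app c)
    (hχ : ∀ c, p₁.app c ≫ χ.app c = p₀.app c)
    (h : ∀ c, δ₁.app c ≫ δ₀.app (F₁.obj c) ≫ F₀.map (F₀.map (χ.app c)) =
      δ₁.app c ≫ χ.app (F₁.obj c) ≫ F₀.map (δ₀.app c)) (c : C)
    (hm : Mono (p₀.app (F.obj (F.obj c)) ≫ F₀.map (p₀.app (F.obj c) ≫ F₀.map (p₀.app c)))) :
    δ.app c ≫ F.map (δ.app c) = δ.app c ≫ δ.app (F.obj c) := by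
  rw [← cancel_mono (p₀.app (F.obj (F.obj c)) ≫ F₀.map (p₀.app (F.obj c) ≫ F₀.map (p₀.app c)))]
  have n1 := χ.naturality (p₁.app c)
  have n2 := δ₀.naturality (p₁.app c)
  dsimp at n2
  have e1 : δ.app c ≫ p₀.app (F.obj c) ≫ F₀.map (p₁.app c) =
      p₂.app c ≫ δ₁.app c ≫ χ.app (F₁.obj c) := by
    rw [← hχ (F.obj c), Category.assoc, ← n1, reassoc_of% h₁]
  have e2 : δ.app c ≫ δ.app (F.obj c) ≫ p₀.app (F.obj (F.obj c)) ≫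
      F₀.map (p₀.app (F.obj c) ≫ F₀.map (p₀.app c)) =
        p₂.app c ≫ δ₁.app c ≫ δ₀.app (F₁.obj c) ≫ F₀.map (F₀.map (χ.app c)) := by
    rw [F₀.map_comp, reassoc_of% h₀ (F.obj c), ← hχ c, F₀.map_comp, F₀.map_comp,
      ← reassoc_of% n2, reassoc_of% h₁]
  simp only [Category.assoc]
  have n3 := p₀.naturality_assoc (δ.app c) (F₀.map (p₀.app (F.obj c) ≫ F₀.map (p₀.app c)))
  rw [e2, h]
  refine (congrArg (δ.app c ≫ ·) n3).trans ?_
  rw [← F₀.map_comp, h₀ c, F₀.map_comp, reassoc_of% e1]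

/-- The comultiplication of `Q_∞`, from `Q_∞ Q_∞ = lim Q_k Q_k`. -/
theorem exists_towerComul : ∃ δ : towerLim L ⟶ towerLim L ⋙ towerLim L,
    ∀ k, δ ≫ (towerProj L k ◫ towerProj L k) = towerProj L (k + 1) ≫ towerδ L k := by
  let F : ℕᵒᵖ ⥤ C ⥤ C := Functor.ofOpSequence (towerχ L)
  -- Composition as a bifunctor. It preserves all limits in the outer functor, and the limit of the
  -- tower in the inner functor because `Q_∞` preserves limits of towers of monomorphisms.
  let G : (C ⥤ C) ⥤ (C ⥤ C) ⥤ C ⥤ C := Functor.whiskeringLeft C C C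
  have hF (c : C) : IsMonoTower (F ⋙ (evaluation C C).obj c) := fun n ↦ by
    have := towerχ_mono hα hQ n
    have h : F.map (homOfLE n.le_succ).op = towerχ L n :=
      Functor.ofOpSequence_map_homOfLE_succ (towerχ L) n
    change Mono ((F.map (homOfLE n.le_succ).op).app c)
    rw [h]
    exact (NatTrans.mono_iff_mono_app (towerχ L n)).1 this c
  have p₁ : PreservesLimit F (G.flip.obj (towerLim L)) := by
    refine preservesLimit_of_evaluation _ _ fun c ↦ ?_
    have := (towerLim_preservesTowers hα hQ).lim _ (hF c)
    exact inferInstanceAs (PreservesLimit F ((evaluation C C).obj c ⋙ towerLim L))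
  have p₂ (n : ℕᵒᵖ) : PreservesLimit F (G.obj (F.obj n)) := inferInstance
  let S : ℕᵒᵖ ⥤ C ⥤ C := F.prod' F ⋙ Functor.uncurry.obj G
  let φ : (Functor.const ℕᵒᵖ).obj (towerLim L) ⟶ S := NatTrans.ofOpSequence
    (fun n ↦ towerProj L (n + 1) ≫ towerδ L n) (fun n ↦ by
      have h : F.map (homOfLE (n.le_add_right 1)).op = towerχ L n :=
        Functor.ofOpSequence_map_homOfLE_succ (towerχ L) n
      have h1 : S.map (homOfLE (n.le_add_right 1)).op = towerχ L n ◫ towerχ L n := by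
        change (G.map (F.map _)).app _ ≫ (G.obj _).map (F.map _) = _
        rw [h]
        ext c
        exact ((towerχ L n).naturality _)
      have h2 : towerProj L (n + 1) ≫ towerδ L n = (towerProj L (n + 1 + 1) ≫
          towerδ L (n + 1)) ≫ (towerχ L n ◫ towerχ L n) := by
        rw [Category.assoc, towerδ_comp_χ, ← Category.assoc, towerProj_comp_χ]
      exact (Category.id_comp _).trans (h2.trans (congrArg (_ ≫ ·) h1.symm)))
  obtain ⟨δ, hδ, -⟩ := existsUnique_lift_diagonal G (c₁ := limit.cone F) (c₂ := limit.cone F)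
    (@isLimitOfPreserves _ _ _ _ _ _ _ (G.flip.obj (towerLim L)) _ (limit.isLimit F) p₁)
    (fun n ↦ isLimitOfPreserves _ (limit.isLimit F)) (fun n ↦ φ.app n)
    (fun u ↦ (φ.naturality u).symm.trans (Category.id_comp _))
  refine ⟨δ, fun k ↦ Eq.trans (congrArg (δ ≫ ·) ?_) (hδ (op k))⟩
  ext c
  exact ((towerProj L k).naturality _).symm

end Tower

section Coreflection

variable {C : Type u'} [Category.{v'} C] [HasLimitsOfSize.{0, 0} C] {L : LaxComonadData C}

/-- A compatible pair of transformations from a comonad to two consecutive steps of the tower. -/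
structure StageLift (S : Stage C) (R : Comonad C) where
  /-- the transformation to `Q_{k-1}` -/
  prev : R.toFunctor ⟶ S.prev
  /-- the transformation to `Q_k` -/
  cur : R.toFunctor ⟶ S.cur
  cur_χ : cur ≫ S.χ = prev
  cur_δ : cur ≫ S.δ = R.δ ≫ (prev ◫ prev)

/-- By coassociativity of `R`, the map `R ⟶ Q_k Q_k` equalizes the two maps to `Q_{k-1} Q_{k-1}
Q_{k-1}`. -/
theorem StageLift.coassoc {S : Stage C} {R : Comonad C} (l : StageLift S R) :
    R.δ ≫ (l.cur ◫ l.cur) ≫ (S.χ ◫ S.δ) =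
      R.δ ≫ (l.cur ◫ l.cur) ≫ (S.δ ◫ S.χ) ≫ (Functor.associator _ _ _).hom := by
  have e1 : (l.cur ◫ l.cur) ≫ (S.χ ◫ S.δ) = l.prev ◫ (R.δ ≫ (l.prev ◫ l.prev)) := by
    rw [← NatTrans.exchange, l.cur_χ, l.cur_δ]
  have e2 : (l.cur ◫ l.cur) ≫ (S.δ ◫ S.χ) = (R.δ ≫ (l.prev ◫ l.prev)) ◫ l.prev := by
    rw [← NatTrans.exchange, l.cur_χ, l.cur_δ]
  rw [e1, reassoc_of% e2]
  ext c
  have h := R.coassoc c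
  have n1 := R.δ.naturality (l.prev.app c)
  simp only [NatTrans.comp_app, NatTrans.hcomp_app, Functor.associator_hom_app,
    Category.comp_id, Functor.map_comp, Category.assoc, Functor.comp_map] at n1 ⊢
  rw [← l.prev.naturality_assoc (R.δ.app c), reassoc_of% h]
  simp

/-- The next step in the construction of the transformations `R ⟶ Q_k`. -/
noncomputable def StageLift.next {S : Stage C} {R : Comonad C} (l : StageLift S R) :
    StageLift S.next R where
  prev := l.cur
  cur := equalizer.lift (pullback.lift l.cur (R.δ ≫ (l.cur ◫ l.cur)) (by
    rw [l.cur_δ, Category.assoc, ← NatTrans.exchange, l.cur_χ])) (by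
      rw [pullback.lift_snd_assoc, pullback.lift_snd_assoc, Category.assoc, Category.assoc]
      exact l.coassoc)
  cur_χ := by
    refine (Category.assoc _ _ _).symm.trans ((congrArg (· ≫ _) (equalizer.lift_ι _ _)).trans ?_)
    exact pullback.lift_fst _ _ _
  cur_δ := by
    refine (Category.assoc _ _ _).symm.trans ((congrArg (· ≫ _) (equalizer.lift_ι _ _)).trans ?_)
    exact pullback.lift_snd _ _ _

variable {R : Comonad C} (p : R.toFunctor ⟶ L.Q 1)
  (hp : p ≫ L.s 1 0 = (R.δ ≫ (p ◫ p)) ≫ L.α (rfl : 1 + 1 = 2))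

/-- The transformations `R ⟶ Q_k` induced by `R ⟶ Q₀`. -/
noncomputable def stageLift : ∀ k, StageLift (stage L k) R
  | 0 =>
    { prev := p
      cur := pullback.lift p (R.δ ≫ (p ◫ p)) hp
      cur_χ := pullback.lift_fst _ _ _
      cur_δ := pullback.lift_snd _ _ _ }
  | k + 1 => (stageLift k).next

/-- The transformation `R ⟶ Q_∞` induced by `R ⟶ Q₀`. -/
noncomputable def towerLift : R.toFunctor ⟶ towerLim L :=
  limit.lift (Functor.ofOpSequence (towerχ L))
    { pt := R.toFunctor
      π := NatTrans.ofOpSequence (fun k ↦ (stageLift p hp k).prev) fun k ↦ by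
        refine (Category.id_comp _).trans ?_
        rw [Functor.ofOpSequence_map_homOfLE_succ]
        exact (stageLift p hp k).cur_χ.symm }

theorem towerLift_proj (k : ℕ) : towerLift p hp ≫ towerProj L k = (stageLift p hp k).prev :=
  limit.lift_π _ _

/-- Composing with `f : T ⟶ T'` before extending to powers, or after it. -/
theorem powMap_powHom {T T' : C ⥤ C} (f : T ⟶ T') (p : T' ⟶ L.Q 1) (n : ℕ) :
    powMap f n ≫ powHom L p n = powHom L (f ≫ p) n := by
  induction n with
  | zero => exact Category.id_comp _
  | succ n ih =>
    refine (Category.assoc _ _ _).symm.trans (congrArg (· ≫ _) ?_)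
    rw [← ih]
    exact (NatTrans.exchange _ _ _ _).symm

section

variable (hL : IsLaxComonad L) (hα : Mono (L.α (rfl : 1 + 1 = 2)))
  (hQ : ∀ n, PreservesTowers (L.Q n)) (e : L.Q 1 ⟶ 𝟭 C) (he : L.d 0 0 = e ≫ L.η)
include hL he

/-! Since the face `L₁ ⟶ L₀` is `e ≫ η`, the counit `e` applied to either factor of `L₁ L₁` is the
corresponding face `L₂ ⟶ L₁`, restricted along `α`. -/

theorem counit_outer_app (c : C) :
    e.app ((L.Q 1).obj c) = (L.α (rfl : 1 + 1 = 2)).app c ≫ (L.d 1 0).app c := by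
  rw [← hL.α_d_outer_app (rfl : 1 + 0 = 1) rfl 0 0 rfl c, he, NatTrans.comp_app, Category.assoc,
    hL.η_outer_app]
  exact (Category.comp_id _).symm

theorem counit_inner_app (c : C) :
    (L.Q 1).map (e.app c) = (L.α (rfl : 1 + 1 = 2)).app c ≫ (L.d 1 1).app c := by
  rw [← hL.α_d_inner_app (rfl : 0 + 1 = 1) rfl 0 1 rfl c, he, NatTrans.comp_app,
    CategoryTheory.Functor.map_comp, Category.assoc, hL.η_inner_app]
  exact (Category.comp_id _).symm

/-- Counitality of `δ`, tested in `L₁`. There `δ ≫ p₀ p₀` becomes the degeneracy `L₁ ⟶ L₂`, on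
which both faces are the identity. -/
theorem counit_of_mono {F F₁ : C ⥤ C} (δ : F ⟶ F ⋙ F) (p₀ : F ⟶ L.Q 1) (p₁ : F ⟶ F₁)
    (χ : F₁ ⟶ L.Q 1) (δ₀ : F₁ ⟶ L.Q 1 ⋙ L.Q 1)
    (h₀ : ∀ c, δ.app c ≫ p₀.app (F.obj c) ≫ (L.Q 1).map (p₀.app c) = p₁.app c ≫ δ₀.app c)
    (hχ : ∀ c, p₁.app c ≫ χ.app c = p₀.app c)
    (hs : ∀ c, χ.app c ≫ (L.s 1 0).app c = δ₀.app c ≫ (L.α (rfl : 1 + 1 = 2)).app c) (c : C)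
    (hm : Mono (p₀.app c)) :
    δ.app c ≫ (p₀ ≫ e).app (F.obj c) = 𝟙 _ ∧ δ.app c ≫ F.map ((p₀ ≫ e).app c) = 𝟙 _ := by
  have d0 : (L.s 1 0).app c ≫ (L.d 1 0).app c = 𝟙 _ :=
    NatTrans.congr_app (hL.s_d_self 1 0) c
  have d1 : (L.s 1 0).app c ≫ (L.d 1 1).app c = 𝟙 _ :=
    NatTrans.congr_app (hL.s_d_succ 1 0) c
  have n1 := e.naturality (p₀.app c)
  dsimp at n1
  rw [← cancel_mono (p₀.app c), ← cancel_mono (p₀.app c), Category.id_comp]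
  constructor
  · simp only [NatTrans.comp_app, Category.assoc]
    erw [← n1, reassoc_of% h₀, counit_outer_app hL e he, ← reassoc_of% hs, d0, Category.comp_id]
    exact hχ c
  · simp only [Category.assoc]
    refine (congrArg (δ.app c ≫ ·) (p₀.naturality _)).trans ?_
    rw [NatTrans.comp_app, CategoryTheory.Functor.map_comp, reassoc_of% h₀,
      counit_inner_app hL e he, ← reassoc_of% hs, d1, Category.comp_id]
    exact hχ c

include hα hQ in
/-- The comonad structure of `Q_∞`, whose counit is induced by a factorization `e` of the face `L₁
⟶ L₀` through `η`. -/
theorem exists_towerComonad : ∃ K : ComonadOn (towerLim L), K.ε = towerBase L ≫ e ∧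
    ∀ k, K.δ ≫ (towerProj L k ◫ towerProj L k) = towerProj L (k + 1) ≫ towerδ L k := by
  obtain ⟨δ, hδ⟩ := exists_towerComul hα hQ
  have hm (k : ℕ) (c : C) : Mono ((towerProj L k).app c) :=
    (NatTrans.mono_iff_mono_app _).1 (towerProj_mono hα hQ k) c
  have hδ' (k : ℕ) (c : C) : δ.app c ≫ (towerProj L k).app ((towerLim L).obj c) ≫
      (towerQ L k).map ((towerProj L k).app c) =
        (towerProj L (k + 1)).app c ≫ (towerδ L k).app c := NatTrans.congr_app (hδ k) c
  have hs (c : C) : (towerχ L 0).app c ≫ (L.s 1 0).app c =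
      (towerδ L 0).app c ≫ (L.α (rfl : 1 + 1 = 2)).app c :=
    NatTrans.congr_app (towerχ_zero_comp_s L) c
  have hχ (k : ℕ) (c : C) : (towerProj L (k + 1)).app c ≫ (towerχ L k).app c =
      (towerProj L k).app c := NatTrans.congr_app (towerProj_comp_χ L k) c
  refine ⟨⟨towerBase L ≫ e, δ, fun c ↦ ?_, fun c ↦ ?_, fun c ↦ ?_⟩, rfl, hδ⟩
  · refine coassoc_of_mono δ (towerProj L 0) (towerProj L 1) (towerProj L 2) (towerχ L 0)
      (towerδ L 0) (towerδ L 1) (hδ' 0) (hδ' 1) (hχ 0) (fun c ↦ ?_) c ?_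
    · refine (NatTrans.congr_app (towerδ_coassoc L 0) c).trans (congrArg (_ ≫ ·) ?_)
      exact Category.comp_id _
    · have h0 := towerQ_preservesTowers hα hQ 0
      have h1 := h0.mono _ (hm 0 c)
      have m1 := hm 0 ((towerLim L).obj c)
      have m2 := hm 0 ((towerLim L).obj ((towerLim L).obj c))
      have h2 := h0.mono _ (mono_comp ((towerProj L 0).app ((towerLim L).obj c))
        ((towerQ L 0).map ((towerProj L 0).app c)))
      exact mono_comp ((towerProj L 0).app ((towerLim L).obj ((towerLim L).obj c)))
        ((towerQ L 0).map ((towerProj L 0).app ((towerLim L).obj c) ≫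
          (towerQ L 0).map ((towerProj L 0).app c)))
  · exact (counit_of_mono hL e he δ (towerProj L 0) (towerProj L 1) (towerχ L 0) (towerδ L 0)
      (hδ' 0) (hχ 0) hs c (hm 0 c)).1
  · exact (counit_of_mono hL e he δ (towerProj L 0) (towerProj L 1) (towerχ L 0) (towerδ L 0)
      (hδ' 0) (hχ 0) hs c (hm 0 c)).2

include hα hQ in
/-- If `α : L₁ L₁ ⟶ L₂` and `η` are monomorphisms and the functors `Lₙ` preserve towers of
monomorphisms, then the limit of the tower is the coreflection of the lax comonad `L` into
comonads. -/
theorem exists_coreflection (hη : Mono L.η) :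
    ∃ K : ComonadOn (towerLim L),
      K.ε = towerBase L ≫ e ∧
      (∀ k, K.δ ≫ (towerProj L k ◫ towerProj L k) = towerProj L (k + 1) ≫ towerδ L k) ∧
      ∃ Φ : LaxComonadHom (ofComonad K.toComonad) L,
        Φ.app 1 = (Functor.leftUnitor K.toComonad.toFunctor).hom ≫ towerBase L ∧
        ∀ (R : Comonad C) (Ψ : LaxComonadHom (ofComonad R) L),
          ∃! f : R ⟶ K.toComonad, ∀ n, powMap f.toNatTrans n ≫ Φ.app n = Ψ.app n := by
  obtain ⟨K, hε, hδ⟩ := exists_towerComonad hL hα hQ e he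
  have hs : towerBase L ≫ L.s 1 0 =
      (K.δ ≫ (towerBase L ◫ towerBase L)) ≫ L.α (rfl : 1 + 1 = 2) := by
    have h1 : towerBase L = towerProj L 1 ≫ towerχ L 0 := (towerProj_comp_χ L 0).symm
    have h2 : K.δ ≫ (towerBase L ◫ towerBase L) = towerProj L 1 ≫ towerδ L 0 := hδ 0
    rw [h2, h1]
    refine (Category.assoc _ _ _).trans (Eq.trans ?_ (Category.assoc _ _ _).symm)
    exact congrArg (_ ≫ ·) (towerχ_zero_comp_s L)
  have hd : towerBase L ≫ L.d 0 0 = K.ε ≫ L.η := by rw [he, hε, Category.assoc]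
  have hm : Mono (towerBase L) := towerProj_mono hα hQ 0
  refine ⟨K, hε, hδ, hL.homOfComonad K.toComonad (towerBase L) (fun c ↦ ?_) (fun c ↦ ?_),
    hL.powHom_one _, fun R Ψ ↦ ?_⟩
  · have := NatTrans.congr_app hs c
    simp only [NatTrans.comp_app, NatTrans.hcomp_app, Category.assoc] at this
    exact this
  · exact NatTrans.congr_app hd c
  · -- Everything about `Ψ` is expressed by its component `p` at `1`.
    have hΨ := IsLaxComonad.app_eq_powHom Ψ
    set p : R.toFunctor ⟶ L.Q 1 := (Functor.leftUnitor R.toFunctor).inv ≫ Ψ.app 1 with hp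
    have hp1 (c : C) : (powHom L p 1).app c = p.app c :=
      (NatTrans.congr_app (hL.powHom_one p) c).trans (Category.id_comp _)
    have hps : p ≫ L.s 1 0 = (R.δ ≫ (p ◫ p)) ≫ L.α (rfl : 1 + 1 = 2) := by
      have h := Ψ.app_s 1 0
      rw [hΨ, hΨ] at h
      ext c
      have hc : (powS R.δ 1 0).app c ≫ (powHom L p 2).app c =
        (powHom L p 1).app c ≫ (L.s 1 0).app c := NatTrans.congr_app h c
      rw [powS_zero_app, powHom_succ_app, hp1] at hc
      refine hc.symm.trans ?_
      have n1 := p.naturality_assoc (p.app c) ((L.α (rfl : 1 + 1 = 2)).app c)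
      refine (congrArg (_ ≫ ·) n1).trans ?_
      simp only [NatTrans.comp_app, NatTrans.hcomp_app, Category.assoc]
      rfl
    have hpd : p ≫ L.d 0 0 = R.ε ≫ L.η := by
      have h := Ψ.app_d 0 0
      rw [hΨ, hΨ] at h
      ext c
      have hc : (powD R.ε 0 0).app c ≫ (powHom L p 0).app c =
        (powHom L p 1).app c ≫ (L.d 0 0).app c := NatTrans.congr_app h c
      rw [powD_zero_app, hp1] at hc
      exact hc.symm
    have hf0 : towerLift p hps ≫ towerBase L = p := towerLift_proj p hps 0
    -- The lift of `p` is a morphism of comonads; both conditions are tested after monomorphisms.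
    have hfε : towerLift p hps ≫ K.ε = R.ε := by
      rw [← cancel_mono L.η, hε, reassoc_of% hf0, Category.assoc, ← he, hpd]
    have hfδ : towerLift p hps ≫ K.δ = R.δ ≫ (towerLift p hps ◫ towerLift p hps) := by
      have hmm : Mono (towerBase L ◫ towerBase L) :=
        mono_hcomp _ _ (hQ 1)
      rw [← cancel_mono (towerBase L ◫ towerBase L), Category.assoc, Category.assoc,
        ← NatTrans.exchange, hf0]
      refine (congrArg (_ ≫ ·) (hδ 0)).trans ?_
      rw [← Category.assoc, towerLift_proj]
      exact (stageLift p hps 0).cur_δ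
    refine ⟨{ toNatTrans := towerLift p hps
              app_ε := fun c ↦ NatTrans.congr_app hfε c
              app_δ := fun c ↦ NatTrans.congr_app hfδ c }, fun n ↦ ?_, fun g hg ↦ ?_⟩
    · rw [hΨ]
      exact (powMap_powHom (towerLift p hps) (towerBase L) n).trans (congrArg (powHom L · n) hf0)
    · have h1 := hg 1
      rw [hΨ] at h1
      have h2 := (powMap_powHom g.toNatTrans (towerBase L) 1).symm.trans h1
      have h3 : g.toNatTrans ≫ towerBase L = p := by
        ext c
        refine Eq.trans ?_ ((NatTrans.congr_app h2 c).trans (hp1 c))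
        exact ((NatTrans.congr_app (hL.powHom_one _) c).trans (Category.id_comp _)).symm
      have h4 : g.toNatTrans = towerLift p hps :=
        (cancel_mono (towerBase L)).1 (h3.trans hf0.symm)
      ext c
      exact NatTrans.congr_app h4 c

end

end Coreflection

noncomputable section

open MonoidalCategory.DayFunctor

variable {V : Type u} [Category.{v} V] [MonoidalCategory V] [SymmetricCategory V]
  [MonoidalClosed V] [HasLimits V] [HasColimits V] {X : Type v}

/-! ### Composition of natural transformations -/

/-- Maps into `∫ [1, K]`, for the unit of the Day convolution, are determined by their action on
the unit element. -/
theorem act_unit_ext {K : Word X ⥤ V} {Z : V}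
    {f g : Z ⟶ vhom (𝟙_ (SMod V X)).functor K}
    (h : act f (ν (Word X) V) = act g (ν (Word X) V)) : f = g := by
  refine vhom_unit_ext ?_
  simpa only [act, MonoidalCategory.tensorHom_def', Category.assoc] using h

/-! Equalities of maps into ends are tested by their actions on elements
`a : D ⟶ A x`. The following lemmas compute the actions of identities, from which all other ones
are obtained by precomposition. -/

theorem act_vpair_id {F G : SMod V X} {M N K : Word X ⥤ V} (j : Pairing M N K) {D D' : V}
    {x y : Word X} (a : D ⟶ F.functor.obj x) (b : D' ⟶ G.functor.obj y) :
    act (vpair (F := F) (G := G) j) ((a ⊗ₘ b) ≫ dayι F G x y) =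
      tensorμ _ _ _ _ ≫
        (act (𝟙 (vhom F.functor M)) a ⊗ₘ act (𝟙 (vhom G.functor N)) b) ≫ j.app x y := by
  have h := act_vpair (F := F) (G := G) j (𝟙 _) (𝟙 _) a b
  rwa [id_tensorHom_id, Category.id_comp] at h

theorem act_vpair_dayι {F G : SMod V X} {M N K : Word X ⥤ V} (j : Pairing M N K)
    (x y : Word X) :
    act (vpair (F := F) (G := G) j) (dayι F G x y) = tensorμ _ _ _ _ ≫
      (act (𝟙 (vhom F.functor M)) (𝟙 (F.functor.obj x)) ⊗ₘ
        act (𝟙 (vhom G.functor N)) (𝟙 (G.functor.obj y))) ≫ j.app x y := by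
  have h := act_vpair_id (F := F) (G := G) j (𝟙 (F.functor.obj x)) (𝟙 (G.functor.obj y))
  rwa [id_tensorHom_id, Category.id_comp] at h

theorem act_vcomp_id {A B C : Word X ⥤ V} {D : V} {x : Word X} (a : D ⟶ A.obj x) :
    act (vcomp A B C) a =
      (α_ _ _ _).hom ≫ act (𝟙 (vhom B C)) (act (𝟙 (vhom A B)) a) := by
  have h := act_vcomp (𝟙 (vhom B C)) (𝟙 (vhom A B)) a
  rwa [id_tensorHom_id, Category.id_comp] at h

/-- Composition of natural transformations is associative. -/
theorem vcomp_assoc (A B C D : Word X ⥤ V) :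
    (vcomp B C D ▷ vhom A B) ≫ vcomp A B D =
      (α_ _ _ _).hom ≫ (_ ◁ vcomp A B C) ≫ vcomp A C D := by
  refine act_ext (fun x ↦ ?_)
  have h1 := act_vcomp (vcomp B C D) (𝟙 (vhom A B)) (𝟙 (A.obj x))
  have h2 := act_vcomp (𝟙 (vhom C D)) (vcomp A B C) (𝟙 (A.obj x))
  rw [tensorHom_id] at h1
  rw [id_tensorHom] at h2
  rw [h1, act_comp_left, h2, act_vcomp_id, act_vcomp_id, act_comp_right]
  simp

/-- The associativity of the interchange of tensor factors, with actions `b₁`, `b₂`, `p`, `q`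
inserted. -/
theorem vcomp_vpair_aux {Z₁ Z₂ Y₁ Y₂ A₁ A₂ B₁ B₂ M₁ M₂ : V} (p : Z₁ ⊗ B₁ ⟶ M₁)
    (q : Z₂ ⊗ B₂ ⟶ M₂) (b₁ : Y₁ ⊗ A₁ ⟶ B₁) (b₂ : Y₂ ⊗ A₂ ⟶ B₂) :
    (α_ _ _ _).hom ≫ (_ ◁ tensorμ Y₁ Y₂ A₁ A₂) ≫ (_ ◁ (b₁ ⊗ₘ b₂)) ≫
        tensorμ Z₁ Z₂ B₁ B₂ ≫ (p ⊗ₘ q) =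
      (tensorμ Z₁ Z₂ Y₁ Y₂ ▷ _) ≫ tensorμ _ _ _ _ ≫
        (((α_ _ _ _).hom ≫ (_ ◁ b₁) ≫ p) ⊗ₘ ((α_ _ _ _).hom ≫ (_ ◁ b₂) ≫ q)) := by
  have h := tensor_associativity Z₁ Z₂ Y₁ Y₂ A₁ A₂
  rw [tensorμ_natural_right_assoc, ← reassoc_of% h]
  simp only [tensorHom_comp_tensorHom]

/-- Composition of natural transformations is compatible with the pairings `vpair`. -/
theorem vpair_vcomp {F G F' G' : SMod V X} {M N K : Word X ⥤ V} (j : Pairing M N K) :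
    (vpair (F := F) (G := G) j ⊗ₘ vpair (F := F') (G := G') (dayPairing F G)) ≫
        vcomp (F' ⊗ G').functor (F ⊗ G).functor K =
      tensorμ _ _ _ _ ≫ (vcomp F'.functor F.functor M ⊗ₘ vcomp G'.functor G.functor N) ≫
        vpair (F := F') (G := G') j := by
  refine act_day_ext (fun x y ↦ ?_)
  have h1 := act_vpair (F := F') (G := G') j (vcomp F'.functor F.functor M)
    (vcomp G'.functor G.functor N) (𝟙 (F'.functor.obj x)) (𝟙 (G'.functor.obj y))
  rw [id_tensorHom_id, Category.id_comp] at h1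
  rw [act_vcomp, act_vpair_dayι, act_comp_left, h1, act_vcomp_id, act_vcomp_id, act_comp_right]
  have h2 := act_vpair_id (F := F) (G := G) j
    (act (𝟙 (vhom F'.functor F.functor)) (𝟙 (F'.functor.obj x)))
    (act (𝟙 (vhom G'.functor G.functor)) (𝟙 (G'.functor.obj y)))
  change _ ≫ _ ◁ tensorμ _ _ _ _ ≫ act (vpair j) ((_ ⊗ₘ _) ≫ dayι F G x y) = _
  rw [h2]
  have h3 := vcomp_vpair_aux (act (𝟙 (vhom F.functor M)) (𝟙 (F.functor.obj x)))
    (act (𝟙 (vhom G.functor N)) (𝟙 (G.functor.obj y)))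
    (act (𝟙 (vhom F'.functor F.functor)) (𝟙 (F'.functor.obj x)))
    (act (𝟙 (vhom G'.functor G.functor)) (𝟙 (G'.functor.obj y)))
  have h4 {A K : Word X ⥤ V} {D : V} {x : Word X} (a : D ⟶ A.obj x) :
      act (𝟙 (vhom A K)) a = (_ ◁ a) ≫ act (𝟙 (vhom A K)) (𝟙 (A.obj x)) := by
    rw [← act_comp_right, Category.comp_id]
  rw [h4 (act (𝟙 (vhom F'.functor F.functor)) (𝟙 (F'.functor.obj x))),
    h4 (act (𝟙 (vhom G'.functor G.functor)) (𝟙 (G'.functor.obj y)))]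
  have h5 := congrArg (· ≫ j.app x y) h3
  simp only [Category.assoc] at h5
  rw [← h5, tensorμ_natural_right_assoc]
  simp only [tensorHom_comp_tensorHom_assoc]

/-- Composition of natural transformations is compatible with the unit pairing. -/
theorem vunit_vcomp {K : Word X ⥤ V} (k : 𝟙_ V ⟶ K.obj (𝟙_ _)) :
    (vunit k ⊗ₘ vunit (ν (Word X) V)) ≫ vcomp _ _ K = (λ_ _).hom ≫ vunit k := by
  refine act_unit_ext ?_
  rw [act_vcomp, act_vunit, act_comp_right, act_vunit, act_comp_left, act_vunit]
  monoidal

/-- The element of `∫_x [A x, A x]` given by the identity. -/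
def vid (A : Word X ⥤ V) : 𝟙_ V ⟶ vhom A A :=
  vlift { app := fun _ ↦ (λ_ _).hom
          naturality := fun _ _ _ ↦ leftUnitor_naturality _ }

theorem act_vid {A : Word X ⥤ V} {D : V} {x : Word X} (a : D ⟶ A.obj x) :
    act (vid A) a = (λ_ _).hom ≫ a := by
  rw [vid, act_vlift]
  exact leftUnitor_naturality _

/-- The unit pairing applied to the unit element is the identity transformation of the unit. -/
theorem vunit_ν : vunit (ν (Word X) V) = vid (𝟙_ (SMod V X)).functor :=
  act_unit_ext (by rw [act_vunit, act_vid])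

/-- The pairing of identity transformations is the identity transformation. -/
theorem vpair_vid (F G : SMod V X) :
    (λ_ (𝟙_ V)).inv ≫ (vid F.functor ⊗ₘ vid G.functor) ≫ vpair (dayPairing F G) =
      vid (F ⊗ G).functor := by
  refine act_day_ext (fun x y ↦ ?_)
  have h := act_vpair (F := F) (G := G) (dayPairing F G) (vid F.functor) (vid G.functor)
    (𝟙 (F.functor.obj x)) (𝟙 (G.functor.obj y))
  rw [id_tensorHom_id, Category.id_comp] at h
  rw [act_comp_left, h, act_vid, act_vid, act_vid, Category.comp_id, Category.comp_id]
  exact (tensor_left_unitality_assoc _ _ _).symm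

/-! ### Compatibility of the comonad structure with pairings -/

/-- The pairing `P^∧ M, P^∧ N → P^∧ K` induced by a pairing `M, N → K`. -/
def wedgePairing (P : X → SMod V X) {M N K : Word X ⥤ V} (j : Pairing M N K) :
    Pairing (wedgeObj P M) (wedgeObj P N) (wedgeObj P K) where
  app a b := vpair (F := (bigP P).obj a) (G := (bigP P).obj b) j
  natural {a a' b b'} f g := by
    have h := vpair_natural j j ((bigP P).map (inv f))
      ((bigP P).map (inv g)) (𝟙 _) (𝟙 _) (𝟙 _) (fun x y ↦ by simp)
    -- `wedgeObj` is covariant in the word through inverses in the groupoid `Word X`.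
    have h2 : (wedgeObj P K).map (f ⊗ₘ g) =
        vmap ((bigP P).map (inv f) ⊗ₘ (bigP P).map (inv g)).natTrans (𝟙 _) := by
      rw [MonoidalCategory.tensorHom_def' ((bigP P).map (inv f)),
        MonoidalCategory.tensorHom_def f, CategoryTheory.Functor.map_comp,
        wedgeObj_map_whiskerRight, wedgeObj_map_whiskerLeft]
      exact (vmap_comp _ _ _ _).trans (congrArg _ (Category.comp_id _))
    rw [h2]
    exact h

/-! The next two lemmas are `vpair_vcomp` and `vunit_vcomp` with maps `c`, `c'`, `d` into the ends
inserted; they apply to the compositions of an operad. -/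

theorem vpair_vcomp_aux {F G F' G' : SMod V X} {M N K : Word X ⥤ V} (j : Pairing M N K)
    {D D' E : V} {c : D ⟶ vhom F'.functor F.functor} {c' : D' ⟶ vhom G'.functor G.functor}
    {e : D ⊗ D' ⟶ E} {d : E ⟶ vhom (F' ⊗ G').functor (F ⊗ G).functor}
    (h : e ≫ d = (c ⊗ₘ c') ≫ vpair (dayPairing F G)) :
    (vpair (F := F) (G := G) j ▷ (D ⊗ D')) ≫ (_ ◁ e) ≫ (_ ◁ d) ≫ vcomp _ _ K =
      tensorμ _ _ _ _ ≫ (((_ ◁ c) ≫ vcomp F'.functor F.functor M) ⊗ₘ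
        ((_ ◁ c') ≫ vcomp G'.functor G.functor N)) ≫ vpair (F := F') (G := G') j := by
  rw [← MonoidalCategory.whiskerLeft_comp_assoc, h, MonoidalCategory.whiskerLeft_comp_assoc,
    ← whisker_exchange_assoc, ← MonoidalCategory.tensorHom_def_assoc, vpair_vcomp,
    ← tensorHom_comp_tensorHom_assoc, ← tensorμ_natural_right_assoc]

theorem vunit_vcomp_aux {K : Word X ⥤ V} (k : 𝟙_ V ⟶ K.obj (𝟙_ _)) {E : V} {e : 𝟙_ V ⟶ E}
    {d : E ⟶ vhom (𝟙_ (SMod V X)).functor (𝟙_ (SMod V X)).functor}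
    (h : e ≫ d = vunit (ν (Word X) V)) :
    (vunit k ▷ 𝟙_ V) ≫ (_ ◁ e) ≫ (_ ◁ d) ≫ vcomp _ _ K = (λ_ _).hom ≫ vunit k := by
  rw [← MonoidalCategory.whiskerLeft_comp_assoc, h, ← MonoidalCategory.tensorHom_def_assoc,
    vunit_vcomp]

/-- Evaluation at a tensor product of elements is compatible with pairings. -/
theorem vpair_counit_aux {F G : SMod V X} {M N K : Word X ⥤ V} (j : Pairing M N K)
    {a b : Word X} (i : 𝟙_ V ⟶ F.functor.obj a) (i' : 𝟙_ V ⟶ G.functor.obj b) :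
    vpair (F := F) (G := G) j ≫ (ρ_ _).inv ≫
        act (𝟙 (vhom (F ⊗ G).functor K)) (dayElt i i') =
      (((ρ_ _).inv ≫ act (𝟙 (vhom F.functor M)) i) ⊗ₘ
        ((ρ_ _).inv ≫ act (𝟙 (vhom G.functor N)) i')) ≫ j.app a b := by
  have h3 := tensor_right_unitality (vhom F.functor M) (vhom G.functor N)
  have h4 : (ρ_ (vhom F.functor M ⊗ vhom G.functor N)).inv ≫
      (_ ◁ (λ_ (𝟙_ V)).inv) ≫ tensorμ _ _ _ _ = (ρ_ _).inv ⊗ₘ (ρ_ _).inv := by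
    rw [Iso.inv_comp_eq, h3]
    simp only [Category.assoc, tensorHom_comp_tensorHom, Iso.hom_inv_id, id_tensorHom_id,
      Category.comp_id]
  rw [rightUnitor_inv_naturality_assoc, ← act_comp_left, Category.comp_id, dayElt, act_comp_right,
    act_vpair_id, reassoc_of% h4, tensorHom_comp_tensorHom_assoc]

theorem dayι_tensorHom_wedgeDayμ (P : X → SMod V X) {F G F' G' : SMod V X}
    (f : F ⟶ (wedgeDay P).obj F') (g : G ⟶ (wedgeDay P).obj G') (x y : Word X) :
    dayι F G x y ≫ ((f ⊗ₘ g) ≫ wedgeDayμ P F' G').natTrans.app (x ⊗ y) =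
      (f.natTrans.app x ⊗ₘ g.natTrans.app y) ≫
        vpair (F := (bigP P).obj x) (G := (bigP P).obj y) (dayPairing F' G') := by
  rw [natTrans_comp, reassoc_of% dayι_map f g x y, dayι_wedgeDayμ]
  rfl

namespace OperadData

variable (P : OperadData V X)

/-! By the recursive definition of the extension `compT` to words, it is monoidal on the nose. -/

theorem compT_tensor (a b : Word X) : P.compT.app (a.tensor b) =
    (P.compT.app a ⊗ₘ P.compT.app b) ≫
      wedgeDayμ P.obj ((bigP P.obj).obj a) ((bigP P.obj).obj b) := by
  change (P.compT.app a ⊗ₘ P.compT.app b) ≫ wedgeDayμ P.obj _ _ ≫ (wedgeDay P.obj).map (𝟙 _) = _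
  rw [CategoryTheory.Functor.map_id]
  exact congrArg (_ ≫ ·) (Category.comp_id _)

theorem compT_unit : P.compT.app (Word.unit : Word X) = wedgeDayε P.obj := by
  change wedgeDayε P.obj ≫ (wedgeDay P.obj).map (𝟙 _) = _
  rw [CategoryTheory.Functor.map_id]
  exact Category.comp_id _

/-- The composition of operations with output word `a ⊗ b` is given by the compositions for `a` and
`b`, through the pairing of Day tensor products. -/
theorem dayι_compNat (a b x y : Word X) :
    dayι ((bigP P.obj).obj a) ((bigP P.obj).obj b) x y ≫ (P.compNat (a.tensor b)).app (x ⊗ y) =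
      ((P.compNat a).app x ⊗ₘ (P.compNat b).app y) ≫
        vpair (F := (bigP P.obj).obj x) (G := (bigP P.obj).obj y)
          (dayPairing ((bigP P.obj).obj a) ((bigP P.obj).obj b)) := by
  refine (congrArg (fun t ↦ dayι _ _ x y ≫ (Hom.natTrans t).app (x ⊗ y))
    (P.compT_tensor a b)).trans ?_
  exact dayι_tensorHom_wedgeDayμ P.obj (P.compT.app a) (P.compT.app b) x y

/-- The composition of operations with empty output word preserves the unit element. -/
theorem ν_compNat :
    ν (Word X) V ≫ (P.compNat Word.unit).app (𝟙_ _) = vunit (ν (Word X) V) :=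
  (congrArg (fun t ↦ ν (Word X) V ≫ (Hom.natTrans t).app (𝟙_ _)) P.compT_unit).trans
    (ν_wedgeDayε P.obj)

/-- The comultiplication of `P^∧` is compatible with pairings. -/
theorem wedgeΔ_pairing {M N K : Word X ⥤ V} (j : Pairing M N K) (a b : Word X) :
    (wedgePairing P.obj j).app a b ≫ P.wedgeΔApp K (a ⊗ b) =
      (P.wedgeΔApp M a ⊗ₘ P.wedgeΔApp N b) ≫
        (wedgePairing P.obj (wedgePairing P.obj j)).app a b := by
  refine act_day_ext (F := (bigP P.obj).obj a) (G := (bigP P.obj).obj b) (fun x y ↦ ?_)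
  refine (act_comp_left _ _ _).trans ?_
  refine (congrArg (_ ≫ ·) (P.act_wedgeΔApp K (a ⊗ b) (x ⊗ y) _)).trans ?_
  have h1 := act_vpair (F := (bigP P.obj).obj a) (G := (bigP P.obj).obj b)
    (wedgePairing P.obj j) (P.wedgeΔApp M a) (P.wedgeΔApp N b) (𝟙 _) (𝟙 _) (x := x) (y := y)
  rw [id_tensorHom_id, Category.id_comp] at h1
  refine Eq.trans ?_ h1.symm
  refine Eq.trans ?_ (congrArg (fun t ↦ tensorμ _ _ _ _ ≫ t ≫ _)
    (congrArg₂ (· ⊗ₘ ·) (P.act_wedgeΔApp_id M a x) (P.act_wedgeΔApp_id N b y))).symm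
  exact vpair_vcomp_aux (F := (bigP P.obj).obj a) (G := (bigP P.obj).obj b) j
    (P.dayι_compNat a b x y)

/-- The comultiplication of `P^∧` is compatible with the unit pairings. -/
theorem wedgeΔ_unit {K : Word X ⥤ V} (k : 𝟙_ V ⟶ K.obj (𝟙_ _)) :
    vunit k ≫ P.wedgeΔApp K Word.unit = vunit (K := wedgeObj P.obj K) (vunit k) := by
  refine act_unit_ext ?_
  refine (act_comp_left _ _ _).trans ?_
  refine (congrArg (_ ≫ ·) (P.act_wedgeΔApp K Word.unit (𝟙_ _) _)).trans ?_
  refine Eq.trans ?_ (act_vunit _).symm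
  exact vunit_vcomp_aux k P.ν_compNat

/-- The counit of `P^∧` is compatible with pairings. -/
theorem wedgeε_pairing {M N K : Word X ⥤ V} (j : Pairing M N K) (a b : Word X) :
    (wedgePairing P.obj j).app a b ≫ (P.wedgeε.app K).app (a ⊗ b) =
      ((P.wedgeε.app M).app a ⊗ₘ (P.wedgeε.app N).app b) ≫ j.app a b :=
  vpair_counit_aux (F := (bigP P.obj).obj a) (G := (bigP P.obj).obj b) j (P.ident a)
    (P.ident b)

/-- The counit of `P^∧` is compatible with the unit pairings. -/
theorem wedgeε_unit {K : Word X ⥤ V} (k : 𝟙_ V ⟶ K.obj (𝟙_ _)) :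
    vunit k ≫ (P.wedgeε.app K).app Word.unit = k := by
  change vunit k ≫ (ρ_ _).inv ≫ act (𝟙 (vhom (𝟙_ (SMod V X)).functor K)) (ν (Word X) V) = k
  rw [rightUnitor_inv_naturality_assoc, ← act_comp_left, Category.comp_id, act_vunit,
    ← unitors_inv_equal]
  simp

end OperadData

/-! ### The operad laws for operations with several outputs -/

/-- The pairings `vpair` are natural in the target of the pairing. -/
theorem vpair_map {F G : SMod V X} {M N K K' : Word X ⥤ V} (j : Pairing M N K)
    (j' : Pairing M N K') (k : K ⟶ K') (h : ∀ x y, j.app x y ≫ k.app (x ⊗ y) = j'.app x y) :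
    vpair (F := F) (G := G) j ≫ vmap (𝟙 (F ⊗ G).functor) k = vpair j' := by
  have h := vpair_natural j j' (𝟙 F) (𝟙 G) (𝟙 M) (𝟙 N) k (fun x y ↦ by simp [h])
  rw [id_tensorHom_id, vmap_id_day, vmap_id_day, id_tensorHom_id, Category.id_comp] at h
  exact h.symm

theorem act_vcomp_whisker {A B C : Word X ⥤ V} {Z Z' D : V} {x : Word X} (f : Z ⟶ vhom B C)
    (g : Z' ⟶ vhom A B) (a : D ⟶ A.obj x) :
    act ((f ▷ _) ≫ (_ ◁ g) ≫ vcomp A B C) a = (α_ _ _ _).hom ≫ act f (act g a) := by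
  rw [← act_vcomp, MonoidalCategory.tensorHom_def, Category.assoc]

/-- Evaluating a family of natural transformations at an element. -/
theorem comp_counit {A K : Word X ⥤ V} {Z : V} {x : Word X} (f : Z ⟶ vhom A K)
    (a : 𝟙_ V ⟶ A.obj x) :
    f ≫ (ρ_ _).inv ≫ act (𝟙 (vhom A K)) a = (ρ_ _).inv ≫ act f a := by
  rw [rightUnitor_inv_naturality_assoc, ← act_comp_left, Category.comp_id]

namespace OperadData

variable (P : OperadData V X)

/-- The comultiplication of `P^∧`, on objects of the Day convolution category. -/
def dayΔ (F : SMod V X) :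
    (wedgeDay P.obj).obj F ⟶ (wedgeDay P.obj).obj ((wedgeDay P.obj).obj F) :=
  ⟨P.wedgeΔ.app F.functor⟩

theorem vpair_map_wedgeDayμ (F G : SMod V X) (a b : Word X) :
    vpair (F := (bigP P.obj).obj a) (G := (bigP P.obj).obj b)
        (dayPairing ((wedgeDay P.obj).obj F) ((wedgeDay P.obj).obj G)) ≫
        vmap (𝟙 _) (wedgeDayμ P.obj F G).natTrans =
      (wedgePairing P.obj (wedgePairing P.obj (dayPairing F G))).app a b := by
  exact vpair_map (F := (bigP P.obj).obj a) (G := (bigP P.obj).obj b) _ _ _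
    (fun x y ↦ dayι_wedgeDayμ P.obj F G x y)

/-- The comultiplication is compatible with the tensorator of `P^∧`. -/
theorem dayΔ_tensor (F G : SMod V X) :
    wedgeDayμ P.obj F G ≫ P.dayΔ (F ⊗ G) =
      (P.dayΔ F ⊗ₘ P.dayΔ G) ≫ wedgeDayμ P.obj _ _ ≫
        (wedgeDay P.obj).map (wedgeDayμ P.obj F G) := by
  refine tensor_hom_ext (fun a b ↦ ?_)
  change dayι _ _ a b ≫ _ = dayι _ _ a b ≫ _
  rw [← Category.assoc (P.dayΔ F ⊗ₘ P.dayΔ G), natTrans_comp, natTrans_comp,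
    reassoc_of% dayι_wedgeDayμ]
  have h := dayι_tensorHom_wedgeDayμ P.obj (P.dayΔ F) (P.dayΔ G) a b
  rw [reassoc_of% h]
  refine (P.wedgeΔ_pairing (dayPairing F G) a b).trans ?_
  exact (congrArg (fun t ↦ (P.wedgeΔApp F.functor a ⊗ₘ P.wedgeΔApp G.functor b) ≫ t)
    (P.vpair_map_wedgeDayμ F G a b).symm).trans (Category.assoc _ _ _).symm

/-- The comultiplication is compatible with the unit of `P^∧`. -/
theorem dayΔ_unit : wedgeDayε P.obj ≫ P.dayΔ (𝟙_ _) =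
    wedgeDayε P.obj ≫ (wedgeDay P.obj).map (wedgeDayε P.obj) := by
  refine unit_hom_ext ?_
  rw [natTrans_comp, natTrans_comp, reassoc_of% ν_wedgeDayε]
  refine (P.wedgeΔ_unit _).trans ?_
  refine Eq.trans ?_ ((congrArg (· ≫ ((wedgeDay P.obj).map (wedgeDayε P.obj)).natTrans.app _)
    (ν_wedgeDayε P.obj)).symm.trans (Category.assoc _ _ _))
  exact (vunit_natural (ν (Word X) V) (wedgeDayε P.obj).natTrans (ν_wedgeDayε P.obj)).symm

/-- The counit of `P^∧`, on objects of the Day convolution category. -/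
def dayCounit (F : SMod V X) : (wedgeDay P.obj).obj F ⟶ F :=
  ⟨P.wedgeε.app F.functor⟩

/-- The counit is compatible with the tensorator of `P^∧`. -/
theorem wedgeDayμ_dayCounit (F G : SMod V X) :
    wedgeDayμ P.obj F G ≫ P.dayCounit (F ⊗ G) = P.dayCounit F ⊗ₘ P.dayCounit G := by
  refine tensor_hom_ext (fun a b ↦ ?_)
  change dayι _ _ a b ≫ _ = dayι _ _ a b ≫ _
  rw [natTrans_comp, reassoc_of% dayι_wedgeDayμ, dayι_map]
  exact P.wedgeε_pairing (dayPairing F G) a b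

theorem wedgeDayε_dayCounit : wedgeDayε P.obj ≫ P.dayCounit (𝟙_ _) = 𝟙 _ := by
  refine unit_hom_ext ?_
  rw [natTrans_comp, reassoc_of% ν_wedgeDayε, natTrans_id]
  exact (P.wedgeε_unit _).trans (Category.comp_id _).symm

/-- If `f` and `g` are coassociative coactions of `P^∧`, then so is their tensor product. -/
theorem coassoc_tensor {A B : SMod V X} {f : A ⟶ (wedgeDay P.obj).obj A}
    {g : B ⟶ (wedgeDay P.obj).obj B} (hf : f ≫ (wedgeDay P.obj).map f = f ≫ P.dayΔ A)
    (hg : g ≫ (wedgeDay P.obj).map g = g ≫ P.dayΔ B) :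
    ((f ⊗ₘ g) ≫ wedgeDayμ P.obj A B) ≫ (wedgeDay P.obj).map ((f ⊗ₘ g) ≫ wedgeDayμ P.obj A B) =
      ((f ⊗ₘ g) ≫ wedgeDayμ P.obj A B) ≫ P.dayΔ (A ⊗ B) := by
  have h := wedgeDayμ_natural P.obj f g
  rw [Category.assoc, Category.assoc, P.dayΔ_tensor, Functor.map_comp, ← reassoc_of% h,
    tensorHom_comp_tensorHom_assoc, tensorHom_comp_tensorHom_assoc, hf, hg]

/-- If `f` and `g` are counital coactions of `P^∧`, then so is their tensor product. -/
theorem counit_tensor {A B : SMod V X} {f : A ⟶ (wedgeDay P.obj).obj A}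
    {g : B ⟶ (wedgeDay P.obj).obj B} (hf : f ≫ P.dayCounit A = 𝟙 A)
    (hg : g ≫ P.dayCounit B = 𝟙 B) :
    ((f ⊗ₘ g) ≫ wedgeDayμ P.obj A B) ≫ P.dayCounit (A ⊗ B) = 𝟙 _ := by
  rw [Category.assoc, P.wedgeDayμ_dayCounit, tensorHom_comp_tensorHom, hf, hg, id_tensorHom_id]

theorem act_mulT (y : X) (z x : Word X) {D : V}
    (a : D ⟶ ((bigP P.obj).obj z).functor.obj x) :
    act (A := ((bigP P.obj).obj z).functor) (K := (P.obj y).functor)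
      ((P.mulT y).natTrans.app z) a = (_ ◁ a) ≫ P.mul y z x :=
  act_vlift _ _

end OperadData

namespace Operad

variable (P : Operad V X)

theorem mulT_assoc_aux (y : X) (z x : Word X) :
    P.mul y z x ≫ (P.mulT y).natTrans.app x =
      ((P.mulT y).natTrans.app z ▷ _) ≫ (_ ◁ (P.compNat z).app x) ≫
        vcomp ((bigP P.obj).obj x).functor ((bigP P.obj).obj z).functor (P.obj y).functor := by
  refine act_ext (fun t ↦ ?_)
  refine (act_comp_left _ _ _).trans ?_
  refine Eq.trans ?_ (act_vcomp_whisker ((P.mulT y).natTrans.app z) ((P.compNat z).app x)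
    (𝟙 (((bigP P.obj).obj x).functor.obj t))).symm
  refine (congrArg (fun s ↦ (P.mul y z x ▷ _) ≫ s) (P.act_mulT y x t _)).trans ?_
  refine Eq.trans ?_ (congrArg (fun s ↦ (α_ _ _ _).hom ≫ s) (P.act_mulT y z t _)).symm
  -- On operations this is the associativity of the composition.
  rw [MonoidalCategory.whiskerLeft_id, Category.id_comp]
  exact P.mul_assoc y z x t

/-- The associativity of an operad, as coassociativity of the coaction of `P^∧` on `P(-; y)`. -/
theorem mulT_assoc (y : X) :
    P.mulT y ≫ (wedgeDay P.obj).map (P.mulT y) = P.mulT y ≫ P.dayΔ (P.obj y) := by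
  refine hom_ext (NatTrans.ext (funext fun z ↦ ?_))
  rw [natTrans_comp, natTrans_comp]
  refine act_ext (fun x ↦ ?_)
  refine (act_vmap _ (𝟙 _) (P.mulT y).natTrans _).trans ?_
  refine Eq.trans ?_ (act_comp_left _ _ _).symm
  refine Eq.trans ?_ (congrArg (fun s ↦ ((P.mulT y).natTrans.app z ▷ _) ≫ s)
    (P.act_wedgeΔApp_id (P.obj y).functor z x)).symm
  refine Eq.trans ?_ (P.mulT_assoc_aux y z x)
  refine congrArg (· ≫ (P.mulT y).natTrans.app x) ?_
  refine (congrArg (act _) (Category.comp_id _)).trans ((P.act_mulT y z x _).trans ?_)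
  exact (congrArg (· ≫ P.mul y z x) (MonoidalCategory.whiskerLeft_id _ _)).trans
    (Category.id_comp _)

/-- The composition of operations with several outputs is associative: `P(-; w)` is a coassociative
coaction of `P^∧`. -/
theorem compT_assoc (w : Word X) :
    P.compT.app w ≫ (wedgeDay P.obj).map (P.compT.app w) =
      P.compT.app w ≫ P.dayΔ ((bigP P.obj).obj w) := by
  induction w with
  | of y => exact P.mulT_assoc y
  | unit =>
    rw [P.compT_unit]
    exact P.dayΔ_unit.symm
  | tensor a b ha hb =>
    rw [P.compT_tensor]
    exact P.coassoc_tensor ha hb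

/-- The right unit law of an operad, as counitality of the coaction of `P^∧` on `P(-; y)`. -/
theorem mulT_dayCounit (y : X) : P.mulT y ≫ P.dayCounit (P.obj y) = 𝟙 _ := by
  refine hom_ext (NatTrans.ext (funext fun z ↦ ?_))
  rw [natTrans_comp]
  refine (comp_counit ((P.mulT y).natTrans.app z) (P.ident z)).trans ?_
  refine (congrArg (fun s ↦ (ρ_ _).inv ≫ s) ((P.act_mulT y z z _).trans (P.mul_one y z))).trans ?_
  exact Iso.inv_hom_id _

/-- The right unit law for operations with several outputs. -/
theorem compT_dayCounit (w : Word X) : P.compT.app w ≫ P.dayCounit ((bigP P.obj).obj w) = 𝟙 _ := by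
  induction w with
  | of y => exact P.mulT_dayCounit y
  | unit =>
    rw [P.compT_unit]
    exact P.wedgeDayε_dayCounit
  | tensor a b ha hb =>
    rw [P.compT_tensor]
    exact P.counit_tensor ha hb

theorem ident_compNat_aux {A B : SMod V X} {A' B' : SMod V X} {a b : Word X}
    (i : 𝟙_ V ⟶ A.functor.obj a) (i' : 𝟙_ V ⟶ B.functor.obj b)
    {f : A ⟶ (wedgeDay P.obj).obj A'} {g : B ⟶ (wedgeDay P.obj).obj B'} :
    dayElt i i' ≫ ((f ⊗ₘ g) ≫ wedgeDayμ P.obj A' B').natTrans.app (a ⊗ b) =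
      (λ_ _).inv ≫ ((i ≫ f.natTrans.app a) ⊗ₘ (i' ≫ g.natTrans.app b)) ≫
        vpair (F := (bigP P.obj).obj a) (G := (bigP P.obj).obj b) (dayPairing A' B') := by
  rw [dayElt, Category.assoc, Category.assoc, dayι_tensorHom_wedgeDayμ]
  exact congrArg (fun s ↦ (λ_ _).inv ≫ s) (tensorHom_comp_tensorHom_assoc _ _ _ _ _)

/-- The left unit law for operations with several outputs: composing with the identity of `w` is
the identity transformation. -/
theorem ident_compNat (w : Word X) :
    P.ident w ≫ (P.compNat w).app w = vid ((bigP P.obj).obj w).functor := by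
  induction w with
  | of y =>
    refine act_ext (fun x ↦ ?_)
    refine (act_comp_left _ _ _).trans ?_
    refine (congrArg (fun s ↦ (P.one y ▷ _) ≫ s) (P.act_mulT y (Word.of y) x _)).trans ?_
    refine Eq.trans ?_ (act_vid _).symm
    rw [MonoidalCategory.whiskerLeft_id, Category.id_comp]
    exact (P.one_mul y x).trans (Category.comp_id _).symm
  | unit => exact P.ν_compNat.trans vunit_ν
  | tensor a b ha hb =>
    refine (congrArg (fun t ↦ dayElt (P.ident a) (P.ident b) ≫ (Hom.natTrans t).app (a ⊗ b))
      (P.compT_tensor a b)).trans ?_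
    refine (P.ident_compNat_aux (P.ident a) (P.ident b)).trans ?_
    refine Eq.trans ?_ (vpair_vid ((bigP P.obj).obj a) ((bigP P.obj).obj b))
    exact congrArg₂ (fun s t ↦ (λ_ (𝟙_ V)).inv ≫ (s ⊗ₘ t) ≫ vpair (dayPairing _ _)) ha hb

end Operad

/-! ### The comonad of an operad -/

/-- The associativity of the composition of natural transformations, for families `c` and `d` whose
composite is the family `e` after a composition law `f`. -/
theorem vcomp_vcomp_aux {A B C N : Word X ⥤ V} {D E F : V} {c : E ⟶ vhom A B}
    {d : D ⟶ vhom B C} {f : D ⊗ E ⟶ F} {e : F ⟶ vhom A C}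
    (h : f ≫ e = (d ▷ _) ≫ (_ ◁ c) ≫ vcomp A B C) :
    (((vhom C N ◁ d) ≫ vcomp B C N) ▷ E) ≫ (_ ◁ c) ≫ vcomp A B N =
      (α_ _ _ _).hom ≫ (_ ◁ f) ≫ (_ ◁ e) ≫ vcomp A C N := by
  rw [← MonoidalCategory.whiskerLeft_comp_assoc, h, comp_whiskerRight, Category.assoc,
    ← whisker_exchange_assoc, vcomp_assoc]
  simp

/-- Precomposition with a family containing the identity, at the identity. -/
theorem vcomp_vid_left {A N : Word X ⥤ V} {D : V} {i : 𝟙_ V ⟶ D} {c : D ⟶ vhom A A}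
    (h : i ≫ c = vid A) :
    (ρ_ _).inv ≫ (vhom A N ◁ i) ≫ (_ ◁ c) ≫ vcomp A A N = 𝟙 _ := by
  refine act_ext (fun x ↦ ?_)
  have h1 := act_vcomp (𝟙 (vhom A N)) (vid A) (𝟙 (A.obj x))
  rw [id_tensorHom, act_vid, act_comp_right] at h1
  rw [← MonoidalCategory.whiskerLeft_comp_assoc, h, act_comp_left, h1]
  simp

/-- Evaluating a composite of natural transformations at an element `i`, when `c` acts on `i` by
`d`. -/
theorem vcomp_counit {A B N : Word X ⥤ V} {D : V} {x : Word X} (c : D ⟶ vhom A B)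
    (i : 𝟙_ V ⟶ A.obj x) {d : D ⟶ B.obj x} (h : c ≫ (ρ_ _).inv ≫ act (𝟙 _) i = d) :
    ((vhom B N ◁ c) ≫ vcomp A B N) ≫ (ρ_ _).inv ≫ act (𝟙 (vhom A N)) i =
      act (𝟙 (vhom B N)) d := by
  have h1 := act_vcomp (𝟙 (vhom B N)) c i
  rw [id_tensorHom] at h1
  rw [comp_counit, h1]
  rw [comp_counit] at h
  rw [← h, act_comp_right]
  simp

namespace Operad

variable (P : Operad V X)

/-- The associativity of the composition of operations with several outputs, in terms of the
transformations by which operations act. -/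
theorem comp_compNat (w z x : Word X) :
    P.comp w z x ≫ (P.compNat w).app x =
      ((P.compNat w).app z ▷ _) ≫ (_ ◁ (P.compNat z).app x) ≫
        vcomp ((bigP P.obj).obj x).functor ((bigP P.obj).obj z).functor
          ((bigP P.obj).obj w).functor := by
  have h := congrArg (fun t ↦ act (A := ((bigP P.obj).obj z).functor)
    (K := wedgeObj P.obj ((bigP P.obj).obj w).functor) ((Hom.natTrans t).app z)
    (𝟙 (((bigP P.obj).obj z).functor.obj x))) (P.compT_assoc w)
  refine Eq.trans ?_ (h.trans ?_)
  · refine Eq.trans ?_ (act_vmap ((P.compNat w).app z) (𝟙 _) (P.compNat w) _).symm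
    refine congrArg (· ≫ (P.compNat w).app x) ?_
    exact (congrArg (act _) (Category.comp_id _)).symm
  · refine (act_comp_left _ _ _).trans ?_
    exact congrArg (fun t ↦ ((P.compNat w).app z ▷ _) ≫ t)
      (P.act_wedgeΔApp_id ((bigP P.obj).obj w).functor z x)

theorem compNat_counit (w x : Word X) :
    (P.compNat w).app x ≫ (ρ_ _).inv ≫
      act (𝟙 (vhom ((bigP P.obj).obj x).functor ((bigP P.obj).obj w).functor)) (P.ident x) =
      𝟙 _ :=
  congrArg (fun t ↦ (Hom.natTrans t).app x) (P.compT_dayCounit w)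

/-- The comonad `N ↦ ∫_x [P(x; -), N x]`. -/
def wedgeComonad : Comonad (Word X ⥤ V) where
  toFunctor := wedge P.obj
  ε := P.wedgeε
  δ := P.wedgeΔ
  coassoc N := by
    refine NatTrans.ext (funext fun w ↦ ?_)
    refine act_ext (fun z ↦ ?_)
    refine (act_vmap (P.wedgeΔApp N w) (𝟙 _) (P.wedgeΔ.app N) _).trans ?_
    refine Eq.trans ?_ (act_comp_left (P.wedgeΔApp N w) (P.wedgeΔApp (wedgeObj P.obj N) w) _).symm
    refine Eq.trans ?_ (congrArg (fun s ↦ (P.wedgeΔApp N w ▷ _) ≫ s)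
      (P.act_wedgeΔApp_id (wedgeObj P.obj N) w z)).symm
    refine (congrArg (· ≫ P.wedgeΔApp N z) ((congrArg (act _) (Category.comp_id _)).trans
      (P.act_wedgeΔApp_id N w z))).trans ?_
    refine act_ext (fun x ↦ ?_)
    refine (act_comp_left _ _ _).trans ?_
    refine (congrArg (fun s ↦ (((vhom ((bigP P.obj).obj w).functor N ◁ (P.compNat w).app z) ≫
      vcomp ((bigP P.obj).obj z).functor ((bigP P.obj).obj w).functor N) ▷ _) ≫ s)
        (P.act_wedgeΔApp_id N z x)).trans ?_
    refine Eq.trans ?_ (act_vcomp_whisker (P.wedgeΔApp N w) ((P.compNat w).app z)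
      (𝟙 (((bigP P.obj).obj z).functor.obj x))).symm
    refine Eq.trans ?_ (congrArg (fun s ↦ (α_ _ _ _).hom ≫ s) (P.act_wedgeΔApp N w x _)).symm
    exact vcomp_vcomp_aux (P.comp_compNat w z x)
  left_counit N := by
    refine NatTrans.ext (funext fun w ↦ ?_)
    refine (comp_counit (P.wedgeΔApp N w) (P.ident w)).trans ?_
    refine (congrArg (fun s ↦ (ρ_ _).inv ≫ s) (P.act_wedgeΔApp N w w (P.ident w))).trans ?_
    exact vcomp_vid_left (P.ident_compNat w)
  right_counit N := by
    refine NatTrans.ext (funext fun w ↦ ?_)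
    refine act_ext (fun x ↦ ?_)
    refine (act_vmap (P.wedgeΔApp N w) (𝟙 _) (P.wedgeε.app N) _).trans ?_
    refine (congrArg (· ≫ (P.wedgeε.app N).app x) ((congrArg (act _) (Category.comp_id _)).trans
      (P.act_wedgeΔApp_id N w x))).trans ?_
    exact vcomp_counit _ (P.ident x) (P.compNat_counit w x)

end Operad

/-! ### The lax comonad of an operad -/

section Monoidality

variable (P : OperadData V X)

/-- The comultiplication of `P^∧` is monoidal at lax monoidal functors. -/
instance wedgeΔ_isMonoidal (N : Word X ⥤ V) [N.LaxMonoidal] :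
    NatTrans.IsMonoidal (F₁ := (wedge P.obj).obj N)
      (F₂ := (wedge P.obj).obj ((wedge P.obj).obj N)) (P.wedgeΔ.app N) where
  unit := P.wedgeΔ_unit (Functor.LaxMonoidal.ε N)
  tensor a b := P.wedgeΔ_pairing (laxPairing N) a b

/-- The counit of `P^∧` is monoidal at lax monoidal functors. -/
instance wedgeε_isMonoidal (N : Word X ⥤ V) [N.LaxMonoidal] :
    NatTrans.IsMonoidal (F₁ := (wedge P.obj).obj N) (F₂ := N) (P.wedgeε.app N) where
  unit := P.wedgeε_unit (Functor.LaxMonoidal.ε N)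
  tensor a b := P.wedgeε_pairing (laxPairing N) a b

variable (N : Word X ⥤ V) [N.LaxBraided]

theorem powS_isMonoidal : ∀ (n : ℕ) (i : Fin n),
    NatTrans.IsMonoidal (F₁ := (pow (wedge P.obj) n).obj N)
      (F₂ := (pow (wedge P.obj) (n + 1)).obj N) ((powS P.wedgeΔ n i).app N)
  | 0, i => i.elim0
  | n + 1, i => by
    induction i using Fin.cases with
    | zero =>
      have h := powS_zero_app P.wedgeΔ n N
      rw [h]
      exact wedgeΔ_isMonoidal P ((pow (wedge P.obj) n).obj N)
    | succ i =>
      have := powS_isMonoidal n i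
      exact wedge_map_isMonoidal P.obj (N := (pow (wedge P.obj) n).obj N)
        (N' := (pow (wedge P.obj) (n + 1)).obj N) ((powS P.wedgeΔ n i).app N)

theorem powD_isMonoidal : ∀ (n : ℕ) (i : Fin (n + 1)),
    NatTrans.IsMonoidal (F₁ := (pow (wedge P.obj) (n + 1)).obj N)
      (F₂ := (pow (wedge P.obj) n).obj N) ((powD P.wedgeε n i).app N)
  | 0, i => wedgeε_isMonoidal P N
  | n + 1, i => by
    induction i using Fin.cases with
    | zero =>
      have h := powD_zero_app P.wedgeε (n + 1) N
      rw [h]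
      exact wedgeε_isMonoidal P ((pow (wedge P.obj) (n + 1)).obj N)
    | succ i =>
      have := powD_isMonoidal n i
      exact wedge_map_isMonoidal P.obj (N := (pow (wedge P.obj) (n + 1)).obj N)
        (N' := (pow (wedge P.obj) n).obj N) ((powD P.wedgeε n i).app N)

theorem powAdd_isMonoidal {m n k : ℕ} (h : m + n = k) :
    NatTrans.IsMonoidal (F₁ := (pow (wedge P.obj) n).obj ((pow (wedge P.obj) m).obj N))
      (F₂ := (pow (wedge P.obj) k).obj N) ((powAdd (wedge P.obj) h).app N) := by
  induction n generalizing k with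
  | zero =>
    obtain rfl : m = k := h
    have h2 := powAdd_zero_app (T := wedge P.obj) (m := m) rfl N
    rw [h2]
    exact inferInstanceAs (NatTrans.IsMonoidal (𝟙 ((pow (wedge P.obj) m).obj N)))
  | succ n ih =>
    subst h
    have h2 := powAdd_succ_app (T := wedge P.obj) (rfl : m + n = m + n) rfl N
    have := ih (rfl : m + n = m + n)
    have h3 := wedge_map_isMonoidal P.obj
      (N := (pow (wedge P.obj) n).obj ((pow (wedge P.obj) m).obj N))
      (N' := (pow (wedge P.obj) (m + n)).obj N) ((powAdd (wedge P.obj) (rfl : m + n = m + n)).app N)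
    rw [h2]
    exact h3

/-- The transformation `ε π M ⟶ M` is the identity for `M = ε C`, since a monoidal transformation
out of a free symmetric monoidal functor is determined on letters. -/
theorem kap_epsF (C : X → V) : kap ((epsF V X).obj C) = 𝟙 _ :=
  letI g : Word.lift C ⟶ Word.lift C := kap ((epsF V X).obj C)
  have : g.IsMonoidal := kap_isMonoidal ((epsF V X).obj C)
  Word.lift_hom_ext (φ := C) g (𝟙 (Word.lift C)) (fun _ ↦ rfl)

end Monoidality

/-- The functors `π (P^∧)ⁿ ε` form a lax comonad. The identities between structure maps are those
of the powers of the comonad `P^∧`; the inner naturality and the associativity of the lax structure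
use in addition that the transformations involved are monoidal, so that `ε π M ⟶ M` is natural with
respect to them. -/
theorem isLaxComonad_hat (P : Operad V X) : IsLaxComonad (hat P.toOperadData) where
  d_d n i j h := by
    ext C : 2
    exact congrArg (piF V X).map (powD_powD P.wedgeComonad n i j h ((epsF V X).obj C))
  s_s n i j h := by
    ext C : 2
    exact congrArg (piF V X).map (powS_powS P.wedgeComonad n i j h ((epsF V X).obj C))
  s_d_self n j := by
    ext C : 2
    exact congrArg (piF V X).map (powS_powD_self P.wedgeComonad n j ((epsF V X).obj C))
  s_d_succ n j := by
    ext C : 2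
    exact congrArg (piF V X).map (powS_powD_succ P.wedgeComonad n j ((epsF V X).obj C))
  s_d_lt n i j h := by
    ext C : 2
    exact congrArg (piF V X).map (powS_powD_lt P.wedgeComonad n i j h ((epsF V X).obj C))
  s_d_gt n i j h := by
    ext C : 2
    exact congrArg (piF V X).map (powS_powD_gt P.wedgeComonad n i j h ((epsF V X).obj C))
  α_s_outer {m n k} h h' i i' hi := by
    ext C : 2
    refine congrArg (piF V X).map (?_ : _ ≫ _ ≫ _ = (_ ≫ _) ≫ _)
    refine (NatTrans.naturality_assoc (powS P.wedgeΔ n i) _ _).symm.trans ?_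
    refine Eq.trans ?_ (Category.assoc _ _ _).symm
    exact congrArg (_ ≫ ·)
      (powAdd_powS_outer P.wedgeComonad h h' i i' hi ((epsF V X).obj C))
  α_s_inner {m n k} h h' i i' hi := by
    ext C : 2
    have := powS_isMonoidal P.toOperadData ((epsF V X).obj C) m i
    exact hat_aux (M := (pow (wedge P.obj) m).obj ((epsF V X).obj C))
      (M' := (pow (wedge P.obj) (m + 1)).obj ((epsF V X).obj C))
      ((powS P.wedgeΔ m i).app ((epsF V X).obj C)) (pow (wedge P.obj) n) _ _ _
      (powAdd_powS_inner P.wedgeComonad h h' i i' hi ((epsF V X).obj C))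
  α_d_outer {m n k} h h' i i' hi := by
    ext C : 2
    refine congrArg (piF V X).map (?_ : _ ≫ _ ≫ _ = (_ ≫ _) ≫ _)
    refine (NatTrans.naturality_assoc (powD P.wedgeε n i) _ _).symm.trans ?_
    refine Eq.trans ?_ (Category.assoc _ _ _).symm
    exact congrArg (_ ≫ ·)
      (powAdd_powD_outer P.wedgeComonad h h' i i' hi ((epsF V X).obj C))
  α_d_inner {m n k} h h' i i' hi := by
    ext C : 2
    have := powD_isMonoidal P.toOperadData ((epsF V X).obj C) m i
    exact hat_aux (M := (pow (wedge P.obj) (m + 1)).obj ((epsF V X).obj C))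
      (M' := (pow (wedge P.obj) m).obj ((epsF V X).obj C))
      ((powD P.wedgeε m i).app ((epsF V X).obj C)) (pow (wedge P.obj) n) _ _ _
      (powAdd_powD_inner P.wedgeComonad h h' i i' hi ((epsF V X).obj C))
  α_assoc {l m n a b k} h₁ h₂ h₃ h₄ := by
    ext C : 2
    refine Eq.trans ?_ (Category.id_comp _).symm
    let T := wedge P.obj
    let E := (epsF V X).obj C
    let M : Word X ⥤ V := (epsF V X).obj ((piF V X).obj ((pow T l).obj E))
    have h1 : NatTrans.IsMonoidal (F₁ := (pow T m).obj M) (F₂ := (pow T m).obj ((pow T l).obj E))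
        ((pow T m).map (kap ((pow T l).obj E))) :=
      pow_map_isMonoidal P.toOperadData (kap ((pow T l).obj E)) m
    have h2 := powAdd_isMonoidal P.toOperadData E h₁
    have h3 : NatTrans.IsMonoidal (F₁ := (pow T m).obj M) (F₂ := (pow T a).obj E)
        ((pow T m).map (kap ((pow T l).obj E)) ≫ (powAdd T h₁).app E) :=
      inferInstance
    refine hat_aux (M := (pow T m).obj M) (M' := (pow T a).obj E)
      ((pow T m).map (kap ((pow T l).obj E)) ≫ (powAdd T h₁).app E) (pow T n)
      ((powAdd T h₃).app M) ((powAdd T h₂).app E)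
      ((pow T b).map (kap ((pow T l).obj E)) ≫ (powAdd T h₄).app E) ?_
    rw [Functor.map_comp, Category.assoc, powAdd_assoc T h₁ h₂ h₃ h₄]
    exact (powAdd T h₃).naturality_assoc (kap ((pow T l).obj E)) ((powAdd T h₄).app E)
  η_inner {n} h := by
    ext C : 2
    refine (congrArg (· ≫ _) ((hatQ P.toOperadData n).map_id C)).trans ?_
    refine (Category.id_comp _).trans ?_
    change (piF V X).map ((pow (wedge P.obj) n).map
      (kap ((pow (wedge P.obj) 0).obj ((epsF V X).obj C))) ≫
        (powAdd (wedge P.obj) h).app ((epsF V X).obj C)) =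
      (piF V X).map (𝟙 ((pow (wedge P.obj) n).obj ((epsF V X).obj C)))
    refine congrArg (piF V X).map ?_
    refine (congrArg₂ (· ≫ ·) ((congrArg (pow (wedge P.obj) n).map (kap_epsF C)).trans
      ((pow (wedge P.obj) n).map_id _)) (powAdd_zero_left_app h _)).trans ?_
    exact Category.id_comp _
  η_outer {n} h := by
    ext C : 2
    refine (Category.id_comp _).trans ?_
    refine (congrArg (piF V X).map
      (congrArg (_ ≫ ·) (powAdd_zero_app (T := wedge P.obj) h _))).trans ?_
    refine (congrArg (piF V X).map
      (Category.comp_id (kap ((pow (wedge P.obj) n).obj ((epsF V X).obj C))))).trans ?_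
    rfl

end

/-! ### Preservation of towers by the functors of the lax comonad -/

section Families

variable {C : Type u₁} [Category.{v₁} C] {Y : Type v} {D : Type u₂} [Category.{v₂} D]

theorem mono_family {A B : Y → D} (f : A ⟶ B) (h : ∀ y, Mono (f y)) : Mono f where
  right_cancellation _ _ hgk := funext fun y ↦ (cancel_mono (f y)).1 (congrFun hgk y)

/-- Functors with values in a category of families preserve towers if they do so for each
index. -/
theorem PreservesTowers.of_eval {G : C ⥤ (Y → D)}
    (h : ∀ y, PreservesTowers (G ⋙ Pi.eval (fun _ ↦ D) y)) : PreservesTowers G where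
  mono f hf := mono_family _ fun y ↦ (h y).mono f hf
  lim F hF := by
    have (y : Y) := (h y).lim F hF
    refine ⟨fun {c} hc ↦ ⟨?_⟩⟩
    let l (y : Y) := isLimitOfPreserves (G ⋙ Pi.eval (fun _ ↦ D) y) hc
    exact
      { lift := fun s y ↦ (l y).lift ((Pi.eval (fun _ ↦ D) y).mapCone s)
        fac := fun s j ↦ funext fun y ↦ (l y).fac ((Pi.eval (fun _ ↦ D) y).mapCone s) j
        uniq := fun s m w ↦ funext fun y ↦
          (l y).uniq ((Pi.eval (fun _ ↦ D) y).mapCone s) (m y) fun j ↦ congrFun (w j) y }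

instance preservesLimits_eval [HasLimitsOfSize.{0, 0} D] (y : Y) :
    PreservesLimitsOfSize.{0, 0} (Pi.eval (fun _ ↦ D) y) where
  preservesLimitsOfShape {J _} :=
    { preservesLimit := fun {F} ↦ by
        let c : Cone F :=
          { pt := fun y ↦ limit (F ⋙ Pi.eval (fun _ ↦ D) y)
            π :=
              { app := fun j y ↦ limit.π (F ⋙ Pi.eval (fun _ ↦ D) y) j
                naturality := fun _ _ f ↦ funext fun y ↦
                  (limit.cone (F ⋙ Pi.eval (fun _ ↦ D) y)).π.naturality f } }
        have hc : IsLimit c :=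
          { lift := fun s y ↦ limit.lift (F ⋙ Pi.eval (fun _ ↦ D) y)
              ((Pi.eval (fun _ ↦ D) y).mapCone s)
            fac := fun _ _ ↦ funext fun _ ↦ limit.lift_π _ _
            uniq := fun s _ w ↦ funext fun y ↦ limit.hom_ext fun j ↦
              (congrFun (w j) y).trans
                (limit.lift_π ((Pi.eval (fun _ ↦ D) y).mapCone s) j).symm }
        exact preservesLimit_of_preserves_limit_cone hc
          (limit.isLimit (F ⋙ Pi.eval (fun _ ↦ D) y)) }

end Families

section Tensor

variable {C : Type u₁} [Category.{v₁} C]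
variable {V : Type u} [Category.{v} V] [MonoidalCategory V] [SymmetricCategory V]

/-- Tensoring with an object preserves the monomorphisms and the limits of towers of monomorphisms. -/
def TensorPreservesTowers (V : Type u) [Category.{v} V] [MonoidalCategory V] : Prop :=
  ∀ A : V, PreservesTowers (tensorLeft A)

theorem TensorPreservesTowers.right (hV : TensorPreservesTowers V) (A : V) :
    PreservesTowers (tensorRight A) :=
  .of_iso (BraidedCategory.tensorLeftIsoTensorRight A) (hV A)

theorem TensorPreservesTowers.mono_tensorHom (hV : TensorPreservesTowers V) {A A' B B' : V}
    (f : A ⟶ A') (g : B ⟶ B') [Mono f] [Mono g] : Mono (f ⊗ₘ g) := by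
  have h1 : Mono (f ▷ B) := (hV.right B).mono f inferInstance
  have h2 : Mono (A' ◁ g) := (hV A').mono g inferInstance
  rw [MonoidalCategory.tensorHom_def]
  infer_instance

/-- The tensor product of functors preserving towers preserves towers. The tensor product is given
by a functor `T` with natural isomorphisms `T c ≅ G c ⊗ H c`. -/
theorem PreservesTowers.tensor (hV : TensorPreservesTowers V) {G H T : C ⥤ V}
    (hG : PreservesTowers G) (hH : PreservesTowers H)
    (e : ∀ c, T.obj c ≅ G.obj c ⊗ H.obj c)
    (he : ∀ {c d : C} (f : c ⟶ d), T.map f ≫ (e d).hom = (e c).hom ≫ (G.map f ⊗ₘ H.map f)) :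
    PreservesTowers T := by
  refine .of_iso (G := (G.prod' H) ⋙ MonoidalCategory.tensor V)
    (NatIso.ofComponents (fun c ↦ (e c).symm) fun {c d} f ↦ ?_) ?_
  · change (G.map f ⊗ₘ H.map f) ≫ (e d).inv = (e c).inv ≫ T.map f
    rw [Iso.comp_inv_eq, Category.assoc, he, Iso.inv_hom_id_assoc]
  · refine ⟨fun f hf ↦ ?_, fun F hF ↦ ⟨fun {c} hc ↦ ⟨?_⟩⟩⟩
    · have h1 := hG.mono f hf
      have h2 := hH.mono f hf
      exact hV.mono_tensorHom (G.map f) (H.map f)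
    · have := hG.lim F hF
      have := hH.lim F hF
      have := (hV.right (H.obj c.pt)).lim (F ⋙ G) (hF.comp hG)
      have (n : ℕᵒᵖ) := (hV (G.obj (F.obj n))).lim (F ⋙ H) (hF.comp hH)
      -- The diagonal of the double tower `G (F n) ⊗ H (F m)`.
      have key {Z : V} (f : ∀ n, Z ⟶ G.obj (F.obj n) ⊗ H.obj (F.obj n))
        (hf : ∀ {m n : ℕᵒᵖ} (u : m ⟶ n), f m ≫ (G.map (F.map u) ⊗ₘ H.map (F.map u)) = f n) :=
        existsUnique_lift_diagonal (curriedTensor V) (F₁ := F ⋙ G) (F₂ := F ⋙ H)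
          (c₁ := G.mapCone c) (c₂ := H.mapCone c)
          (isLimitOfPreserves (tensorRight (H.obj c.pt)) (isLimitOfPreserves G hc))
          (fun n ↦ isLimitOfPreserves (tensorLeft (G.obj (F.obj n))) (isLimitOfPreserves H hc))
          f (fun u ↦ by
            refine Eq.trans ?_ (hf u)
            rw [MonoidalCategory.tensorHom_def]
            rfl)
      refine IsLimit.ofExistsUnique fun s ↦ ?_
      obtain ⟨g, hg, hu⟩ := key (fun n ↦ s.π.app n) (fun u ↦ s.w u)
      refine ⟨g, fun n ↦ ?_, fun g' hg' ↦ hu g' fun n ↦ ?_⟩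
      · refine Eq.trans ?_ (hg n)
        change g ≫ (G.map (c.π.app n) ⊗ₘ H.map (c.π.app n)) = _
        rw [MonoidalCategory.tensorHom_def]
        rfl
      · refine Eq.trans ?_ (hg' n)
        change _ = g' ≫ (G.map (c.π.app n) ⊗ₘ H.map (c.π.app n))
        rw [MonoidalCategory.tensorHom_def]
        rfl

end Tensor

noncomputable section

variable {V : Type u} [Category.{v} V] [MonoidalCategory V] [SymmetricCategory V]
  [MonoidalClosed V] [HasLimits V] [HasColimits V] {X : Type v}

theorem tensorPreservesTowers (hV : CoreflectionHypothesis V) : TensorPreservesTowers V :=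
  fun A ↦
    { mono := fun f _ ↦ (hV.preservesMono A).preserves f
      lim := hV.preservesIntersection A }

/-- By induction on the word, `C ↦ C(x₁) ⊗ ⋯ ⊗ C(xₙ)` preserves towers. A constant functor
preserves them because `ℕᵒᵖ` is connected. -/
theorem preservesTowers_epsF (hV : TensorPreservesTowers V) : PreservesTowers (epsF V X) := by
  refine .of_evaluation fun w ↦ ?_
  have : HasLimitsOfSize.{0, 0} V := hasLimitsOfSizeShrink.{0, 0} V
  induction w with
  | of y =>
    exact .of_iso (G := Pi.eval (fun _ ↦ V) y) (Iso.refl _) (.of_preservesLimits _)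
  | unit =>
    refine .of_iso (G := (Functor.const _).obj (𝟙_ V)) (Iso.refl _) ⟨fun f hf ↦ ?_, fun F hF ↦ ?_⟩
    · exact inferInstanceAs (Mono (𝟙 _))
    · refine ⟨fun {c} _ ↦ ⟨IsLimit.ofExistsUnique fun s ↦ ?_⟩⟩
      have h (n : ℕᵒᵖ) : s.π.app n = s.π.app (Opposite.op 0) :=
        (Category.comp_id _).symm.trans (s.w (homOfLE (Nat.zero_le n.unop)).op)
      exact ⟨s.π.app (Opposite.op 0), fun n ↦ (Category.comp_id _).trans (h n).symm,
        fun g hg ↦ (Category.comp_id g).symm.trans (hg (Opposite.op 0))⟩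
  | tensor a b ha hb =>
    refine .tensor hV ha hb (fun C ↦ Iso.refl _) fun {C D} f ↦ ?_
    refine (Category.comp_id _).trans (Eq.trans ?_ (Category.id_comp _).symm)
    exact Category.comp_id _

/-- The functor `N ↦ ∫_x [A x, N x]`. -/
def vhomF (A : Word X ⥤ V) : (Word X ⥤ V) ⥤ V where
  obj N := vhom A N
  map k := vmap (𝟙 A) k
  map_id N := vmap_id A N
  map_comp k l := by rw [vmap_comp, Category.comp_id]

/-- The universal property of `vhom A N` as the adjunction of `vhomF A` with `Z ↦ Z ⊗ A`. -/
def vhomEquiv (A : Word X ⥤ V) (Z : V) (N : Word X ⥤ V) :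
    (A ⋙ tensorLeft Z ⟶ N) ≃ (Z ⟶ vhom A N) where
  toFun t := vlift t
  invFun f :=
    { app := fun x ↦ (f ▷ A.obj x) ≫ (vev A N).app x
      naturality := fun x y u ↦ by
        have h := (vev A N).naturality u
        dsimp at h ⊢
        rw [Category.assoc, ← h, whisker_exchange_assoc] }
  left_inv t := by
    ext x
    exact vlift_vev t x
  right_inv _ := vhom_ext fun x ↦ vlift_vev _ x

theorem vlift_comp {A N N' : Word X ⥤ V} {Z : V} (t : A ⋙ tensorLeft Z ⟶ N) (k : N ⟶ N') :
    vlift (t ≫ k) = vlift t ≫ vmap (𝟙 A) k := by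
  refine vhom_ext fun x ↦ ?_
  rw [vlift_vev, comp_whiskerRight_assoc, vmap_vev, NatTrans.id_app,
    MonoidalCategory.whiskerLeft_id, Category.id_comp, reassoc_of% vlift_vev t x]
  rfl

/-- The functor `N ↦ ∫_x [A x, N x]` is a right adjoint. -/
instance preservesLimits_vhomF (A : Word X ⥤ V) : PreservesLimitsOfSize.{0, 0} (vhomF A) :=
  (Adjunction.adjunctionOfEquivLeft (G := vhomF A) (vhomEquiv A)
    (fun _ _ _ k t ↦ vlift_comp t k)).rightAdjoint_preservesLimits

theorem preservesTowers_wedge (P : X → SMod V X) : PreservesTowers (wedge P) := by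
  refine .of_evaluation fun w ↦ ?_
  exact .of_iso (G := vhomF ((bigP P).obj w).functor) (Iso.refl _) (.of_preservesLimits _)

theorem preservesTowers_piF : PreservesTowers (piF V X) := by
  have : HasLimitsOfSize.{0, 0} V := hasLimitsOfSizeShrink.{0, 0} V
  refine .of_eval fun y ↦ ?_
  exact .of_iso (G := (evaluation (Word X) V).obj (Word.of y)) (Iso.refl _) (.of_preservesLimits _)

theorem preservesTowers_pow {C : Type u'} [Category.{v'} C] {T : C ⥤ C} (hT : PreservesTowers T) :
    ∀ n : ℕ, PreservesTowers (pow T n)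
  | 0 => .of_preservesLimits (𝟭 C)
  | n + 1 => (preservesTowers_pow hT n).comp hT

theorem preservesTowers_hatQ (hV : TensorPreservesTowers V) (P : OperadData V X) (n : ℕ) :
    PreservesTowers (hatQ P n) :=
  (preservesTowers_epsF hV).comp
    ((preservesTowers_pow (preservesTowers_wedge P.obj) n).comp preservesTowers_piF)

end

/-! ### Monomorphisms in the lax comonad -/

noncomputable section

open MonoidalCategory.DayFunctor

section Symmetric

variable {V : Type u} [Category.{v} V] [MonoidalCategory V] [SymmetricCategory V]

/-- In a symmetric monoidal category the interchange of the middle factors is an involution. -/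
theorem tensorμ_tensorμ (Z₁ Z₂ A₁ A₂ : V) :
    tensorμ Z₁ Z₂ A₁ A₂ ≫ tensorμ Z₁ A₁ Z₂ A₂ = 𝟙 _ := by
  have h : tensorμ Z₁ A₁ Z₂ A₂ = tensorδ Z₁ Z₂ A₁ A₂ := by
    rw [tensorμ, tensorδ, SymmetricCategory.braiding_swap_eq_inv_braiding Z₂ A₁]
  rw [h, tensorμ_tensorδ]

/-- The interchange of the middle factors is compatible with the symmetries. -/
theorem tensorμ_braiding (Z₁ Z₂ A₁ A₂ : V) :
    tensorμ Z₁ Z₂ A₁ A₂ ≫ ((β_ Z₁ A₁).hom ⊗ₘ (β_ Z₂ A₂).hom) =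
      (β_ _ _).hom ≫ tensorμ A₁ A₂ Z₁ Z₂ := by
  have h : tensorμ Z₁ A₁ Z₂ A₂ ≫ (β_ (Z₁ ⊗ Z₂) (A₁ ⊗ A₂)).hom =
      ((β_ Z₁ A₁).hom ⊗ₘ (β_ Z₂ A₂).hom) ≫ tensorμ A₁ Z₁ A₂ Z₂ := by
    simp [tensorμ, SymmetricCategory.braiding_swap_eq_inv_braiding Z₂ A₁,
      MonoidalCategory.tensorHom_def]
  have h' := congrArg (fun t ↦ tensorμ Z₁ Z₂ A₁ A₂ ≫ t ≫ tensorμ A₁ A₂ Z₁ Z₂) h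
  simp only [Category.assoc, reassoc_of% tensorμ_tensorμ Z₁ Z₂ A₁ A₂,
    tensorμ_tensorμ A₁ Z₁ A₂ Z₂, Category.comp_id] at h'
  exact h'.symm

end Symmetric

variable {V : Type u} [Category.{v} V] [MonoidalCategory V] [SymmetricCategory V]
  [MonoidalClosed V] [HasLimits V] [HasColimits V] {X : Type v}

/-- The canonical map `[A, A'] ⊗ [B, B'] ⟶ [A ⊗ B, A' ⊗ B']` acts by the tensor product of the
actions. -/
theorem uncurry_tensorHom_homTensor {Z Z' A A' B B' : V} (p : Z ⟶ (ihom A).obj A')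
    (q : Z' ⟶ (ihom B).obj B') :
    (β_ _ _).hom ≫ MonoidalClosed.uncurry ((p ⊗ₘ q) ≫ homTensor A A' B B') =
      tensorμ Z Z' A B ≫ (((β_ _ _).hom ≫ MonoidalClosed.uncurry p) ⊗ₘ
        ((β_ _ _).hom ≫ MonoidalClosed.uncurry q)) := by
  rw [MonoidalClosed.uncurry_natural_left, homTensor, MonoidalClosed.uncurry_curry,
    tensorμ_natural_right_assoc, ← reassoc_of% tensorμ_braiding Z Z' A B,
    tensorHom_comp_tensorHom, tensorHom_comp_tensorHom]
  rfl

theorem mono_vmap (A : Word X ⥤ V) {N N' : Word X ⥤ V} (k : N ⟶ N') (hk : ∀ x, Mono (k.app x)) :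
    Mono (vmap (𝟙 A) k) where
  right_cancellation f g h := by
    refine act_ext fun x ↦ ?_
    have := hk x
    have h1 := congrArg (fun t ↦ act t (𝟙 (A.obj x))) h
    simpa [act_vmap, cancel_mono] using h1

/-- The embedding of the end `vhom A K` into a product. -/
def vhomι (A K : Word X ⥤ V) : vhom A K ⟶ ∏ᶜ fun x : Word X ↦ (ihom (A.obj x)).obj (K.obj x) :=
  Pi.lift (vproj A K)

instance vhomι_mono (A K : Word X ⥤ V) : Mono (vhomι A K) where
  right_cancellation f g h := end_.hom_ext fun x ↦ by
    have h1 := congrArg (· ≫ Pi.π _ x) h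
    simp only [vhomι, Category.assoc, Pi.lift_π] at h1
    exact h1

/-- The pairing of ends induced by a pairing `j` of monomorphisms is a monomorphism. The ends embed
into products of internal homs, whose canonical pairing is a monomorphism by hypothesis; the
existence of elements of `F` and `G` is needed for this hypothesis to apply. -/
theorem mono_vpair (hV : CoreflectionHypothesis V) {F G : SMod V X} {M N K : Word X ⥤ V}
    (j : Pairing M N K) (hj : ∀ x y, Mono (j.app x y))
    (hF : ∃ x, Nonempty (𝟙_ V ⟶ F.functor.obj x)) (hG : ∃ x, Nonempty (𝟙_ V ⟶ G.functor.obj x)) :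
    Mono (vpair (F := F) (G := G) j) where
  right_cancellation {Z} f g h := by
    have h1 := (tensorPreservesTowers hV).mono_tensorHom (vhomι F.functor M) (vhomι G.functor N)
    have h2 := hV.mono_homTensor F.functor.obj M.obj G.functor.obj N.obj hF hG
    rw [← cancel_mono (vhomι F.functor M ⊗ₘ vhomι G.functor N),
      ← cancel_mono (homTensorFamily F.functor.obj M.obj G.functor.obj N.obj)]
    refine Pi.hom_ext _ _ fun p ↦ ?_
    obtain ⟨x, y⟩ := p
    have key (f : Z ⟶ vhom F.functor M ⊗ vhom G.functor N) :
        ((f ≫ (vhomι F.functor M ⊗ₘ vhomι G.functor N)) ≫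
          homTensorFamily F.functor.obj M.obj G.functor.obj N.obj) ≫ Pi.π _ (x, y) =
          f ≫ (vproj F.functor M x ⊗ₘ vproj G.functor N y) ≫ homTensor _ _ _ _ := by
      simp only [homTensorFamily, Category.assoc, Pi.lift_π, tensorHom_comp_tensorHom_assoc,
        vhomι]
    rw [key, key]
    apply MonoidalClosed.uncurry_injective
    rw [← cancel_epi (β_ _ _).hom]
    have key₂ (f : Z ⟶ vhom F.functor M ⊗ vhom G.functor N) :
        (β_ _ _).hom ≫ MonoidalClosed.uncurry (f ≫ (vproj F.functor M x ⊗ₘ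
            vproj G.functor N y) ≫ homTensor _ _ _ _) =
          (f ▷ _) ≫ tensorμ _ _ _ _ ≫
            ((vev F.functor M).app x ⊗ₘ (vev G.functor N).app y) := by
      rw [MonoidalClosed.uncurry_natural_left, ← BraidedCategory.braiding_naturality_left_assoc,
        uncurry_tensorHom_homTensor]
      rfl
    have := hj x y
    rw [key₂, key₂, ← cancel_mono (j.app x y)]
    -- Restricted to the pair `(x, y)`, the canonical pairing factors through `vpair j`.
    have key₃ (f : Z ⟶ vhom F.functor M ⊗ vhom G.functor N) :
        ((f ▷ _) ≫ tensorμ _ _ _ _ ≫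
            ((vev F.functor M).app x ⊗ₘ (vev G.functor N).app y)) ≫ j.app x y =
          (Z ◁ dayι F G x y) ≫ ((f ≫ vpair j) ▷ _) ≫ (vev (F ⊗ G).functor K).app (x ⊗ y) := by
      rw [comp_whiskerRight_assoc, whisker_exchange_assoc, vpair_vev]
      simp only [Category.assoc]
    rw [key₃, key₃, h]

theorem mono_vunit {K : Word X ⥤ V} (k : 𝟙_ V ⟶ K.obj (𝟙_ _)) [Mono k] : Mono (vunit k) where
  right_cancellation f g h := by
    have h1 := congrArg (fun t ↦ act t (ν (Word X) V)) h
    have key {Z : V} (f : Z ⟶ 𝟙_ V) : act (f ≫ vunit k) (ν (Word X) V) = (ρ_ _).hom ≫ f ≫ k := by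
      rw [act_comp_left, act_vunit, unitors_equal, rightUnitor_naturality_assoc]
    rw [key, key, cancel_epi, cancel_mono] at h1
    exact h1

/-- The structure maps of the lax monoidal functor `N` are monomorphisms. -/
structure MonoStructure (N : Word X ⥤ V) [N.LaxMonoidal] : Prop where
  ε : Mono (Functor.LaxMonoidal.ε N)
  μ (x y : Word X) : Mono (Functor.LaxMonoidal.μ N x y)

/-- The elements required by the hypothesis on `V` are the identities of the operad. -/
theorem MonoStructure.wedge (hV : CoreflectionHypothesis V) (P : OperadData V X)
    {N : Word X ⥤ V} [N.LaxMonoidal] (hN : MonoStructure N) :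
    MonoStructure ((wedge P.obj).obj N) where
  ε := by
    have := hN.ε
    exact mono_vunit (Functor.LaxMonoidal.ε N)
  μ a b := mono_vpair hV (F := (bigP P.obj).obj a) (G := (bigP P.obj).obj b) (laxPairing N) hN.μ
    ⟨a, ⟨P.ident a⟩⟩ ⟨b, ⟨P.ident b⟩⟩

theorem MonoStructure.epsF (C : X → V) : MonoStructure ((epsF V X).obj C) where
  ε := inferInstanceAs (Mono (𝟙 _))
  μ _ _ := inferInstanceAs (Mono (𝟙 _))

/-- If the lax structure of `M` consists of monomorphisms, then `M(x₁) ⊗ ⋯ ⊗ M(xₙ) ⟶ M(x₁ ⋯ xₙ)` is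
a monomorphism. -/
theorem MonoStructure.kap (hV : TensorPreservesTowers V) {M : Word X ⥤ V} [M.LaxBraided]
    (hM : MonoStructure M) (w : Word X) : Mono ((kap M).app w) := by
  induction w with
  | of y => exact inferInstanceAs (Mono (𝟙 _))
  | unit => exact hM.ε
  | tensor a b ha hb =>
    have h1 := hV.mono_tensorHom ((ColoredOperad.kap M).app a) ((ColoredOperad.kap M).app b)
    have h2 := hM.μ a b
    exact mono_comp ((ColoredOperad.kap M).app a ⊗ₘ (ColoredOperad.kap M).app b)
      (Functor.LaxMonoidal.μ M a b)

/-- The map `α : P^∧_1 P^∧_1 ⟶ P^∧_2` is a monomorphism: it is `π P^∧` applied to `ε π M ⟶ M`, for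
`M = P^∧ ε C`. -/
theorem mono_hatα (hV : CoreflectionHypothesis V) (P : OperadData V X) :
    Mono ((hat P).α (rfl : 1 + 1 = 2)) := by
  have (C : X → V) : Mono (((hat P).α (rfl : 1 + 1 = 2)).app C) := by
    refine mono_family _ fun y ↦ ?_
    have h : (powAdd (wedge P.obj) (rfl : 1 + 1 = 2)).app ((epsF V X).obj C) = 𝟙 _ := by
      refine (powAdd_succ_app (T := wedge P.obj) (rfl : 1 + 0 = 1) rfl _).trans ?_
      refine (congrArg (wedge P.obj).map (powAdd_zero_app rfl _)).trans ?_
      exact (wedge P.obj).map_id _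
    let k := kap ((pow (wedge P.obj) 1).obj ((epsF V X).obj C))
    have e : ((hat P).α (rfl : 1 + 1 = 2)).app C =
        (piF V X).map ((pow (wedge P.obj) 1).map k) :=
      congrArg (piF V X).map ((congrArg (_ ≫ ·) h).trans (Category.comp_id _))
    rw [e]
    have hk := ((MonoStructure.epsF C).wedge hV P).kap (tensorPreservesTowers hV)
    exact mono_vmap _ k hk
  exact NatTrans.mono_of_mono_app _

/-- The face `P^∧_1 ⟶ P^∧_0` is the counit, as `P^∧_0` is the identity. -/
theorem hat_d_zero (P : OperadData V X) : (hat P).d 0 0 = hatCounit P ≫ (hat P).η := by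
  ext C : 2
  exact (Category.comp_id _).symm

theorem hat_η_mono (P : OperadData V X) : Mono (hat P).η := by
  have (C : X → V) : Mono ((hat P).η.app C) := inferInstanceAs (Mono (𝟙 C))
  exact NatTrans.mono_of_mono_app _

end

end ColoredOperad

theorem theorem2 {V : Type u} [Category.{v} V] [MonoidalCategory V] [SymmetricCategory V]
    [MonoidalClosed V] [HasLimits V] [HasColimits V] (hV : CoreflectionHypothesis V)
    {X : Type v} (P : Operad V X) :
    IsLaxComonad (hat P.toOperadData) ∧
    ∃ K : ComonadOn (towerLim (hat P.toOperadData)),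
      K.ε = towerBase (hat P.toOperadData) ≫ hatCounit P.toOperadData ∧
      (∀ k, K.δ ≫ (towerProj (hat P.toOperadData) k ◫ towerProj (hat P.toOperadData) k) =
        towerProj (hat P.toOperadData) (k + 1) ≫ towerδ (hat P.toOperadData) k) ∧
      ∃ Φ : LaxComonadHom (ofComonad K.toComonad) (hat P.toOperadData),
        Φ.app 1 = (Functor.leftUnitor K.toComonad.toFunctor).hom ≫
          towerBase (hat P.toOperadData) ∧
        ∀ (R : Comonad (X → V)) (Ψ : LaxComonadHom (ofComonad R) (hat P.toOperadData)),
          ∃! f : R ⟶ K.toComonad, ∀ n, powMap f.toNatTrans n ≫ Φ.app n = Ψ.app n := by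
  have hL := isLaxComonad_hat P
  exact ⟨hL, exists_coreflection hL (mono_hatα hV P.toOperadData)
    (preservesTowers_hatQ (tensorPreservesTowers hV) P.toOperadData) (hatCounit P.toOperadData)
    (hat_d_zero P.toOperadData) (hat_η_mono P.toOperadData)⟩
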